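/- **Lemma 5.1 (two-dimensional dynamic Gauss formula).** Let $c>0$ and let $S^-\subset\mathbb R^2$ be an open set (bounded or not) whose boundary $S$ is a compact Lyapunov curve, that is, near each of its points $S$ is the graph of a $C^1$ function, $S^-$ lies on one side of it, and the unit normal $n$ to $S$ external to $S^-$ is Hölder continuous on $S$. Put $r=\|x-y\|$, $S_t(x)=\{y\in S: r<ct\}$, $S_t^-(x)=\{y\in S^-: r<ct\}$; let $dS$ be arc length and $dV$ area; let $H_S^-(x)$ be $1$ for $x\in S^-$, $\tfrac12$ for $x\in S$, and $0$ otherwise, and let $H$ be the Heaviside function, $H(0)=\tfrac12$. Then for every $x\in\mathbb R^2$ (in particular also for $x\in S$) $$-\,\mathrm{V.P.}\!\int_{S_t(x)}\frac{1}{\sqrt{1-(r/ct)^2}}\,\frac{\partial}{\partial n(y)}\Big(\ln\frac1r\Big)\,dS(y)+\frac1c\frac{\partial}{\partial t}\int_{S_t^-(x)}\frac{dV(y)}{\sqrt{c^2t^2-r^2}}=2\pi H_S^-(x)H(t),$$ where V.P. denotes the limit, as $\varepsilon\to0+$, of the absolutely convergent integrals over $\{y\in S_t(x): r\ge\varepsilon\}$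 (for $x\notin S$ it is the ordinary integral). The area integral converges absolutely for every $t$, and the formula holds 1. in the classical sense (the principal value and the $t$-derivative exist and satisfy the formula) for every $t\ne0$ such that the circle $\|y-x\|=ct$ is nowhere tangent to $S$; 2. for almost every $t\in\mathbb R$ in the classical sense, almost every $t$ being of the kind described in 1; 3. in the sense of generalized functions of $t$ in $D'(\mathbb R)$: the boundary integral and the area integral are locally integrable functions of $t$, and the formula holds with $\partial/\partial t$ the generalized derivative. -/

import Mathlib

open MeasureTheory Filter Set
open scoped Topology ContDiff

noncomputable section

/-- The Euclidean plane. -/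
abbrev Plane : Type := EuclideanSpace ℝ (Fin 2)

/-- Rotation of a plane vector by a right angle; if `v` is normal to a curve, `perp v` is tangent. -/
def perp (v : Plane) : Plane := !₂[-(v 1), v 0]

/-- `Ω` is an open plane set (a domain `S⁻`, which may be bounded or be the exterior of a bounded
one) whose boundary `S = frontier Ω` is a closed bounded Lyapunov curve, and `n` is its unit normal
external to `Ω`: in the Cartesian frame formed at a boundary point `p` by the tangent
`perp (n p)` and the normal `n p`, the set `Ω` is near `p` the part of the plane that lies
below the graph of a `C¹` function with zero value and zero slope at `p`, and the
normal is Hölder continuous along `S`. The values of `n` off `S` play no role. -/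
structure IsLyapunovDomain (Ω : Set Plane) (n : Plane → Plane) : Prop where
  isOpen : IsOpen Ω
  isCompact_frontier : IsCompact (frontier Ω)
  norm_normal : ∀ p ∈ frontier Ω, ‖n p‖ = 1
  local_graph : ∀ p ∈ frontier Ω, ∃ δ > 0, ∃ η > 0, ∃ f : ℝ → ℝ,
    ContDiffOn ℝ 1 f (Ioo (-δ) δ) ∧ f 0 = 0 ∧ deriv f 0 = 0 ∧
    ∀ s ∈ Ioo (-δ) δ, ∀ h ∈ Ioo (-η) η,
      (p + s • perp (n p) + h • n p ∈ Ω ↔ h < f s)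
  holder_normal : ∃ C α : ℝ, 0 < α ∧ α ≤ 1 ∧
    ∀ p ∈ frontier Ω, ∀ q ∈ frontier Ω, ‖n p - n q‖ ≤ C * ‖p - q‖ ^ α

/-- The characteristic function of `Ω`, with the value `1/2` on the boundary. -/
def domainIndicator (Ω : Set Plane) (x : Plane) : ℝ :=
  open Classical in if x ∈ Ω then 1 else if x ∈ frontier Ω then 1 / 2 else 0

/-- The Heaviside function, with the value `1/2` at `0`. -/
def heavisideHalf (t : ℝ) : ℝ := if 0 < t then 1 else if t = 0 then 1 / 2 else 0

/-- `S_t(x)`: the points of the boundary curve at distance less than `ct` from `x`. -/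
def boundaryPart (Ω : Set Plane) (c : ℝ) (x : Plane) (t : ℝ) : Set Plane :=
  {y | y ∈ frontier Ω ∧ ‖x - y‖ < c * t}

/-- `S_t⁻(x)`: the points of the domain at distance less than `ct` from `x`. -/
def domainPart (Ω : Set Plane) (c : ℝ) (x : Plane) (t : ℝ) : Set Plane :=
  {y | y ∈ Ω ∧ ‖x - y‖ < c * t}

/-- `(1 - (r/ct)²)^(-1/2) ∂/∂n(y) (ln (1/r))` with `r = ‖x - y‖`, as a function of `y`. -/
def boundaryKernel (n : Plane → Plane) (c : ℝ) (x : Plane) (t : ℝ) (y : Plane) : ℝ :=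
  1 / √(1 - (‖x - y‖ / (c * t)) ^ 2) *
    lineDeriv ℝ (fun z : Plane => Real.log (1 / ‖x - z‖)) y (n y)

/-- `(c²t² - r²)^(-1/2)` with `r = ‖x - y‖`, as a function of `y`. -/
def areaKernel (c : ℝ) (x : Plane) (t : ℝ) (y : Plane) : ℝ :=
  1 / √(c ^ 2 * t ^ 2 - ‖x - y‖ ^ 2)

/-- The area integral of `(c²t² - r²)^(-1/2)` over `S_t⁻(x)`. -/
def areaIntegral (Ω : Set Plane) (c : ℝ) (x : Plane) (t : ℝ) : ℝ :=
  ∫ y in domainPart Ω c x t, areaKernel c x t y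

/-- `I` is the principal value at `x` of the integral over the set `T` of the curve, with respect
to arc length (the one-dimensional Hausdorff measure), of `k`: the limit, as `ε → 0+`, of the
(absolutely convergent) integrals over the points of `T` at distance at least `ε` from `x`. -/
def HasPrincipalValue (k : Plane → ℝ) (T : Set Plane) (x : Plane) (I : ℝ) : Prop :=
  (∀ ε > 0, IntegrableOn k (T \ Metric.ball x ε) (Measure.hausdorffMeasure 1)) ∧
  Tendsto (fun ε : ℝ => ∫ y in T \ Metric.ball x ε, k y ∂(Measure.hausdorffMeasure 1))
    (𝓝[>] 0) (𝓝 I)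

/-- The circle of centre `x` and radius `ct` (the wave front at time `t`) is nowhere tangent to the
boundary of `Ω`. -/
def FrontTransversal (Ω : Set Plane) (n : Plane → Plane) (c : ℝ) (x : Plane) (t : ℝ) : Prop :=
  ∀ y ∈ frontier Ω, ‖x - y‖ = c * t → inner ℝ (x - y) (perp (n y)) ≠ 0

/-- The formula at the time `t`, in the classical sense: the principal value integral over `S_t(x)`
exists and equals `b`, the area integral over `S_t⁻(x)` is differentiable in `t`, and
`- b + c⁻¹ ∂/∂t (area integral) = 2π H_S⁻(x) H(t)`. -/
def GaussFormulaAt (Ω : Set Plane) (n : Plane → Plane) (c : ℝ) (x : Plane) (t b : ℝ) : Prop :=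
  HasPrincipalValue (boundaryKernel n c x t) (boundaryPart Ω c x t) x b ∧
  ∃ D : ℝ, HasDerivAt (areaIntegral Ω c x) D t ∧
    -b + 1 / c * D = 2 * Real.pi * domainIndicator Ω x * heavisideHalf t

end

/-!
Write `r = ‖y - x‖` and `τ = c t`. The normal derivative of `ln (1 / r)` is `-κ`, where
`κ dS = ⟪y - x, n⟫ / r² dS` is the angle form, and the proof is an integrated form of the statement
that `κ dS` is the flux of the field `(y - x) / r²`, whose divergence is `2π` times the point mass
at `x`.

*Gauss' formula with a radial weight.* For `g` of class `C¹` that vanishes for large arguments,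
`∫_S g(r²) κ dS = ∫_Ω 2 g'(r²) dV + 2π H(x) g(0)` (`integral_weight_angleKernel`). It is the
Gauss–Green formula for the field `g(r²) (y - x) / r²`, cut off near `x`; in the limit the
derivative of the cut-off sees only the blow-up of `Ω` at `x`, which is the plane, a half-plane or
empty (`exists_blowup`), and this gives the factor `H(x)`. On the boundary, `κ` is absolutely
integrable also for `x ∈ S`, because the normal is Hölder continuous (`integrable_angleKernel`).
The Gauss–Green formula itself (`gauss_green`) is reduced by a partition of unity to the region
below a graph; that the one-dimensional Hausdorff measure of a graph is `∫ √(1 + f'²)` is the case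
needed of the area formula (`comap_hausdorffMeasure_eq`).

*The area integral as a primitive.* With `C¹` approximations of the weight `√(τ² - r²)` the formula
becomes `A(τ) = 2π H(x) τ - ∫_S √(τ² - r²) κ dS` for the area integral `A` (`integral_area_eq`).
Since `√(τ² - r²)` is the integral over `σ ∈ (r, τ)` of `σ / √(σ² - r²)`, Fubini's theorem shows that
`A` is the primitive of `2π H(x)` plus the boundary integral, and that the latter is locally
integrable in time (`areaIntegral_eq`). Integration by parts for absolutely continuous functions
gives the formula in the sense of generalized functions.

*Classical times.* Where the circle `r = τ` is nowhere tangent to `S`, the distance `r` is a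
bi-Lipschitz parameter of `S` near the circle, so there the boundary integral is dominated by an
integral in `r`, in which the kernel `τ / √(τ² - r²)` depends continuously on `τ` in `L¹`. Hence the
boundary integral converges absolutely and is continuous at `τ`
(`integrable_and_continuousAt_frontIntegral`), and the primitive can be differentiated there. The
remaining times are critical values of a `C¹` function of one variable, a null set by Sard's lemma
(`ae_frontTransversal`).
-/

noncomputable section

/-! ### Frames and local graphs -/

lemma perp_apply_zero (v : Plane) : perp v 0 = -(v 1) := rfl

lemma perp_apply_one (v : Plane) : perp v 1 = v 0 := rfl

lemma plane_inner (v w : Plane) : inner ℝ v w = v 0 * w 0 + v 1 * w 1 := by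
  simp [PiLp.inner_apply, Fin.sum_univ_two]; ring

lemma plane_norm_sq (v : Plane) : ‖v‖ ^ 2 = v 0 ^ 2 + v 1 ^ 2 := by
  simp [EuclideanSpace.norm_sq_eq, Fin.sum_univ_two]

lemma inner_perp_self (v : Plane) : inner ℝ v (perp v) = 0 := by
  rw [plane_inner, perp_apply_zero, perp_apply_one]; ring

lemma norm_perp (v : Plane) : ‖perp v‖ = ‖v‖ := by
  have h : ‖perp v‖ ^ 2 = ‖v‖ ^ 2 := by
    rw [plane_norm_sq, plane_norm_sq, perp_apply_zero, perp_apply_one]; ring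
  exact (pow_left_inj₀ (norm_nonneg _) (norm_nonneg _) two_ne_zero).1 h

/-- The point with coordinates `z = (s, h)` in the Cartesian frame at `p` whose axes are the tangent
`perp ν` and the normal `ν`. -/
def frame (p ν : Plane) (z : ℝ × ℝ) : Plane := p + z.1 • perp ν + z.2 • ν

/-- The linear part of `frame`. -/
def frameVec (ν : Plane) (z : ℝ × ℝ) : Plane := z.1 • perp ν + z.2 • ν

lemma frame_eq (p ν : Plane) (z : ℝ × ℝ) : frame p ν z = p + frameVec ν z := by
  simp [frame, frameVec, add_assoc]

section Frame

variable {ν : Plane} (hν : ‖ν‖ = 1)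
include hν

lemma unit_sq : ν 0 ^ 2 + ν 1 ^ 2 = 1 := by
  rw [← plane_norm_sq, hν]; norm_num

lemma inner_frameVec (z w : ℝ × ℝ) :
    inner ℝ (frameVec ν z) (frameVec ν w) = z.1 * w.1 + z.2 * w.2 := by
  have := unit_sq hν
  simp only [plane_inner, frameVec, PiLp.add_apply, PiLp.smul_apply, perp_apply_zero,
    perp_apply_one, smul_eq_mul]
  linear_combination (z.1 * w.1 + z.2 * w.2) * this

lemma norm_frameVec_sq (z : ℝ × ℝ) : ‖frameVec ν z‖ ^ 2 = z.1 ^ 2 + z.2 ^ 2 := by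
  rw [← real_inner_self_eq_norm_sq, inner_frameVec hν]; ring

lemma norm_frameVec (z : ℝ × ℝ) : ‖frameVec ν z‖ = √(z.1 ^ 2 + z.2 ^ 2) := by
  rw [← norm_frameVec_sq hν, Real.sqrt_sq (norm_nonneg _)]

lemma inner_frameVec_perp (z : ℝ × ℝ) : inner ℝ (frameVec ν z) (perp ν) = z.1 := by
  have := inner_frameVec hν z (1, 0)
  simpa [frameVec] using this

lemma inner_frameVec_normal (z : ℝ × ℝ) : inner ℝ (frameVec ν z) ν = z.2 := by
  have := inner_frameVec hν z (0, 1)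
  simpa [frameVec] using this

lemma frameVec_inner (v : Plane) : frameVec ν (inner ℝ v (perp ν), inner ℝ v ν) = v := by
  have h := unit_sq hν
  ext i
  fin_cases i
  · simp only [plane_inner, frameVec, perp_apply_zero, perp_apply_one, PiLp.add_apply,
      PiLp.smul_apply, smul_eq_mul, Fin.zero_eta, Fin.isValue]
    linear_combination (v 0) * h
  · simp only [plane_inner, frameVec, perp_apply_zero, perp_apply_one, PiLp.add_apply,
      PiLp.smul_apply, smul_eq_mul, Fin.mk_one, Fin.isValue]
    linear_combination (v 1) * h

lemma frame_inner (p q : Plane) :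
    frame p ν (inner ℝ (q - p) (perp ν), inner ℝ (q - p) ν) = q := by
  rw [frame_eq, frameVec_inner hν]; abel

lemma inner_frame_sub_perp (p : Plane) (z : ℝ × ℝ) :
    inner ℝ (frame p ν z - p) (perp ν) = z.1 := by
  rw [frame_eq, add_sub_cancel_left, inner_frameVec_perp hν]

lemma inner_frame_sub_normal (p : Plane) (z : ℝ × ℝ) :
    inner ℝ (frame p ν z - p) ν = z.2 := by
  rw [frame_eq, add_sub_cancel_left, inner_frameVec_normal hν]

omit hν in
lemma frame_sub_frame (p : Plane) (z w : ℝ × ℝ) :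
    frame p ν z - frame p ν w = frameVec ν (z - w) := by
  simp only [frame, frameVec, Prod.fst_sub, Prod.snd_sub]; module

lemma frameVec_measurePreserving : MeasurePreserving (frameVec ν) := by
  let L : Plane →ₗᵢ[ℝ] Plane :=
    { toFun := fun v => frameVec ν (v 0, v 1)
      map_add' := fun v w => by simp only [frameVec, PiLp.add_apply]; module
      map_smul' := fun a v => by
        simp only [frameVec, PiLp.smul_apply, smul_eq_mul, RingHom.id_apply]; module
      norm_map' := fun v => by
        have h := norm_frameVec_sq hν (v 0, v 1)
        rw [← plane_norm_sq] at h
        exact (pow_left_inj₀ (norm_nonneg _) (norm_nonneg _) two_ne_zero).1 h }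
  let e : Plane ≃ₗᵢ[ℝ] Plane := L.toLinearIsometryEquiv rfl
  have h1 : MeasurePreserving e := e.measurePreserving
  have h2 := PiLp.volume_preserving_toLp (Fin 2)
  have h3 := (volume_preserving_finTwoArrow ℝ).symm
  exact h1.comp (h2.comp h3)

lemma frame_measurePreserving (p : Plane) : MeasurePreserving (frame p ν) := by
  have h := (measurePreserving_add_left (volume : Measure Plane) p).comp
    (frameVec_measurePreserving hν)
  have he : frame p ν = (fun x => p + x) ∘ frameVec ν := funext fun z => frame_eq p ν z
  rw [he]
  exact h

omit hν in
lemma continuous_frame (p : Plane) : Continuous (frame p ν) := by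
  unfold frame; fun_prop

end Frame

/-- The open rectangle of half-sides `δ` (tangential) and `η` (normal) about `p`. -/
def frameBox (p ν : Plane) (δ η : ℝ) : Set Plane :=
  {q | |inner ℝ (q - p) (perp ν)| < δ ∧ |inner ℝ (q - p) ν| < η}

lemma isOpen_frameBox (p ν : Plane) (δ η : ℝ) : IsOpen (frameBox p ν δ η) := by
  unfold frameBox
  apply IsOpen.and <;> exact isOpen_lt (by fun_prop) continuous_const

lemma self_mem_frameBox (p ν : Plane) {δ η : ℝ} (hδ : 0 < δ) (hη : 0 < η) :
    p ∈ frameBox p ν δ η := by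
  simp [frameBox, hδ, hη]

lemma frame_mem_frameBox {p ν : Plane} (hν : ‖ν‖ = 1) {δ η : ℝ} {z : ℝ × ℝ} :
    frame p ν z ∈ frameBox p ν δ η ↔ |z.1| < δ ∧ |z.2| < η := by
  simp only [frameBox, mem_ofPred_eq, inner_frame_sub_perp hν, inner_frame_sub_normal hν]

/-- `Ω` is, in the rectangle of half-sides `δ`, `η` about `p`, the part below the graph of `f` in the
frame with normal `ν`; here `f` is defined on the whole line, of class `C¹` and `1`-Lipschitz, and
its graph over `(-δ, δ)` stays in the rectangle. -/
structure IsGraphBox (Ω : Set Plane) (p ν : Plane) (δ η : ℝ) (f : ℝ → ℝ) : Prop where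
  norm_normal : ‖ν‖ = 1
  pos_left : 0 < δ
  pos_right : 0 < η
  contDiff : ContDiff ℝ 1 f
  zero : f 0 = 0
  deriv_zero : deriv f 0 = 0
  abs_deriv_le : ∀ s, |deriv f s| ≤ 1
  abs_apply_lt : ∀ s, |s| < δ → |f s| < η
  mem_iff : ∀ s h : ℝ, |s| < δ → |h| < η → (frame p ν (s, h) ∈ Ω ↔ h < f s)

/-- The parametrisation of a graph by the abscissa. -/
def graphCurve (p ν : Plane) (f : ℝ → ℝ) (s : ℝ) : Plane := frame p ν (s, f s)

/-- Extending the derivative of the given local graph by constants makes the graph global. -/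
lemma exists_isGraphBox {Ω : Set Plane} {n : Plane → Plane} (hΩ : IsLyapunovDomain Ω n)
    {p : Plane} (hp : p ∈ frontier Ω) : ∃ δ η f, IsGraphBox Ω p (n p) δ η f := by
  obtain ⟨δ, hδ, η, hη, f, hf, hf0, hf0', hmem⟩ := hΩ.local_graph p hp
  have hcont : ContinuousOn (deriv f) (Ioo (-δ) δ) :=
    hf.continuousOn_deriv_of_isOpen isOpen_Ioo le_rfl
  have hdiff : ∀ s ∈ Ioo (-δ) δ, DifferentiableAt ℝ f s := fun s hs =>
    (hf.differentiableOn one_ne_zero).differentiableAt (isOpen_Ioo.mem_nhds hs)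
  have h0 : (0 : ℝ) ∈ Ioo (-δ) δ := ⟨by linarith, hδ⟩
  have hc0 : ContinuousAt (deriv f) 0 := hcont.continuousAt (isOpen_Ioo.mem_nhds h0)
  have hev : ∀ᶠ s in 𝓝 (0 : ℝ), |deriv f s| < 1 := by
    have : Tendsto (fun s => |deriv f s|) (𝓝 0) (𝓝 |deriv f 0|) := hc0.abs
    rw [hf0', abs_zero] at this
    exact this.eventually_lt_const one_pos
  obtain ⟨e, he, hev⟩ := Metric.eventually_nhds_iff.1 hev
  obtain ⟨a, ha0, haδ, hae, haη⟩ : ∃ a : ℝ, 0 < a ∧ a < δ ∧ a < e ∧ a < η := by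
    refine ⟨min δ (min e η) / 2, ?_, ?_, ?_, ?_⟩
    · positivity
    all_goals
      have : 0 < min δ (min e η) := by positivity
      have h1 := min_le_left δ (min e η)
      have h2 := (min_le_right δ (min e η)).trans (min_le_left _ _)
      have h3 := (min_le_right δ (min e η)).trans (min_le_right _ _)
      linarith
  have hsub : Icc (-a) a ⊆ Ioo (-δ) δ := fun s hs => ⟨by linarith [hs.1], by linarith [hs.2]⟩
  -- the derivative, extended by constants
  let d : ℝ → ℝ := fun s => deriv f (max (-a) (min a s))
  have hclamp : ∀ s, max (-a) (min a s) ∈ Icc (-a) a := fun s =>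
    ⟨le_max_left _ _, max_le (by linarith) (min_le_left _ _)⟩
  have hd : Continuous d := by
    refine continuous_iff_continuousAt.2 fun s => ?_
    have h1 : ContinuousAt (deriv f) (max (-a) (min a s)) :=
      hcont.continuousAt (isOpen_Ioo.mem_nhds (hsub (hclamp s)))
    exact ContinuousAt.comp (f := fun s => max (-a) (min a s)) h1 (by fun_prop)
  have hdle : ∀ s, |d s| ≤ 1 := fun s => by
    have h1 := hclamp s
    refine (hev ?_).le
    rw [Real.dist_eq, sub_zero]
    exact (abs_le.2 h1).trans_lt hae
  have hdeq : ∀ s ∈ Icc (-a) a, d s = deriv f s := fun s hs => by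
    simp only [d]
    rw [min_eq_right hs.2, max_eq_right hs.1]
  let g : ℝ → ℝ := fun s => ∫ u in (0 : ℝ)..s, d u
  have hg' : ∀ s, HasDerivAt g (d s) s := fun s =>
    intervalIntegral.integral_hasDerivAt_right (hd.intervalIntegrable _ _)
      (hd.stronglyMeasurableAtFilter _ _) hd.continuousAt
  have hgd : deriv g = d := funext fun s => (hg' s).deriv
  have hgf : ∀ s ∈ Icc (-a) a, g s = f s := by
    intro s hs
    have hsubs : uIcc 0 s ⊆ Icc (-a) a := by
      apply uIcc_subset_Icc _ hs
      exact ⟨by linarith, ha0.le⟩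
    have h1 : g s = ∫ u in (0 : ℝ)..s, deriv f u :=
      intervalIntegral.integral_congr fun u hu => hdeq u (hsubs hu)
    rw [h1, intervalIntegral.integral_deriv_eq_sub
      (fun u hu => hdiff u (hsub (hsubs hu)))
      ((hcont.mono (hsubs.trans hsub)).intervalIntegrable), hf0, sub_zero]
  have hgle : ∀ s, |g s| ≤ |s| := fun s => by
    have := intervalIntegral.norm_integral_le_of_norm_le_const (a := 0) (b := s) (f := d) (C := 1)
      (fun u _ => hdle u)
    simpa using this
  refine ⟨a, η, g, hΩ.norm_normal p hp, ha0, hη, ?_, by simp [g], ?_, ?_, ?_, ?_⟩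
  · rw [contDiff_one_iff_deriv]
    exact ⟨fun s => (hg' s).differentiableAt, by rw [hgd]; exact hd⟩
  · rw [hgd, hdeq 0 ⟨by linarith, ha0.le⟩, hf0']
  · rw [hgd]; exact hdle
  · intro s hs
    linarith [hgle s]
  · intro s h hs hh
    have hs' := abs_lt.1 hs
    rw [hgf s ⟨hs'.1.le, hs'.2.le⟩]
    exact hmem s ⟨by linarith, by linarith⟩ h (abs_lt.1 hh)

lemma graphCurve_sub (p ν : Plane) (f : ℝ → ℝ) (s t : ℝ) :
    graphCurve p ν f s - graphCurve p ν f t = frameVec ν (s - t, f s - f t) :=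
  frame_sub_frame p _ _

namespace IsGraphBox

variable {Ω : Set Plane} {p ν : Plane} {δ η : ℝ} {f : ℝ → ℝ} (hG : IsGraphBox Ω p ν δ η f)
include hG

lemma hasDerivAt (s : ℝ) : HasDerivAt f (deriv f s) s :=
  (hG.contDiff.differentiable one_ne_zero s).hasDerivAt

lemma continuous : Continuous f := hG.contDiff.continuous

lemma continuous_deriv : Continuous (deriv f) := hG.contDiff.continuous_deriv le_rfl

lemma abs_sub_le (s t : ℝ) : |f s - f t| ≤ |s - t| := by
  have := Convex.norm_image_sub_le_of_norm_deriv_le (f := f) (C := 1) (s := univ) (x := t) (y := s)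
    (fun x _ => (hG.hasDerivAt x).differentiableAt) (fun x _ => hG.abs_deriv_le x) convex_univ
    (mem_univ _) (mem_univ _)
  simpa using this

lemma abs_sub_le_dist (s t : ℝ) : |s - t| ≤ ‖graphCurve p ν f s - graphCurve p ν f t‖ := by
  rw [graphCurve_sub, norm_frameVec hG.norm_normal]
  apply Real.le_sqrt_of_sq_le
  rw [sq_abs]
  nlinarith [sq_nonneg (f s - f t)]

lemma dist_le (s t : ℝ) : ‖graphCurve p ν f s - graphCurve p ν f t‖ ≤ 2 * |s - t| := by
  rw [graphCurve_sub, norm_frameVec hG.norm_normal]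
  apply Real.sqrt_le_iff.2 ⟨by positivity, ?_⟩
  have := pow_le_pow_left₀ (abs_nonneg _) (hG.abs_sub_le s t) 2
  rw [sq_abs] at this
  rw [mul_pow, sq_abs]
  rw [sq_abs] at this
  simp only
  nlinarith [sq_nonneg (s - t)]

lemma curve_hasDerivAt (s : ℝ) :
    HasDerivAt (graphCurve p ν f) (frameVec ν (1, deriv f s)) s := by
  have h1 : HasDerivAt (fun s : ℝ => s • perp ν) ((1 : ℝ) • perp ν) s :=
    (hasDerivAt_id s).smul_const _
  have h2 := (hG.hasDerivAt s).smul_const ν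
  exact (h1.const_add p).add h2

lemma curve_mem_box {s : ℝ} (hs : |s| < δ) : graphCurve p ν f s ∈ frameBox p ν δ η :=
  (frame_mem_frameBox hG.norm_normal).2 ⟨hs, hG.abs_apply_lt s hs⟩

lemma frame_mem_frontier_iff {s h : ℝ} (hs : |s| < δ) (hh : |h| < η) :
    frame p ν (s, h) ∈ frontier Ω ↔ h = f s := by
  have hbox : ∀ᶠ z : ℝ × ℝ in 𝓝 (s, h), |z.1| < δ ∧ |z.2| < η := by
    apply Filter.Eventually.and
    · exact (continuous_fst.abs.tendsto (s, h)).eventually_lt_const hs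
    · exact (continuous_snd.abs.tendsto (s, h)).eventually_lt_const hh
  have hfc : Continuous fun z : ℝ × ℝ => f z.1 := hG.continuous.comp continuous_fst
  -- `frame` is a homeomorphism: neighbourhoods can be tested in coordinates
  have key : ∀ P : Plane → Prop, (∀ᶠ z : ℝ × ℝ in 𝓝 (s, h), P (frame p ν z)) →
      ∀ᶠ q in 𝓝 (frame p ν (s, h)), P q := by
    intro P hP
    have hc : Continuous fun q : Plane => ((inner ℝ (q - p) (perp ν) : ℝ), (inner ℝ (q - p) ν : ℝ)) := by
      fun_prop
    have ht := hc.tendsto (frame p ν (s, h))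
    rw [inner_frame_sub_perp hG.norm_normal, inner_frame_sub_normal hG.norm_normal] at ht
    filter_upwards [ht.eventually hP] with q hq
    rwa [frame_inner hG.norm_normal] at hq
  rcases lt_trichotomy h (f s) with hlt | heq | hgt
  · refine iff_of_false (fun hfr => ?_) hlt.ne
    have : ∀ᶠ q in 𝓝 (frame p ν (s, h)), q ∈ Ω := by
      apply key
      filter_upwards [hbox, (continuous_snd.tendsto (s, h)).eventually_lt (hfc.tendsto (s, h)) hlt]
        with z hz hz'
      exact (hG.mem_iff z.1 z.2 hz.1 hz.2).2 hz'
    exact hfr.2 (mem_interior_iff_mem_nhds.2 this)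
  · refine iff_of_true ⟨?_, fun hint => ?_⟩ heq
    · subst heq
      have hc : Tendsto (fun k : ℝ => frame p ν (s, f s - k)) (𝓝[>] 0) (𝓝 (frame p ν (s, f s))) := by
        have : Continuous (fun k : ℝ => frame p ν (s, f s - k)) :=
          (continuous_frame p).comp (by fun_prop)
        have h2 := (this.tendsto 0).mono_left (nhdsWithin_le_nhds (s := Ioi 0))
        simpa using h2
      refine mem_closure_of_tendsto hc ?_
      have h1 : ∀ᶠ k : ℝ in 𝓝[>] 0, |f s - k| < η := by
        have : Continuous fun k : ℝ => |f s - k| := by fun_prop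
        have h2 := (this.tendsto 0).mono_left (nhdsWithin_le_nhds (s := Ioi 0))
        exact h2.eventually_lt_const (by simpa using hh)
      filter_upwards [h1, self_mem_nhdsWithin] with k hk hk0
      exact (hG.mem_iff s _ hs hk).2 (by simpa using hk0)
    · have := interior_subset hint
      rw [hG.mem_iff s h hs hh] at this
      exact this.ne heq
  · refine iff_of_false (fun hfr => ?_) hgt.ne'
    have : ∀ᶠ q in 𝓝 (frame p ν (s, h)), q ∉ Ω := by
      apply key
      filter_upwards [hbox, (hfc.tendsto (s, h)).eventually_lt (continuous_snd.tendsto (s, h)) hgt]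
        with z hz hz'
      rw [hG.mem_iff z.1 z.2 hz.1 hz.2]
      exact not_lt.2 (le_of_lt hz')
    exact (mem_closure_iff_frequently.1 hfr.1) this

lemma curve_mem_frontier {s : ℝ} (hs : |s| < δ) : graphCurve p ν f s ∈ frontier Ω :=
  (hG.frame_mem_frontier_iff hs (hG.abs_apply_lt s hs)).2 rfl

lemma frontier_inter_box :
    frontier Ω ∩ frameBox p ν δ η = graphCurve p ν f '' Ioo (-δ) δ := by
  ext q
  constructor
  · rintro ⟨hq, hb⟩
    have h := frame_inner hG.norm_normal p q
    rw [← h, hG.frame_mem_frontier_iff hb.1 hb.2] at hq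
    refine ⟨_, abs_lt.1 hb.1, ?_⟩
    rw [graphCurve, ← hq, h]
  · rintro ⟨s, hs, rfl⟩
    have hs' := abs_lt.2 hs
    exact ⟨hG.curve_mem_frontier hs', hG.curve_mem_box hs'⟩

/-- Seen from a boundary point in a direction `v` that is not tangent there, `Ω` is the half-plane
below the tangent `(1, f' s)`. -/
lemma eventually_mem_iff {s : ℝ} (hs : |s| < δ) {v : Plane}
    (hv : inner ℝ v (frameVec ν (-deriv f s, 1)) ≠ 0) :
    ∀ᶠ ε : ℝ in 𝓝[>] 0, (graphCurve p ν f s + ε • v ∈ Ω ↔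
      inner ℝ v (frameVec ν (-deriv f s, 1)) < 0) := by
  set a : ℝ := inner ℝ v (perp ν)
  set b : ℝ := inner ℝ v ν
  have hvab : frameVec ν (a, b) = v := frameVec_inner hG.norm_normal v
  have hin : inner ℝ v (frameVec ν (-deriv f s, 1)) = b - deriv f s * a := by
    rw [← hvab, inner_frameVec hG.norm_normal]; simp only; ring
  rw [hin] at hv ⊢
  have hpt : ∀ ε : ℝ, graphCurve p ν f s + ε • v = frame p ν (s + ε * a, f s + ε * b) := by
    intro ε
    rw [← hvab]
    simp only [graphCurve, frame, frameVec]
    module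
  have h1 : ∀ᶠ ε : ℝ in 𝓝[>] 0, |s + ε * a| < δ := by
    have : Continuous fun ε : ℝ => |s + ε * a| := by fun_prop
    exact ((this.tendsto 0).mono_left nhdsWithin_le_nhds).eventually_lt_const (by simpa using hs)
  have h2 : ∀ᶠ ε : ℝ in 𝓝[>] 0, |f s + ε * b| < η := by
    have : Continuous fun ε : ℝ => |f s + ε * b| := by fun_prop
    exact ((this.tendsto 0).mono_left nhdsWithin_le_nhds).eventually_lt_const
      (by simpa using hG.abs_apply_lt s hs)
  have hder : HasDerivAt (fun ε : ℝ => f (s + ε * a)) (deriv f s * a) 0 := by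
    have hi : HasDerivAt (fun ε : ℝ => s + ε * a) a 0 := by
      simpa using ((hasDerivAt_id (0 : ℝ)).mul_const a).const_add s
    have := hG.hasDerivAt s
    have h3 : HasDerivAt f (deriv f s) (s + 0 * a) := by simpa using this
    exact h3.comp 0 hi
  have hslope : Tendsto (fun ε : ℝ => b - ε⁻¹ * (f (s + ε * a) - f s)) (𝓝[>] 0)
      (𝓝 (b - deriv f s * a)) := by
    have := hder.tendsto_slope_zero_right
    simp only [zero_add, zero_mul, add_zero, smul_eq_mul] at this
    exact tendsto_const_nhds.sub this
  rcases lt_or_gt_of_ne hv with hlt | hgt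
  · filter_upwards [h1, h2, hslope.eventually_lt_const hlt, self_mem_nhdsWithin]
      with ε e1 e2 e3 e4
    have e4' : (0 : ℝ) < ε := e4
    rw [hpt, hG.mem_iff _ _ e1 e2]
    refine iff_of_true ?_ hlt
    have := mul_neg_of_pos_of_neg e4' e3
    rw [mul_sub, ← mul_assoc, mul_inv_cancel₀ e4'.ne'] at this
    linarith
  · filter_upwards [h1, h2, hslope.eventually_const_lt hgt, self_mem_nhdsWithin]
      with ε e1 e2 e3 e4
    have e4' : (0 : ℝ) < ε := e4
    rw [hpt, hG.mem_iff _ _ e1 e2]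
    refine iff_of_false ?_ hgt.not_gt
    have := mul_pos e4' e3
    rw [mul_sub, ← mul_assoc, mul_inv_cancel₀ e4'.ne'] at this
    linarith

lemma curve_zero : graphCurve p ν f 0 = p := by
  simp [graphCurve, frame, hG.zero]

lemma eventually_mem_iff_base {v : Plane} (hv : inner ℝ v ν ≠ 0) :
    ∀ᶠ ε : ℝ in 𝓝[>] 0, (p + ε • v ∈ Ω ↔ inner ℝ v ν < 0) := by
  have h := hG.eventually_mem_iff (s := 0) (by simpa using hG.pos_left) (v := v)
  simpa [hG.curve_zero, hG.deriv_zero, frameVec, hv] using h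

/-- The prescribed normal is the normal of the graph: otherwise the difference of the two unit
normals would point into `Ω` according to one graph and out of `Ω` according to the other. -/
lemma normal_curve {n : Plane → Plane} (hΩ : IsLyapunovDomain Ω n) {s : ℝ} (hs : |s| < δ) :
    √(1 + deriv f s ^ 2) • n (graphCurve p ν f s) = frameVec ν (-deriv f s, 1) := by
  set w : ℝ := √(1 + deriv f s ^ 2)
  have hw2 : w ^ 2 = 1 + deriv f s ^ 2 := Real.sq_sqrt (by positivity)
  have hw : 0 < w := Real.sqrt_pos.2 (by positivity)
  set N : Plane := frameVec ν (-deriv f s, 1)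
  set q := graphCurve p ν f s
  have hq : q ∈ frontier Ω := hG.curve_mem_frontier hs
  obtain ⟨δ', η', f', hG'⟩ := exists_isGraphBox hΩ hq
  have hn : ‖n q‖ = 1 := hG'.norm_normal
  have hN : ‖N‖ = w := by
    rw [norm_frameVec hG.norm_normal]
    simp only [w]; congr 1; ring
  by_contra hne
  have hlt : inner ℝ N (n q) < w := by
    have h1 : inner ℝ N (n q) ≤ w := by
      have := real_inner_le_norm N (n q)
      rwa [hN, hn, mul_one] at this
    refine lt_of_le_of_ne h1 fun h => hne ?_
    have h2 : ‖w • n q - N‖ ^ 2 = 0 := by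
      rw [norm_sub_sq_real, norm_smul, Real.norm_of_nonneg hw.le, hn, hN, real_inner_smul_left,
        real_inner_comm, h]
      ring
    exact sub_eq_zero.1 (norm_eq_zero.1 (pow_eq_zero_iff two_ne_zero |>.1 h2))
  have h1 : inner ℝ (N - w • n q) (n q) < 0 := by
    rw [inner_sub_left, real_inner_smul_left, real_inner_self_eq_norm_sq, hn]
    linarith
  have h2 : 0 < inner ℝ (N - w • n q) N := by
    rw [inner_sub_left, real_inner_smul_left, real_inner_self_eq_norm_sq, hN,
      real_inner_comm]
    nlinarith
  have e1 := hG'.eventually_mem_iff_base h1.ne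
  have e2 := hG.eventually_mem_iff hs h2.ne'
  obtain ⟨ε, e3, e4⟩ := (e1.and e2).exists
  exact h2.not_gt (e4.1 (e3.2 h1))

end IsGraphBox

/-! ### Arc length -/

lemma hausdorffMeasure_le_of_antilipschitzOn {X Y : Type*} [MetricSpace X] [MeasurableSpace X]
    [BorelSpace X] [MetricSpace Y] [MeasurableSpace Y] [BorelSpace Y] {f : X → Y} {s : Set X}
    {K : NNReal} (hf : ∀ x ∈ s, ∀ y ∈ s, dist x y ≤ K * dist (f x) (f y)) {d : ℝ} (hd : 0 ≤ d) :
    Measure.hausdorffMeasure d s ≤ (K : ENNReal) ^ d * Measure.hausdorffMeasure d (f '' s) := by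
  have h1 : AntilipschitzWith K (fun x : s => f x) :=
    AntilipschitzWith.of_le_mul_dist fun x y => hf x x.2 y y.2
  have h2 := h1.le_hausdorffMeasure_image hd univ
  have h3 := (isometry_subtype_coe (s := s)).hausdorffMeasure_image (d := d) (Or.inl hd) univ
  rw [image_univ, Subtype.range_coe] at h3
  rw [image_univ] at h2
  rw [h3, image_eq_range]
  exact h2

lemma Measure.le_of_locally_le {X : Type*} [TopologicalSpace X] [SecondCountableTopology X]
    [MeasurableSpace X] [OpensMeasurableSpace X] {μ ν : Measure X}
    (h : ∀ x, ∃ U, IsOpen U ∧ x ∈ U ∧ ∀ E ⊆ U, MeasurableSet E → μ E ≤ ν E) : μ ≤ ν := by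
  choose U hU hxU hle using h
  obtain ⟨T, hT, hTU⟩ := TopologicalSpace.countable_cover_nhds fun x => (hU x).mem_nhds (hxU x)
  rcases T.eq_empty_or_nonempty with rfl | hne
  · have : (univ : Set X) = ∅ := by rw [← hTU]; simp
    rw [Measure.le_iff]
    intro s _
    rw [show s = ∅ from subset_empty_iff.1 (this ▸ subset_univ s)]
    simp
  obtain ⟨e, rfl⟩ := hT.exists_eq_range hne
  have hcov : ⋃ k, U (e k) = univ := by rw [← hTU, biUnion_range]
  rw [Measure.le_iff]
  intro E hE
  have hm : ∀ k, MeasurableSet (disjointed (fun k => U (e k)) k) := fun k =>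
    MeasurableSet.disjointed (fun i => (hU (e i)).measurableSet) k
  have hEk : E = ⋃ k, E ∩ disjointed (fun k => U (e k)) k := by
    rw [← inter_iUnion, iUnion_disjointed, hcov, inter_univ]
  have hdis : Pairwise (Function.onFun Disjoint fun k => E ∩ disjointed (fun k => U (e k)) k) :=
    fun i j hij => ((disjoint_disjointed _) hij).mono inter_subset_right inter_subset_right
  rw [hEk, measure_iUnion hdis fun k => hE.inter (hm k), measure_iUnion hdis fun k => hE.inter (hm k)]
  exact ENNReal.tsum_le_tsum fun k =>
    hle _ _ (inter_subset_right.trans (disjointed_subset _ _)) (hE.inter (hm k))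

section ArcLength

variable {E : Type*} [NormedAddCommGroup E] [NormedSpace ℝ E] [MeasurableSpace E] [BorelSpace E]
  {γ γ' : ℝ → E} (hγ : ∀ s, HasDerivAt γ (γ' s) s) (hγ' : Continuous γ')
  {L : NNReal} (hup : LipschitzWith L γ) (hlow : ∀ s t, |s - t| ≤ ‖γ s - γ t‖)
include hγ hγ' hup hlow

omit [NormedSpace ℝ E] hγ hγ' [MeasurableSpace E] [BorelSpace E] γ' in
lemma isClosedEmbedding_of_le : Topology.IsClosedEmbedding γ := by
  have : AntilipschitzWith 1 γ := AntilipschitzWith.of_le_mul_dist fun s t => by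
    simpa [Real.dist_eq, dist_eq_norm] using hlow s t
  exact this.isClosedEmbedding hup.uniformContinuous

omit [MeasurableSpace E] [BorelSpace E] hγ' hup in
lemma one_le_norm_deriv (s : ℝ) : 1 ≤ ‖γ' s‖ := by
  have h := (hγ s).tendsto_slope.norm
  refine ge_of_tendsto h ?_
  filter_upwards [self_mem_nhdsWithin] with t ht
  have ht0 : 0 < |t - s| := abs_pos.2 (sub_ne_zero.2 ht)
  rw [slope_def_module, norm_smul, norm_inv, Real.norm_eq_abs]
  rw [le_inv_mul_iff₀ ht0, mul_one]
  exact hlow t s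

omit [MeasurableSpace E] [BorelSpace E] hup hlow in
lemma exists_local_speed (s₀ : ℝ) {ε : ℝ} (hε : 0 < ε) : ∃ U, IsOpen U ∧ s₀ ∈ U ∧
    (∀ s ∈ U, |‖γ' s‖ - ‖γ' s₀‖| ≤ ε) ∧
    ∀ s ∈ U, ∀ t ∈ U, |‖γ s - γ t‖ - ‖γ' s₀‖ * (|s - t|)| ≤ ε * |s - t| := by
  have h1 : ∀ᶠ s in 𝓝 s₀, |‖γ' s‖ - ‖γ' s₀‖| < ε := by
    have := (hγ'.norm.tendsto s₀)
    exact (Metric.tendsto_nhds.1 this ε hε)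
  have hs : HasStrictDerivAt γ (γ' s₀) s₀ :=
    hasStrictDerivAt_of_hasDerivAt_of_continuousAt (Eventually.of_forall hγ) hγ'.continuousAt
  obtain ⟨V, hV, hVs⟩ := hs.hasStrictFDerivAt.approximates_deriv_on_nhds (c := ⟨ε, hε.le⟩)
    (Or.inr (by exact_mod_cast hε))
  obtain ⟨U, hU1, hU2, hU3⟩ := eventually_nhds_iff.1 (h1.and hV)
  refine ⟨U, hU2, hU3, fun s hs => (hU1 s hs).1.le, fun s hs t ht => ?_⟩
  have h2 := hVs s (hU1 s hs).2 t (hU1 t ht).2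
  simp only [ContinuousLinearMap.toSpanSingleton_apply] at h2
  have h3 := abs_norm_sub_norm_le (γ s - γ t) ((s - t) • γ' s₀)
  rw [norm_smul, Real.norm_eq_abs, mul_comm] at h3
  exact h3.trans h2

/-- The length of a piece of a `C¹` curve is the integral of the speed: near each parameter both are,
up to a small relative error, the speed there times Lebesgue measure. -/
lemma comap_hausdorffMeasure_eq :
    (Measure.hausdorffMeasure 1 : Measure E).comap γ = volume.withDensity fun s => ‖γ' s‖ₑ := by
  have hemb := (isClosedEmbedding_of_le hup hlow).measurableEmbedding
  set ν := (Measure.hausdorffMeasure 1 : Measure E).comap γ with hν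
  set l := (volume : Measure ℝ).withDensity fun s => ‖γ' s‖ₑ with hl
  have hνa : ∀ A : Set ℝ, ν A = Measure.hausdorffMeasure 1 (γ '' A) := fun A =>
    hemb.comap_apply _ A
  have hla : ∀ A : Set ℝ, MeasurableSet A → l A = ∫⁻ s in A, ‖γ' s‖ₑ := fun A hA =>
    withDensity_apply _ hA
  have h1 := one_le_norm_deriv hγ hlow
  have hvν : ∀ A : Set ℝ, volume A ≤ ν A := fun A => by
    have := hausdorffMeasure_le_of_antilipschitzOn (f := γ) (s := A) (K := 1)
      (fun x _ y _ => by simpa [Real.dist_eq, dist_eq_norm] using hlow x y) zero_le_one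
    rw [hνa]
    simpa [hausdorffMeasure_real] using this
  have hvl : ∀ A : Set ℝ, MeasurableSet A → volume A ≤ l A := fun A hA => by
    rw [hla A hA, ← setLIntegral_one]
    refine lintegral_mono fun s => ?_
    rw [← ofReal_norm]
    exact ENNReal.one_le_ofReal.2 (h1 s)
  -- both measures are squeezed between the same multiples of Lebesgue measure
  have hloc : ∀ ε : ℝ, 0 < ε → ∀ s₀ : ℝ, ∃ U, IsOpen U ∧ s₀ ∈ U ∧ ∀ A ⊆ U, MeasurableSet A →
      ν A ≤ (l + ENNReal.ofReal (2 * ε) • (volume : Measure ℝ)) A ∧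
      l A ≤ (ν + ENNReal.ofReal (2 * ε) • (volume : Measure ℝ)) A := by
    intro ε' hε'
    -- a smaller tolerance, below the speed
    obtain ⟨ε, hε, hε1, hεε⟩ : ∃ ε : ℝ, 0 < ε ∧ ε < 1 ∧ ε ≤ ε' :=
      ⟨min (1/2) ε', by positivity, (min_le_left _ _).trans_lt (by norm_num), min_le_right _ _⟩
    intro s₀
    obtain ⟨U, hU, hsU, hU1, hU2⟩ := exists_local_speed hγ hγ' s₀ hε
    refine ⟨U, hU, hsU, fun A hA hAm => ?_⟩
    set g := ‖γ' s₀‖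
    have hg : 1 ≤ g := h1 s₀
    have e1 : ν A ≤ ENNReal.ofReal (g + ε) * volume A := by
      have hlip : LipschitzOnWith (g + ε).toNNReal γ A :=
        LipschitzOnWith.of_dist_le_mul fun s hs t ht => by
          have := (abs_le.1 (hU2 s (hA hs) t (hA ht))).2
          rw [dist_eq_norm, Real.dist_eq, Real.coe_toNNReal _ (by positivity)]
          linarith
      have := hlip.hausdorffMeasure_image_le zero_le_one
      rw [hνa]
      rw [hausdorffMeasure_real, ENNReal.rpow_one] at this
      exact this
    have e2 : ENNReal.ofReal (g - ε) * volume A ≤ ν A := by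
      have hpos : 0 < g - ε := by linarith
      have := hausdorffMeasure_le_of_antilipschitzOn (f := γ) (s := A)
        (K := (g - ε)⁻¹.toNNReal) (fun s hs t ht => by
          have := (abs_le.1 (hU2 s (hA hs) t (hA ht))).1
          rw [Real.dist_eq, dist_eq_norm, Real.coe_toNNReal _ (by positivity)]
          rw [le_inv_mul_iff₀ hpos]
          linarith) zero_le_one
      rw [hausdorffMeasure_real, ENNReal.rpow_one, ← hνa] at this
      change _ ≤ ENNReal.ofReal (g - ε)⁻¹ * _ at this
      rw [ENNReal.ofReal_inv_of_pos hpos] at this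
      calc ENNReal.ofReal (g - ε) * volume A
          ≤ ENNReal.ofReal (g - ε) * ((ENNReal.ofReal (g - ε))⁻¹ * ν A) := by gcongr
        _ = ν A := by
          rw [← mul_assoc, ENNReal.mul_inv_cancel (by simpa using hpos) ENNReal.ofReal_ne_top,
            one_mul]
    have e3 : l A ≤ ENNReal.ofReal (g + ε) * volume A := by
      rw [hla A hAm, ← setLIntegral_const]
      refine setLIntegral_mono' hAm fun s hs => ?_
      rw [← ofReal_norm]
      exact ENNReal.ofReal_le_ofReal (by linarith [(abs_le.1 (hU1 s (hA hs))).2])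
    have e4 : ENNReal.ofReal (g - ε) * volume A ≤ l A := by
      rw [hla A hAm, ← setLIntegral_const]
      refine setLIntegral_mono' hAm fun s hs => ?_
      rw [← ofReal_norm]
      exact ENNReal.ofReal_le_ofReal (by linarith [(abs_le.1 (hU1 s (hA hs))).1])
    have e5 : ENNReal.ofReal (g + ε) ≤ ENNReal.ofReal (g - ε) + ENNReal.ofReal (2 * ε') := by
      rw [← ENNReal.ofReal_add (by linarith) (by linarith)]
      exact ENNReal.ofReal_le_ofReal (by linarith)
    have e6 : ENNReal.ofReal (g + ε) * volume A ≤
        ENNReal.ofReal (g - ε) * volume A + ENNReal.ofReal (2 * ε') * volume A := by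
      rw [← add_mul]; gcongr
    simp only [Measure.add_apply, Measure.smul_apply, smul_eq_mul]
    exact ⟨e1.trans (e6.trans (by gcongr)), e3.trans (e6.trans (by gcongr))⟩
  have hle1 : ∀ ε : ℝ, 0 < ε → ν ≤ l + ENNReal.ofReal (2 * ε) • volume := fun ε hε =>
    Measure.le_of_locally_le fun s => by
      obtain ⟨U, a, b, h⟩ := hloc ε hε s
      exact ⟨U, a, b, fun A hA hAm => (h A hA hAm).1⟩
  have hle2 : ∀ ε : ℝ, 0 < ε → l ≤ ν + ENNReal.ofReal (2 * ε) • volume := fun ε hε =>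
    Measure.le_of_locally_le fun s => by
      obtain ⟨U, a, b, h⟩ := hloc ε hε s
      exact ⟨U, a, b, fun A hA hAm => (h A hA hAm).2⟩
  have hlim : ∀ (κ κ' : Measure ℝ) (A : Set ℝ), volume A ≠ ⊤ →
      (∀ ε : ℝ, 0 < ε → κ ≤ κ' + ENNReal.ofReal (2 * ε) • volume) → κ A ≤ κ' A := by
    intro κ κ' A hA h
    have ht : Tendsto (fun ε : ℝ => κ' A + ENNReal.ofReal (2 * ε) * volume A) (𝓝[>] 0)
        (𝓝 (κ' A + ENNReal.ofReal (2 * 0) * volume A)) := by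
      have hc : Tendsto (fun ε : ℝ => ENNReal.ofReal (2 * ε)) (𝓝[>] 0)
          (𝓝 (ENNReal.ofReal (2 * 0))) :=
        (ENNReal.tendsto_ofReal ((continuous_const.mul continuous_id).tendsto 0)).mono_left
          nhdsWithin_le_nhds
      exact tendsto_const_nhds.add (ENNReal.Tendsto.mul_const hc (Or.inr hA))
    rw [mul_zero, ENNReal.ofReal_zero, zero_mul, add_zero] at ht
    refine ge_of_tendsto ht ?_
    filter_upwards [self_mem_nhdsWithin] with ε hε
    exact h ε hε A
  ext A hA
  by_cases hv : volume A = ⊤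
  · have e1 : ν A = ⊤ := top_le_iff.1 (hv ▸ hvν A)
    have e2 : l A = ⊤ := top_le_iff.1 (hv ▸ hvl A hA)
    rw [e1, e2]
  · exact le_antisymm (hlim ν l A hv hle1) (hlim l ν A hv hle2)

lemma integral_image_curve {A : Set ℝ} (hA : MeasurableSet A) (F : E → ℝ) :
    ∫ y in γ '' A, F y ∂(Measure.hausdorffMeasure 1) = ∫ s in A, ‖γ' s‖ * F (γ s) := by
  have hemb := (isClosedEmbedding_of_le hup hlow).measurableEmbedding
  have h := hemb.setIntegral_map
    (μ := (Measure.hausdorffMeasure 1 : Measure E).comap γ) F (γ '' A)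
  rw [hemb.map_comap, comap_hausdorffMeasure_eq hγ hγ' hup hlow,
    preimage_image_eq _ hemb.injective,
    Measure.restrict_restrict (hemb.measurableSet_image' hA),
    inter_eq_left.2 (image_subset_range _ _)] at h
  rw [h, setIntegral_withDensity_eq_setIntegral_toReal_smul₀]
  · simp
  · exact hγ'.enorm.measurable.aemeasurable
  · exact Eventually.of_forall fun s => enorm_lt_top
  · exact hA

lemma integrableOn_image_curve {A : Set ℝ} (hA : MeasurableSet A) (F : E → ℝ) :
    IntegrableOn F (γ '' A) (Measure.hausdorffMeasure 1) ↔
      IntegrableOn (fun s => ‖γ' s‖ * F (γ s)) A := by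
  have hemb := (isClosedEmbedding_of_le hup hlow).measurableEmbedding
  have h := hemb.integrableOn_map_iff
    (μ := (Measure.hausdorffMeasure 1 : Measure E).comap γ) (f := F) (s := γ '' A)
  rw [hemb.map_comap, comap_hausdorffMeasure_eq hγ hγ' hup hlow,
    preimage_image_eq _ hemb.injective, IntegrableOn,
    Measure.restrict_restrict (hemb.measurableSet_image' hA),
    inter_eq_left.2 (image_subset_range _ _)] at h
  rw [IntegrableOn, h, IntegrableOn, restrict_withDensity hA,
    integrable_withDensity_iff_integrable_smul']
  · simp [IntegrableOn]
  · exact hγ'.enorm.measurable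
  · exact Eventually.of_forall fun s => enorm_lt_top

end ArcLength

/-- Arc length on the boundary of `Ω`. -/
def arcLength (Ω : Set Plane) : Measure Plane :=
  (Measure.hausdorffMeasure 1 : Measure Plane).restrict (frontier Ω)

namespace IsGraphBox

variable {Ω : Set Plane} {p ν : Plane} {δ η : ℝ} {f : ℝ → ℝ} (hG : IsGraphBox Ω p ν δ η f)
include hG

lemma lipschitz_curve : LipschitzWith 2 (graphCurve p ν f) :=
  LipschitzWith.of_dist_le_mul fun s t => by
    simpa [Real.dist_eq, dist_eq_norm] using hG.dist_le s t

lemma continuous_speed : Continuous fun s => frameVec ν (1, deriv f s) := by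
  have := hG.continuous_deriv
  unfold frameVec; fun_prop

lemma speed_eq (s : ℝ) : ‖frameVec ν (1, deriv f s)‖ = √(1 + deriv f s ^ 2) := by
  rw [norm_frameVec hG.norm_normal]; simp

lemma setIntegral_frontier_inter_box (F : Plane → ℝ) :
    ∫ y in frontier Ω ∩ frameBox p ν δ η, F y ∂(Measure.hausdorffMeasure 1) =
      ∫ s in Ioo (-δ) δ, √(1 + deriv f s ^ 2) * F (graphCurve p ν f s) := by
  rw [hG.frontier_inter_box, integral_image_curve hG.curve_hasDerivAt hG.continuous_speed
    hG.lipschitz_curve hG.abs_sub_le_dist measurableSet_Ioo]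
  simp_rw [hG.speed_eq]

lemma integrableOn_frontier_inter_box (F : Plane → ℝ) :
    IntegrableOn F (frontier Ω ∩ frameBox p ν δ η) (Measure.hausdorffMeasure 1) ↔
      IntegrableOn (fun s => √(1 + deriv f s ^ 2) * F (graphCurve p ν f s)) (Ioo (-δ) δ) := by
  rw [hG.frontier_inter_box, integrableOn_image_curve hG.curve_hasDerivAt hG.continuous_speed
    hG.lipschitz_curve hG.abs_sub_le_dist measurableSet_Ioo]
  simp_rw [hG.speed_eq]

lemma hausdorffMeasure_frontier_inter_box_lt_top :
    Measure.hausdorffMeasure 1 (frontier Ω ∩ frameBox p ν δ η) < ⊤ := by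
  rw [hG.frontier_inter_box]
  refine (hG.lipschitz_curve.hausdorffMeasure_image_le zero_le_one _).trans_lt ?_
  rw [hausdorffMeasure_real, Real.volume_Ioo]
  exact ENNReal.mul_lt_top (by simp) ENNReal.ofReal_lt_top

end IsGraphBox

section Boundary

variable {Ω : Set Plane} {n : Plane → Plane} (hΩ : IsLyapunovDomain Ω n)
include hΩ

lemma isFiniteMeasure_arcLength : IsFiniteMeasure (arcLength Ω) := by
  constructor
  rw [arcLength, Measure.restrict_apply_univ]
  refine hΩ.isCompact_frontier.measure_lt_top_of_nhdsWithin fun p hp => ?_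
  obtain ⟨δ, η, f, hG⟩ := exists_isGraphBox hΩ hp
  refine ⟨frontier Ω ∩ frameBox p (n p) δ η, inter_mem_nhdsWithin _
    ((isOpen_frameBox _ _ _ _).mem_nhds (self_mem_frameBox _ _ hG.pos_left hG.pos_right)), ?_⟩
  exact hG.hausdorffMeasure_frontier_inter_box_lt_top

lemma continuousOn_normal : ContinuousOn n (frontier Ω) := by
  obtain ⟨C, α, hα, -, hC⟩ := hΩ.holder_normal
  intro p hp
  rw [ContinuousWithinAt, tendsto_iff_norm_sub_tendsto_zero]
  have h1 : Tendsto (fun q => C * ‖q - p‖ ^ α) (𝓝[frontier Ω] p) (𝓝 0) := by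
    have hc : Continuous fun q : Plane => C * ‖q - p‖ ^ α :=
      continuous_const.mul ((by fun_prop : Continuous fun q : Plane => ‖q - p‖).rpow_const
        fun _ => Or.inr hα.le)
    have := (hc.tendsto p).mono_left (nhdsWithin_le_nhds (s := frontier Ω))
    simpa [Real.zero_rpow hα.ne'] using this
  refine squeeze_zero' (Eventually.of_forall fun q => norm_nonneg _) ?_ h1
  filter_upwards [self_mem_nhdsWithin] with q hq using hC q hq p hp

lemma aestronglyMeasurable_normal : AEStronglyMeasurable n (arcLength Ω) :=
  (continuousOn_normal hΩ).aestronglyMeasurable hΩ.isCompact_frontier.isClosed.measurableSet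

lemma ae_mem_frontier : ∀ᵐ y ∂(arcLength Ω), y ∈ frontier Ω :=
  ae_restrict_mem hΩ.isCompact_frontier.isClosed.measurableSet

lemma integrable_mul_inner_normal {u : Plane → ℝ} (hu : Continuous u) (v : Plane) :
    Integrable (fun y => u y * inner ℝ v (n y)) (arcLength Ω) := by
  have := isFiniteMeasure_arcLength hΩ
  obtain ⟨M, hM⟩ := hΩ.isCompact_frontier.exists_bound_of_continuousOn hu.continuousOn
  refine Integrable.of_bound (C := M * ‖v‖) ?_ ?_
  · exact hu.aestronglyMeasurable.mul
      (aestronglyMeasurable_const.inner (aestronglyMeasurable_normal hΩ))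
  · filter_upwards [ae_mem_frontier hΩ] with y hy
    rw [norm_mul]
    refine mul_le_mul (hM y hy) ?_ (norm_nonneg _) ((norm_nonneg _).trans (hM y hy))
    have := norm_inner_le_norm (𝕜 := ℝ) v (n y)
    rwa [hΩ.norm_normal y hy, mul_one] at this

end Boundary

/-! ### The Gauss–Green formula -/

/-- The homeomorphism that takes the lower half-plane to the region below the graph of `f`. -/
def shearFrame (p ν : Plane) (hν : ‖ν‖ = 1) (f : ℝ → ℝ) (hf : Continuous f) : ℝ × ℝ ≃ₜ Plane where
  toFun z := frame p ν (z.1, f z.1 + z.2)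
  invFun q := (inner ℝ (q - p) (perp ν), inner ℝ (q - p) ν - f (inner ℝ (q - p) (perp ν)))
  left_inv z := by
    simp only [inner_frame_sub_perp hν, inner_frame_sub_normal hν, add_sub_cancel_left]
  right_inv q := by
    simp only [add_sub_cancel]
    exact frame_inner hν p q
  continuous_toFun := (continuous_frame p).comp (by fun_prop)
  continuous_invFun := by fun_prop

lemma measurePreserving_shearFrame (p ν : Plane) (hν : ‖ν‖ = 1) (f : ℝ → ℝ) (hf : Continuous f) :
    MeasurePreserving (shearFrame p ν hν f hf) := by
  have h1 : MeasurePreserving (fun z : ℝ × ℝ => (id z.1, f z.1 + z.2))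
      ((volume : Measure ℝ).prod volume) ((volume : Measure ℝ).prod volume) := by
    refine (MeasurePreserving.id volume).skew_product (g := fun s k => f s + k) ?_ ?_
    · exact (hf.comp continuous_fst |>.add continuous_snd).measurable
    · exact Eventually.of_forall fun s => map_add_left_eq_self volume (f s)
  exact (frame_measurePreserving hν p).comp h1

namespace IsGraphBox

variable {Ω : Set Plane} {n : Plane → Plane} {p : Plane} {δ η : ℝ} {f : ℝ → ℝ}

/-- The Gauss–Green formula for a function supported in a graph box. In the sheared coordinates
`(s, k)` with `h = f s + k` the domain is `k < 0`; a constant vector is there a combination of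
`∂/∂s`, whose integral vanishes, and of `∂/∂k` with a coefficient that does not depend on `k`. -/
lemma gauss_green (hΩ : IsLyapunovDomain Ω n) (hG : IsGraphBox Ω p (n p) δ η f) {u : Plane → ℝ}
    (hu : ContDiff ℝ 1 u) (hc : HasCompactSupport u) (hs : tsupport u ⊆ frameBox p (n p) δ η)
    (v : Plane) :
    ∫ y in Ω, fderiv ℝ u y v = ∫ y, u y * inner ℝ v (n y) ∂(arcLength Ω) := by
  have hν := hG.norm_normal
  set ν := n p
  set a : ℝ := inner ℝ v (perp ν)
  set b : ℝ := inner ℝ v ν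
  have hvab : frameVec ν (a, b) = v := frameVec_inner hν v
  set Ψ := shearFrame p ν hν f hG.continuous
  have hΨ : ∀ s k, Ψ (s, k) = frame p ν (s, f s + k) := fun _ _ => rfl
  have hΨm : MeasurePreserving Ψ := measurePreserving_shearFrame p ν hν f hG.continuous
  have hdu : Continuous (fderiv ℝ u) := hu.continuous_fderiv one_ne_zero
  have hu0 : ∀ y, y ∉ frameBox p ν δ η → u y = 0 := fun y hy =>
    image_eq_zero_of_notMem_tsupport fun h => hy (hs h)
  have hdu0 : ∀ y, y ∉ frameBox p ν δ η → fderiv ℝ u y = 0 := fun y hy =>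
    image_eq_zero_of_notMem_tsupport fun h => hy (hs (tsupport_fderiv_subset ℝ h))
  -- continuous functions of `fderiv u` along the shear are integrable
  have hint : ∀ w : ℝ → Plane, Continuous w →
      Integrable (fun z : ℝ × ℝ => fderiv ℝ u (Ψ z) (w z.1)) := fun w hw => by
    refine Continuous.integrable_of_hasCompactSupport
      ((hdu.comp Ψ.continuous).clm_apply (hw.comp continuous_fst)) ?_
    have h1 : HasCompactSupport (fun z => fderiv ℝ u (Ψ z)) :=
      (hc.fderiv (𝕜 := ℝ)).comp_homeomorph Ψ
    refine h1.mono fun z hz => ?_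
    intro h
    apply hz
    simp only [h, zero_apply]
  have hT := hint (fun s => frameVec ν (1, deriv f s)) hG.continuous_speed
  have hcd : Continuous fun s => b - a * deriv f s := by
    have := hG.continuous_deriv
    fun_prop
  have hN := hint (fun s => (b - a * deriv f s) • ν) (hcd.smul continuous_const)
  -- the left-hand side in sheared coordinates
  have hL : ∫ y in Ω, fderiv ℝ u y v =
      ∫ z in (univ : Set ℝ) ×ˢ Iio (0 : ℝ), fderiv ℝ u (Ψ z) v := by
    rw [← integral_indicator hΩ.isOpen.measurableSet,
      ← integral_indicator (MeasurableSet.univ.prod measurableSet_Iio),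
      ← hΨm.integral_comp Ψ.measurableEmbedding]
    congr 1
    funext z
    obtain ⟨s, k⟩ := z
    by_cases hbox : Ψ (s, k) ∈ frameBox p ν δ η
    · have hb := hbox
      rw [hΨ, frame_mem_frameBox hν] at hb
      have hiff : Ψ (s, k) ∈ Ω ↔ (s, k) ∈ (univ : Set ℝ) ×ˢ Iio (0 : ℝ) := by
        rw [hΨ, hG.mem_iff _ _ hb.1 hb.2]
        simp
      by_cases hmem : Ψ (s, k) ∈ Ω
      · rw [indicator_of_mem hmem, indicator_of_mem (hiff.1 hmem)]
      · rw [indicator_of_notMem hmem, indicator_of_notMem fun h => hmem (hiff.2 h)]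
    · have h0 : fderiv ℝ u (Ψ (s, k)) v = 0 := by rw [hdu0 _ hbox]; rfl
      have h1 : Ω.indicator (fun y => fderiv ℝ u y v) (Ψ (s, k)) = 0 :=
        indicator_apply_eq_zero.2 fun _ => h0
      rw [h1, eq_comm]
      exact indicator_apply_eq_zero.2 fun _ => h0
  have hsplit : ∀ z : ℝ × ℝ, fderiv ℝ u (Ψ z) v =
      a * fderiv ℝ u (Ψ z) (frameVec ν (1, deriv f z.1)) +
        fderiv ℝ u (Ψ z) ((b - a * deriv f z.1) • ν) := by
    intro z
    rw [← smul_eq_mul, ← map_smul, ← map_add]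
    congr 1
    rw [← hvab]
    simp only [frameVec]
    module
  have hdΨ : ∀ s k, HasDerivAt (fun s => u (Ψ (s, k)))
      (fderiv ℝ u (Ψ (s, k)) (frameVec ν (1, deriv f s))) s := by
    intro s k
    have h1 : HasDerivAt (fun s => Ψ (s, k)) (frameVec ν (1, deriv f s)) s := by
      have := (hG.curve_hasDerivAt s).add_const (k • ν)
      refine this.congr_of_eventuallyEq (Eventually.of_forall fun s => ?_)
      simp only [hΨ, graphCurve, frame]
      module
    exact ((hu.differentiable one_ne_zero (Ψ (s, k))).hasFDerivAt).comp_hasDerivAt s h1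
  have hdΨ' : ∀ s k, HasDerivAt (fun k => u (Ψ (s, k))) (fderiv ℝ u (Ψ (s, k)) ν) k := by
    intro s k
    have h1 : HasDerivAt (fun k => Ψ (s, k)) ν k := by
      have h2 : HasDerivAt (fun k : ℝ => k • ν) ((1 : ℝ) • ν) k := (hasDerivAt_id k).smul_const ν
      have := h2.const_add (graphCurve p ν f s)
      rw [one_smul] at this
      refine this.congr_of_eventuallyEq (Eventually.of_forall fun s => ?_)
      simp only [hΨ, graphCurve, frame]
      module
    exact ((hu.differentiable one_ne_zero (Ψ (s, k))).hasFDerivAt).comp_hasDerivAt k h1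
  have hemb1 : ∀ k : ℝ, Topology.IsClosedEmbedding fun s : ℝ => Ψ (s, k) := fun k =>
    Ψ.isClosedEmbedding.comp (Function.LeftInverse.isClosedEmbedding (f := Prod.fst)
      (fun _ => rfl) continuous_fst (by fun_prop))
  have hemb2 : ∀ s : ℝ, Topology.IsClosedEmbedding fun k : ℝ => Ψ (s, k) := fun s =>
    Ψ.isClosedEmbedding.comp
    (Function.LeftInverse.isClosedEmbedding (f := Prod.snd) (fun _ => rfl) continuous_snd
      (by fun_prop))
  have hzero : ∫ z in (univ : Set ℝ) ×ˢ Iio (0 : ℝ),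
      fderiv ℝ u (Ψ z) (frameVec ν (1, deriv f z.1)) = 0 := by
    rw [Measure.volume_eq_prod, ← setIntegral_prod_swap, setIntegral_prod]
    · refine integral_eq_zero_of_ae (Eventually.of_forall fun k => ?_)
      simp only [Prod.swap_prod_mk, setIntegral_univ, Pi.zero_apply]
      refine integral_eq_zero_of_hasDerivAt_of_integrable (fun s => hdΨ s k) ?_ ?_
      · refine Continuous.integrable_of_hasCompactSupport
          ((hdu.comp (hemb1 k).continuous).clm_apply hG.continuous_speed) ?_
        have h1 : HasCompactSupport (fun s => fderiv ℝ u (Ψ (s, k))) :=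
          (hc.fderiv (𝕜 := ℝ)).comp_isClosedEmbedding (hemb1 k)
        refine h1.mono fun z hz h => hz ?_
        simp only [h, zero_apply]
      · exact (hu.continuous.comp (hemb1 k).continuous).integrable_of_hasCompactSupport
          (hc.comp_isClosedEmbedding (hemb1 k))
    · exact (hT.swap).integrableOn
  have hnormal : ∫ z in (univ : Set ℝ) ×ˢ Iio (0 : ℝ),
      fderiv ℝ u (Ψ z) ((b - a * deriv f z.1) • ν) =
        ∫ s, (b - a * deriv f s) * u (graphCurve p ν f s) := by
    rw [Measure.volume_eq_prod, setIntegral_prod _ hN.integrableOn, setIntegral_univ]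
    congr 1
    funext s
    simp only [map_smul, smul_eq_mul]
    rw [integral_const_mul]
    congr 1
    have h1 : ContDiff ℝ 1 fun k => u (Ψ (s, k)) := by
      refine hu.comp ?_
      simp only [hΨ, frame]
      fun_prop
    have h2 := HasCompactSupport.integral_Iic_deriv_eq h1 (hc.comp_isClosedEmbedding (hemb2 s)) 0
    rw [integral_Iic_eq_integral_Iio] at h2
    simp only [hΨ, add_zero] at h2
    rw [graphCurve, ← h2]
    congr 1
    funext k
    exact (hdΨ' s k).deriv.symm
  rw [hL]
  simp_rw [hsplit]
  rw [integral_add (hT.const_mul a).integrableOn hN.integrableOn, integral_const_mul, hzero,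
    hnormal, mul_zero, zero_add]
  -- the right-hand side in the parameter of the graph
  have hR : ∫ y, u y * inner ℝ v (n y) ∂(arcLength Ω) =
      ∫ y in frontier Ω ∩ frameBox p ν δ η, u y * inner ℝ v (n y)
        ∂(Measure.hausdorffMeasure 1) := by
    rw [arcLength]
    refine setIntegral_eq_of_subset_of_forall_sdiff_eq_zero
      hΩ.isCompact_frontier.isClosed.measurableSet inter_subset_left fun y hy => ?_
    rw [hu0 y fun h => hy.2 ⟨hy.1, h⟩, zero_mul]
  rw [hR, hG.setIntegral_frontier_inter_box]
  have hR2 : ∫ s, (b - a * deriv f s) * u (graphCurve p ν f s) =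
      ∫ s in Ioo (-δ) δ, (b - a * deriv f s) * u (graphCurve p ν f s) := by
    symm
    apply setIntegral_eq_integral_of_forall_compl_eq_zero
    intro s hs'
    rw [hu0, mul_zero]
    intro h
    rw [graphCurve, frame_mem_frameBox hν] at h
    exact hs' (abs_lt.1 h.1)
  rw [hR2]
  refine setIntegral_congr_fun measurableSet_Ioo fun s hs' => ?_
  have h1 := hG.normal_curve hΩ (abs_lt.2 hs')
  have h2 : inner ℝ v (√(1 + deriv f s ^ 2) • n (graphCurve p ν f s)) = b - a * deriv f s := by
    rw [h1, ← hvab, inner_frameVec hν]; simp only; ring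
  rw [real_inner_smul_right] at h2
  rw [← h2]; ring

end IsGraphBox

section

variable {Ω : Set Plane} {n : Plane → Plane} (hΩ : IsLyapunovDomain Ω n)
include hΩ

lemma exists_nhds_gauss_green (y : Plane) : ∃ U, IsOpen U ∧ y ∈ U ∧
    ∀ u : Plane → ℝ, ContDiff ℝ 1 u → HasCompactSupport u → tsupport u ⊆ U → ∀ v,
      ∫ y in Ω, fderiv ℝ u y v = ∫ y, u y * inner ℝ v (n y) ∂(arcLength Ω) := by
  have hfr : ∀ u : Plane → ℝ, tsupport u ⊆ (frontier Ω)ᶜ → ∀ v : Plane,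
      ∫ y, u y * inner ℝ v (n y) ∂(arcLength Ω) = 0 := fun u hu v => by
    refine integral_eq_zero_of_ae ?_
    filter_upwards [ae_mem_frontier hΩ] with y hy
    have : u y = 0 := image_eq_zero_of_notMem_tsupport fun h => hu h hy
    simp [this]
  have hfd : ∀ (u : Plane → ℝ) (v y : Plane), y ∉ tsupport u → fderiv ℝ u y v = 0 :=
    fun u v y hy => by
      have := image_eq_zero_of_notMem_tsupport fun h => hy (tsupport_fderiv_subset ℝ h)
      rw [this]; rfl
  by_cases hy : y ∈ frontier Ω
  · obtain ⟨δ, η, f, hG⟩ := exists_isGraphBox hΩ hy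
    exact ⟨_, isOpen_frameBox _ _ _ _, self_mem_frameBox _ _ hG.pos_left hG.pos_right,
      fun u hu hc hs v => hG.gauss_green hΩ hu hc hs v⟩
  by_cases hyΩ : y ∈ Ω
  · refine ⟨Ω, hΩ.isOpen, hyΩ, fun u hu hc hs v => ?_⟩
    have hdis : Ω ⊆ (frontier Ω)ᶜ := fun z hz hz' => hz'.2 (by rwa [hΩ.isOpen.interior_eq])
    rw [hfr u (hs.trans hdis), setIntegral_eq_integral_of_forall_compl_eq_zero
      fun z hz => hfd u v z fun h => hz (hs h)]
    have h1 := integral_mul_fderiv_eq_neg_fderiv_mul_of_integrable (μ := (volume : Measure Plane))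
      (f := fun _ => (1 : ℝ)) (g := u) (v := v) (𝕜 := ℝ)
      (by simp) (by
        simp only [one_mul]
        exact ((hu.continuous_fderiv one_ne_zero).clm_apply
          continuous_const).integrable_of_hasCompactSupport (hc.fderiv_apply (𝕜 := ℝ) v))
      (by simpa using hu.continuous.integrable_of_hasCompactSupport hc)
      (fun _ _ => differentiableAt_const _) (fun y _ => hu.differentiable one_ne_zero y)
    simpa using h1
  · have hcl : y ∉ closure Ω := fun h => hy ⟨h, by rwa [hΩ.isOpen.interior_eq]⟩
    refine ⟨(closure Ω)ᶜ, isClosed_closure.isOpen_compl, hcl, fun u hu hc hs v => ?_⟩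
    rw [hfr u (hs.trans (compl_subset_compl.2 frontier_subset_closure))]
    refine setIntegral_eq_zero_of_forall_eq_zero fun z hz => hfd u v z fun h => hs h
      (subset_closure hz)

/-- The Gauss–Green formula for `Ω`. -/
theorem gauss_green {u : Plane → ℝ} (hu : ContDiff ℝ 1 u) (hc : HasCompactSupport u) (v : Plane) :
    ∫ y in Ω, fderiv ℝ u y v = ∫ y, u y * inner ℝ v (n y) ∂(arcLength Ω) := by
  choose U hU hyU hgg using exists_nhds_gauss_green hΩ
  obtain ⟨t, ht⟩ := hc.elim_finite_subcover U hU fun y _ => mem_iUnion.2 ⟨y, hyU y⟩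
  have hcov : tsupport u ⊆ ⋃ i : t, U i := by
    intro y hy
    obtain ⟨i, hi, hyi⟩ := mem_iUnion₂.1 (ht hy)
    exact mem_iUnion.2 ⟨⟨i, hi⟩, hyi⟩
  obtain ⟨ρ, hρ⟩ := SmoothPartitionOfUnity.exists_isSubordinate (modelWithCornersSelf ℝ Plane)
    (isClosed_tsupport u) (fun i : t => U i) (fun i => hU i) hcov
  have hρs : ∀ i, ContDiff ℝ 1 (ρ i) := fun i => by
    have := (ρ i).contMDiff
    exact (contMDiff_iff_contDiff.1 this).of_le (by exact_mod_cast le_top)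
  have hw : ∀ i, ContDiff ℝ 1 fun y => ρ i y * u y := fun i => (hρs i).mul hu
  have hwc : ∀ i, HasCompactSupport fun y => ρ i y * u y := fun i => hc.mul_left
  have hws : ∀ i : t, tsupport (fun y => ρ i y * u y) ⊆ U i := fun i =>
    (tsupport_mul_subset_left).trans (hρ i)
  have hsum : u = fun y => ∑ i, ρ i y * u y := by
    funext y
    by_cases hy : y ∈ tsupport u
    · rw [← Finset.sum_mul]
      have := ρ.sum_eq_one hy
      rw [finsum_eq_sum_of_fintype] at this
      rw [this, one_mul]
    · simp [image_eq_zero_of_notMem_tsupport hy]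
  have h1 : ∀ y, fderiv ℝ u y v = ∑ i, fderiv ℝ (fun y => ρ i y * u y) y v := by
    intro y
    conv_lhs => rw [hsum]
    rw [fderiv_fun_sum fun i _ => (hw i).differentiable one_ne_zero y]
    simp
  have h2 : ∀ y, u y * inner ℝ v (n y) = ∑ i, (ρ i y * u y) * inner ℝ v (n y) := by
    intro y
    rw [← Finset.sum_mul]
    conv_lhs => rw [hsum]
  simp_rw [h1]
  rw [integral_finsetSum, integral_congr_ae (Eventually.of_forall h2), integral_finsetSum]
  · exact Finset.sum_congr rfl fun i _ => hgg i _ (hw i) (hwc i) (hws i) v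
  · exact fun i _ => integrable_mul_inner_normal hΩ (hw i).continuous v
  · exact fun i _ => (((hw i).continuous_fderiv one_ne_zero).clm_apply
      continuous_const).integrable_of_hasCompactSupport ((hwc i).fderiv_apply (𝕜 := ℝ) v)
      |>.integrableOn

end

/-! ### The angle form is integrable along the boundary -/

/-- The density with respect to arc length of the angle under which the boundary is seen from `x`;
it is `-∂/∂n(y) ln (1 / ‖x - y‖)`. -/
def angleKernel (n : Plane → Plane) (x y : Plane) : ℝ := inner ℝ (y - x) (n y) / ‖y - x‖ ^ 2

section

variable {Ω : Set Plane} {n : Plane → Plane} (hΩ : IsLyapunovDomain Ω n)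
include hΩ

lemma aestronglyMeasurable_angleKernel (x : Plane) :
    AEStronglyMeasurable (angleKernel n x) (arcLength Ω) := by
  have h1 : AEStronglyMeasurable (fun y => inner ℝ (y - x) (n y)) (arcLength Ω) :=
    ((continuous_id.sub continuous_const).aestronglyMeasurable (μ := arcLength Ω)).inner
      (aestronglyMeasurable_normal hΩ)
  have h2 : AEMeasurable (fun y : Plane => ‖y - x‖ ^ 2) (arcLength Ω) :=
    (by fun_prop : Continuous fun y : Plane => ‖y - x‖ ^ 2).measurable.aemeasurable
  exact (h1.aemeasurable.div h2).aestronglyMeasurable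

lemma abs_angleKernel_le (x : Plane) {y : Plane} (hy : y ∈ frontier Ω) :
    |angleKernel n x y| ≤ ‖y - x‖⁻¹ := by
  have h1 := abs_real_inner_le_norm (y - x) (n y)
  rw [hΩ.norm_normal y hy, mul_one] at h1
  rw [angleKernel, abs_div, abs_of_nonneg (sq_nonneg ‖y - x‖)]
  calc |inner ℝ (y - x) (n y)| / ‖y - x‖ ^ 2 ≤ ‖y - x‖ / ‖y - x‖ ^ 2 := by gcongr
    _ = ‖y - x‖⁻¹ := by
      by_cases h : ‖y - x‖ = 0
      · simp [h]
      · field_simp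

lemma integrableOn_angleKernel_of_le (x : Plane) {T : Set Plane} (hT : MeasurableSet T)
    {d : ℝ} (hd : 0 < d) (h : ∀ y ∈ T, d ≤ ‖y - x‖) :
    IntegrableOn (angleKernel n x) T (arcLength Ω) := by
  have := isFiniteMeasure_arcLength hΩ
  refine Integrable.of_bound (C := d⁻¹)
    ((aestronglyMeasurable_angleKernel hΩ x).mono_measure Measure.restrict_le_self) ?_
  filter_upwards [ae_restrict_mem hT, ae_restrict_of_ae (ae_mem_frontier hΩ)] with y hy hy'
  exact (abs_angleKernel_le hΩ x hy').trans (inv_anti₀ hd (h y hy))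

/-- Near its base point the graph deviates from the tangent by `O(|s| ^ (1 + α))`, where `α` is the
Hölder exponent of the normal. -/
lemma IsGraphBox.exists_deriv_le {p : Plane} {δ η : ℝ} {f : ℝ → ℝ}
    (hG : IsGraphBox Ω p (n p) δ η f) (hp : p ∈ frontier Ω) :
    ∃ C α : ℝ, 0 ≤ C ∧ 0 < α ∧ (∀ s, |s| < δ → |deriv f s| ≤ C * |s| ^ α) ∧
      ∀ s, |s| < δ → |f s| ≤ C * |s| ^ α * |s| := by
  obtain ⟨C, α, hα, -, hC⟩ := hΩ.holder_normal
  have hν := hG.norm_normal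
  have h1 : ∀ s, |s| < δ → |deriv f s| ≤ (2 * |C| * 2 ^ α) * |s| ^ α := by
    intro s hs
    set w := √(1 + deriv f s ^ 2)
    have hw0 : 0 ≤ w := Real.sqrt_nonneg _
    have hw2 : w ≤ 2 := by
      refine Real.sqrt_le_iff.2 ⟨by norm_num, ?_⟩
      have := pow_le_pow_left₀ (abs_nonneg _) (hG.abs_deriv_le s) 2
      rw [sq_abs] at this
      linarith
    have h2 := hG.normal_curve hΩ hs
    have h3 : inner ℝ (w • (n (graphCurve p (n p) f s) - n p)) (perp (n p)) = -deriv f s := by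
      rw [smul_sub, h2, inner_sub_left, inner_frameVec_perp hν, real_inner_smul_left,
        inner_perp_self]
      simp
    have h4 : |deriv f s| ≤ w * ‖n (graphCurve p (n p) f s) - n p‖ := by
      have := abs_real_inner_le_norm (w • (n (graphCurve p (n p) f s) - n p)) (perp (n p))
      rwa [h3, abs_neg, norm_perp, hν, mul_one, norm_smul, Real.norm_of_nonneg hw0] at this
    have h5 := hC _ (hG.curve_mem_frontier hs) p hp
    have h6 : ‖graphCurve p (n p) f s - p‖ ≤ 2 * |s| := by
      have := hG.dist_le s 0
      rwa [hG.curve_zero, sub_zero] at this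
    have h7 : ‖graphCurve p (n p) f s - p‖ ^ α ≤ 2 ^ α * |s| ^ α := by
      rw [← Real.mul_rpow (by norm_num) (abs_nonneg s)]
      exact Real.rpow_le_rpow (norm_nonneg _) h6 hα.le
    calc |deriv f s| ≤ w * ‖n (graphCurve p (n p) f s) - n p‖ := h4
      _ ≤ 2 * (|C| * (2 ^ α * |s| ^ α)) := by
        refine mul_le_mul hw2 ?_ (norm_nonneg _) (by norm_num)
        refine h5.trans ?_
        calc C * ‖graphCurve p (n p) f s - p‖ ^ α
            ≤ |C| * ‖graphCurve p (n p) f s - p‖ ^ α := by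
              gcongr; exact le_abs_self C
          _ ≤ _ := by gcongr
      _ = _ := by ring
  refine ⟨2 * |C| * 2 ^ α, α, by positivity, hα, h1, fun s hs => ?_⟩
  have h2 := Convex.norm_image_sub_le_of_norm_deriv_le (f := f) (C := 2 * |C| * 2 ^ α * |s| ^ α)
    (s := uIcc 0 s) (x := 0) (y := s) (fun u _ => (hG.hasDerivAt u).differentiableAt)
    (fun u hu => ?_) (convex_uIcc 0 s) left_mem_uIcc right_mem_uIcc
  · simpa [hG.zero] using h2
  · have hus : |u| ≤ |s| := by
      have := abs_sub_left_of_mem_uIcc hu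
      simpa using this
    refine (h1 u (hus.trans_lt hs)).trans ?_
    gcongr

lemma integrable_angleKernel (x : Plane) : Integrable (angleKernel n x) (arcLength Ω) := by
  have hcl := hΩ.isCompact_frontier.isClosed
  by_cases hx : x ∈ frontier Ω
  · obtain ⟨δ, η, f, hG⟩ := exists_isGraphBox hΩ hx
    have hν := hG.norm_normal
    obtain ⟨C, α, hC, hα, hf', hf⟩ := hG.exists_deriv_le hΩ hx
    have hbm : MeasurableSet (frameBox x (n x) δ η) := (isOpen_frameBox _ _ _ _).measurableSet
    rw [← integrableOn_univ, ← union_compl_self (frameBox x (n x) δ η), integrableOn_union]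
    constructor
    · rw [arcLength, IntegrableOn, Measure.restrict_restrict hbm, inter_comm,
        ← IntegrableOn, hG.integrableOn_frontier_inter_box]
      have hpow : IntegrableOn (fun s : ℝ => 2 * C * |s| ^ (α - 1)) (Ioo (-δ) δ) := by
        have h1 : IntervalIntegrable (fun s : ℝ => |s| ^ (α - 1)) volume (-δ) δ := by
          have h2 : IntervalIntegrable (fun s : ℝ => |s| ^ (α - 1)) volume 0 δ := by
            have h3 : IntervalIntegrable (fun s : ℝ => s ^ (α - 1)) volume 0 δ :=
              intervalIntegral.intervalIntegrable_rpow' (by linarith)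
            refine h3.congr fun s hs => ?_
            rw [uIoc_of_le hG.pos_left.le] at hs
            simp only [abs_of_pos hs.1]
          have h4 : IntervalIntegrable (fun s : ℝ => |s| ^ (α - 1)) volume (-δ) 0 := by
            have := (IntervalIntegrable.iff_comp_neg (by simp)).1 h2
            simp only [abs_neg, neg_zero] at this
            exact this.symm
          exact h4.trans h2
        rw [intervalIntegrable_iff, uIoc_of_le (by linarith [hG.pos_left])] at h1
        exact (h1.mono_set Ioo_subset_Ioc_self).const_mul _
      refine Integrable.mono' hpow (f := fun s => √(1 + deriv f s ^ 2) *
        angleKernel n x (graphCurve x (n x) f s)) ?_ ?_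
      · have hm : Measurable fun s : ℝ => (f s - s * deriv f s) / (s ^ 2 + f s ^ 2) := by
          have h1 := hG.continuous.measurable
          have h2 := hG.continuous_deriv.measurable
          fun_prop
        refine hm.aestronglyMeasurable.congr ?_
        filter_upwards [ae_restrict_mem measurableSet_Ioo] with s hs
        have h1 := hG.normal_curve hΩ (abs_lt.2 hs)
        have h2 : graphCurve x (n x) f s - x = frameVec (n x) (s, f s) := by
          rw [graphCurve, frame_eq, add_sub_cancel_left]
        rw [angleKernel, mul_div_assoc', ← real_inner_smul_right, h1, h2,
          inner_frameVec hν, norm_frameVec_sq hν]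
        simp only
        congr 1; ring
      · filter_upwards [ae_restrict_mem measurableSet_Ioo] with s hs
        have hs' := abs_lt.2 hs
        have h1 := hG.normal_curve hΩ hs'
        have h2 : graphCurve x (n x) f s - x = frameVec (n x) (s, f s) := by
          rw [graphCurve, frame_eq, add_sub_cancel_left]
        rw [angleKernel, mul_div_assoc', ← real_inner_smul_right, h1, h2,
          inner_frameVec hν, norm_frameVec_sq hν, Real.norm_eq_abs, abs_div]
        simp only
        by_cases hs0 : s = 0
        · rw [hs0, hG.zero]
          simp
          positivity
        have hpos : 0 < |s| := abs_pos.2 hs0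
        have h3 : |s * -deriv f s + f s * 1| ≤ 2 * C * |s| ^ α * |s| := by
          calc |s * -deriv f s + f s * 1| ≤ |s * -deriv f s| + |f s * 1| := abs_add_le _ _
            _ = |s| * |deriv f s| + |f s| := by rw [abs_mul, abs_neg, mul_one]
            _ ≤ |s| * (C * |s| ^ α) + C * |s| ^ α * |s| :=
              add_le_add (mul_le_mul_of_nonneg_left (hf' s hs') hpos.le) (hf s hs')
            _ = _ := by ring
        have h4 : |s| ^ 2 ≤ |s ^ 2 + f s ^ 2| := by
          rw [abs_of_nonneg (a := s ^ 2 + f s ^ 2) (by positivity), sq_abs]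
          nlinarith [sq_nonneg (f s)]
        calc |s * -deriv f s + f s * 1| / |s ^ 2 + f s ^ 2|
            ≤ (2 * C * |s| ^ α * |s|) / |s| ^ 2 :=
              div_le_div₀ (by positivity) h3 (by positivity) h4
          _ = 2 * C * |s| ^ (α - 1) := by
            rw [Real.rpow_sub_one hpos.ne']
            field_simp
    · refine integrableOn_angleKernel_of_le hΩ x hbm.compl
        (d := min δ η) (lt_min hG.pos_left hG.pos_right) fun y hy => ?_
      by_contra hlt
      rw [not_le] at hlt
      apply hy
      have h1 := abs_real_inner_le_norm (y - x) (perp (n x))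
      have h2 := abs_real_inner_le_norm (y - x) (n x)
      rw [norm_perp, hν, mul_one] at h1
      rw [hν, mul_one] at h2
      exact ⟨h1.trans_lt (hlt.trans_le (min_le_left _ _)),
        h2.trans_lt (hlt.trans_le (min_le_right _ _))⟩
  · have hpos : ∃ d > 0, ∀ y ∈ frontier Ω, d ≤ ‖y - x‖ := by
      obtain ⟨d, hd, hball⟩ := Metric.isOpen_iff.1 hcl.isOpen_compl x hx
      refine ⟨d, hd, fun y hy => ?_⟩
      by_contra hlt
      exact hball (by simpa [dist_eq_norm] using hlt) hy
    obtain ⟨d, hd, h⟩ := hpos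
    have := integrableOn_angleKernel_of_le hΩ x hcl.measurableSet hd h
    rwa [IntegrableOn, arcLength, Measure.restrict_restrict hcl.measurableSet, inter_self] at this

end

/-! ### Gauss' formula with a radial weight -/

section Blowup

variable {Ω : Set Plane} {n : Plane → Plane} (hΩ : IsLyapunovDomain Ω n)
include hΩ

omit hΩ in
lemma ae_inner_ne_zero {ν : Plane} (hν : ‖ν‖ = 1) : ∀ᵐ z : Plane, inner ℝ z ν ≠ 0 := by
  let L : Plane →ₗ[ℝ] ℝ := (innerSL ℝ ν).toLinearMap
  have hL : ∀ z, L z = inner ℝ z ν := fun z => by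
    change inner ℝ ν z = _
    rw [real_inner_comm]
  have h := Measure.addHaar_submodule (volume : Measure Plane) (LinearMap.ker L) (by
    intro htop
    have : ν ∈ LinearMap.ker L := htop ▸ Submodule.mem_top
    rw [LinearMap.mem_ker, hL, real_inner_self_eq_norm_sq, hν] at this
    norm_num at this)
  rw [ae_iff]
  convert h using 2
  ext z
  simp [hL]

/-- Blown up at `x`, the domain `Ω` becomes the plane, a half-plane or the empty set, and so fills
the fraction `domainIndicator Ω x` of every radial integral. -/
lemma exists_blowup (x : Plane) : ∃ θ : Plane → ℝ,
    (∀ᵐ z : Plane, Tendsto (fun ε : ℝ => Ω.indicator (fun _ => (1 : ℝ)) (x + ε • z)) (𝓝[>] 0)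
      (𝓝 (θ z))) ∧
    ∀ ψ : ℝ → ℝ, Integrable (fun z : Plane => ψ ‖z‖) →
      ∫ z : Plane, θ z * ψ ‖z‖ = domainIndicator Ω x * ∫ z : Plane, ψ ‖z‖ := by
  have hlim : ∀ z : Plane, Tendsto (fun ε : ℝ => x + ε • z) (𝓝[>] 0) (𝓝 x) := fun z => by
    have : Continuous fun ε : ℝ => x + ε • z := by fun_prop
    simpa using (this.tendsto 0).mono_left (nhdsWithin_le_nhds (s := Ioi 0))
  by_cases hx : x ∈ Ω
  · refine ⟨fun _ => 1, Eventually.of_forall fun z => ?_, fun ψ _ => by simp [domainIndicator, hx]⟩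
    refine tendsto_const_nhds.congr' ?_
    filter_upwards [(hlim z).eventually (hΩ.isOpen.mem_nhds hx)] with ε hε
    rw [indicator_of_mem hε]
  by_cases hxf : x ∈ frontier Ω
  · obtain ⟨δ, η, f, hG⟩ := exists_isGraphBox hΩ hxf
    have hν := hG.norm_normal
    set ν := n x
    refine ⟨{z | inner ℝ z ν < 0}.indicator fun _ => 1, ?_, fun ψ hψ => ?_⟩
    · filter_upwards [ae_inner_ne_zero hν] with z hz
      refine tendsto_const_nhds.congr' ?_
      filter_upwards [hG.eventually_mem_iff_base hz] with ε hε
      by_cases h : inner ℝ z ν < 0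
      · rw [indicator_of_mem (hε.2 h), indicator_of_mem (show z ∈ {z | inner ℝ z ν < 0} from h)]
      · rw [indicator_of_notMem fun h' => h (hε.1 h'),
          indicator_of_notMem (show z ∉ {z | inner ℝ z ν < 0} from h)]
    · have hm : MeasurableSet {z : Plane | inner ℝ z ν < 0} :=
        (isOpen_lt (by fun_prop) continuous_const).measurableSet
      set A := {z : Plane | inner ℝ z ν < 0}
      have e1 : ∀ z, A.indicator (fun _ => (1 : ℝ)) z * ψ ‖z‖ =
          A.indicator (fun z => ψ ‖z‖) z := fun z => by
        by_cases hz : z ∈ A <;> simp [hz]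
      -- reflection in `x` exchanges the two half-planes
      have e2 : ∫ z, A.indicator (fun z => ψ ‖z‖) z = ∫ z, A.indicator (fun z => ψ ‖z‖) (-z) :=
        (integral_neg_eq_self _ _).symm
      have e3 : ∫ z, A.indicator (fun z => ψ ‖z‖) z + A.indicator (fun z => ψ ‖z‖) (-z) =
          ∫ z : Plane, ψ ‖z‖ := by
        refine integral_congr_ae ?_
        filter_upwards [ae_inner_ne_zero hν] with z hz
        have hA : z ∈ A ↔ inner ℝ z ν < 0 := Iff.rfl
        have hA' : -z ∈ A ↔ 0 < inner ℝ z ν := by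
          change inner ℝ (-z) ν < 0 ↔ _
          rw [inner_neg_left, neg_lt_zero]
        rcases lt_or_gt_of_ne hz with h | h
        · rw [indicator_of_mem (hA.2 h), indicator_of_notMem (fun h' => h.not_gt (hA'.1 h')),
            add_zero]
        · rw [indicator_of_mem (hA'.2 h), indicator_of_notMem (fun h' => h.not_gt (hA.1 h')),
            zero_add, norm_neg]
      have hi : Integrable (A.indicator fun z : Plane => ψ ‖z‖) := hψ.indicator hm
      rw [integral_add hi hi.comp_neg, ← e2] at e3
      simp_rw [e1]
      rw [← e3]
      simp only [domainIndicator, hx, hxf, if_false, if_true]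
      ring
  · refine ⟨fun _ => 0, Eventually.of_forall fun z => ?_,
      fun ψ _ => by simp [domainIndicator, hx, hxf]⟩
    have hcl : x ∉ closure Ω := fun h => hxf ⟨h, by rwa [hΩ.isOpen.interior_eq]⟩
    refine tendsto_const_nhds.congr' ?_
    filter_upwards [(hlim z).eventually (isClosed_closure.isOpen_compl.mem_nhds hcl)] with ε hε
    rw [indicator_of_notMem fun h => hε (subset_closure h)]

end Blowup

lemma hasFDerivAt_norm_sub_sq (x y : Plane) :
    HasFDerivAt (fun y : Plane => ‖y - x‖ ^ 2) (2 • innerSL ℝ (y - x)) y := by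
  have h := (hasStrictFDerivAt_norm_sq (y - x)).hasFDerivAt
  exact h.comp y ((hasFDerivAt_id y).sub_const x)

lemma hasCompactSupport_radial (x : Plane) {φ : ℝ → ℝ} {R : ℝ} (h : ∀ ρ ≥ R, φ ρ = 0) :
    HasCompactSupport fun y : Plane => φ (‖y - x‖ ^ 2) := by
  refine HasCompactSupport.intro (isCompact_closedBall x (√R)) fun y hy => h _ ?_
  rw [Metric.mem_closedBall, dist_eq_norm, not_le] at hy
  exact (Real.sqrt_lt' ((Real.sqrt_nonneg R).trans_lt hy)).1 hy |>.le

lemma integrable_radial (x : Plane) {φ : ℝ → ℝ} (hφ : Continuous φ) {R : ℝ}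
    (h : ∀ ρ ≥ R, φ ρ = 0) : Integrable fun y : Plane => φ (‖y - x‖ ^ 2) :=
  (hφ.comp (by fun_prop : Continuous fun y : Plane => ‖y - x‖ ^ 2)).integrable_of_hasCompactSupport
    (hasCompactSupport_radial x h)

lemma deriv_eq_zero_of_ge {φ : ℝ → ℝ} (hφ : ContDiff ℝ 1 φ) {R : ℝ} (h : ∀ ρ ≥ R, φ ρ = 0) :
    ∀ ρ ≥ R, deriv φ ρ = 0 := by
  intro ρ hρ
  have h1 : HasDerivWithinAt φ (deriv φ ρ) (Ici ρ) ρ :=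
    (hφ.differentiable one_ne_zero ρ).hasDerivAt.hasDerivWithinAt
  have h2 : HasDerivWithinAt φ 0 (Ici ρ) ρ :=
    (hasDerivWithinAt_const ρ (Ici ρ) (0 : ℝ)).congr (fun u hu => h u (hρ.trans hu)) (h ρ hρ)
  exact (uniqueDiffOn_Ici ρ ρ self_mem_Ici).eq_deriv _ h1 h2

section RadialGauss

variable {Ω : Set Plane} {n : Plane → Plane} (hΩ : IsLyapunovDomain Ω n)
include hΩ

/-- The Gauss–Green formula for the field `m (r²) (y - x)`, whose divergence is `2 (ρ m)'` at
`ρ = r²`. -/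
lemma integral_radial_field (x : Plane) {m : ℝ → ℝ} (hm : ContDiff ℝ 1 m) {R : ℝ}
    (hR : ∀ ρ ≥ R, m ρ = 0) :
    ∫ y, m (‖y - x‖ ^ 2) * inner ℝ (y - x) (n y) ∂(arcLength Ω) =
      ∫ y in Ω, 2 * (‖y - x‖ ^ 2 * deriv m (‖y - x‖ ^ 2) + m (‖y - x‖ ^ 2)) := by
  let e : Fin 2 → Plane := fun i => EuclideanSpace.single i 1
  let u : Fin 2 → Plane → ℝ := fun i y => m (‖y - x‖ ^ 2) * inner ℝ (y - x) (e i)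
  have hmc : ContDiff ℝ 1 fun y : Plane => m (‖y - x‖ ^ 2) :=
    hm.comp ((contDiff_id.sub contDiff_const).norm_sq ℝ)
  have hu : ∀ i, ContDiff ℝ 1 (u i) := fun i =>
    hmc.mul ((contDiff_id.sub contDiff_const).inner ℝ contDiff_const)
  have hc : ∀ i, HasCompactSupport (u i) := fun i => (hasCompactSupport_radial x hR).mul_right
  have hin : ∀ (i : Fin 2) (v : Plane), inner ℝ v (e i) = v i := fun i v => by
    simp [e, EuclideanSpace.inner_single_right]
  have hin' : ∀ (i : Fin 2) (v : Plane), inner ℝ (e i) v = v i := fun i v => by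
    rw [real_inner_comm, hin]
  have hfd : ∀ i y, fderiv ℝ (u i) y (e i) =
      2 * (y - x) i ^ 2 * deriv m (‖y - x‖ ^ 2) + m (‖y - x‖ ^ 2) := by
    intro i y
    have h1 := ((hm.differentiable one_ne_zero (‖y - x‖ ^ 2)).hasDerivAt).comp_hasFDerivAt y
      (hasFDerivAt_norm_sub_sq x y)
    have h2 : HasFDerivAt (fun y : Plane => inner ℝ (y - x) (e i)) (innerSL ℝ (e i)) y := by
      have := ((innerSL ℝ (e i)).hasFDerivAt (x := y - x)).comp y ((hasFDerivAt_id y).sub_const x)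
      refine this.congr_of_eventuallyEq (Eventually.of_forall fun z => ?_)
      simp only [Function.comp_apply, innerSL_apply_apply, id]
      rw [real_inner_comm]
    have h3 := h1.mul h2
    rw [show u i = (m ∘ fun y : Plane => ‖y - x‖ ^ 2) * fun y : Plane => inner ℝ (y - x) (e i)
      from rfl, h3.fderiv]
    have he : (e i) i = (1 : ℝ) := by simp [e]
    simp only [add_apply, smul_apply, innerSL_apply_apply, Function.comp_apply, smul_eq_mul,
      hin, he, nsmul_eq_mul]
    push_cast
    ring
  have hg := fun i => gauss_green hΩ (hu i) (hc i) (e i)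
  have hi : ∀ i, Integrable fun y => fderiv ℝ (u i) y (e i) := fun i =>
    (((hu i).continuous_fderiv one_ne_zero).clm_apply
      continuous_const).integrable_of_hasCompactSupport ((hc i).fderiv_apply (𝕜 := ℝ) (e i))
  have hb : ∀ i, Integrable (fun y => u i y * inner ℝ (e i) (n y)) (arcLength Ω) := fun i =>
    integrable_mul_inner_normal hΩ (hu i).continuous (e i)
  calc ∫ y, m (‖y - x‖ ^ 2) * inner ℝ (y - x) (n y) ∂(arcLength Ω)
      = ∫ y, (u 0 y * inner ℝ (e 0) (n y) + u 1 y * inner ℝ (e 1) (n y)) ∂(arcLength Ω) := by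
        congr 1
        funext y
        rw [plane_inner]
        simp only [u, hin, hin']
        ring
    _ = (∫ y in Ω, fderiv ℝ (u 0) y (e 0)) + ∫ y in Ω, fderiv ℝ (u 1) y (e 1) := by
        rw [integral_add (hb 0) (hb 1), hg 0, hg 1]
    _ = ∫ y in Ω, (fderiv ℝ (u 0) y (e 0) + fderiv ℝ (u 1) y (e 1)) :=
        (integral_add (hi 0).integrableOn (hi 1).integrableOn).symm
    _ = _ := by
        congr 1
        funext y
        rw [hfd, hfd]
        have := plane_norm_sq (y - x)
        linear_combination (-2 * deriv m (‖y - x‖ ^ 2)) * this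

/-- Gauss' formula with a radial weight that vanishes near `x`. -/
lemma integral_weight_angleKernel_of_zero (x : Plane) {G : ℝ → ℝ} (hG : ContDiff ℝ 1 G) {a R : ℝ}
    (ha : 0 < a) (hGa : ∀ ρ ≤ a, G ρ = 0) (hR : ∀ ρ ≥ R, G ρ = 0) :
    ∫ y, G (‖y - x‖ ^ 2) * angleKernel n x y ∂(arcLength Ω) =
      ∫ y in Ω, 2 * deriv G (‖y - x‖ ^ 2) := by
  let m : ℝ → ℝ := fun ρ => G ρ / ρ
  have hm : ContDiff ℝ 1 m := by
    rw [contDiff_iff_contDiffAt]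
    intro ρ
    rcases lt_or_ge ρ a with h | h
    · refine (contDiffAt_const (c := (0 : ℝ))).congr_of_eventuallyEq ?_
      filter_upwards [gt_mem_nhds h] with σ hσ
      simp only [m, hGa σ hσ.le, zero_div]
    · exact hG.contDiffAt.div contDiffAt_id (ha.trans_le h).ne'
  have hmR : ∀ ρ ≥ R, m ρ = 0 := fun ρ hρ => by simp only [m, hR ρ hρ, zero_div]
  have hmG : ∀ ρ, ρ * m ρ = G ρ := fun ρ => by
    by_cases h : ρ = 0
    · rw [h, zero_mul, hGa 0 ha.le]
    · simp only [m]; field_simp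
  have hd : ∀ ρ, ρ * deriv m ρ + m ρ = deriv G ρ := fun ρ => by
    have h1 := (hasDerivAt_id ρ).mul (hm.differentiable one_ne_zero ρ).hasDerivAt
    have h2 : (id * m) = G := funext hmG
    rw [h2] at h1
    rw [h1.deriv]
    simp only [id]; ring
  have h := integral_radial_field hΩ x hm hmR
  simp_rw [hd] at h
  rw [← h]
  congr 1
  funext y
  simp only [m, angleKernel]
  ring

end RadialGauss

/-- A smooth function of `ρ` that vanishes for `ρ ≤ 1` and equals `1` for `ρ ≥ 2`. -/
def cutoff (ρ : ℝ) : ℝ := Real.smoothTransition (ρ - 1)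

lemma contDiff_cutoff : ContDiff ℝ 1 cutoff :=
  Real.smoothTransition.contDiff.comp (contDiff_id.sub contDiff_const)

lemma cutoff_hasDerivAt (ρ : ℝ) : HasDerivAt cutoff (deriv cutoff ρ) ρ :=
  (contDiff_cutoff.differentiable one_ne_zero ρ).hasDerivAt

lemma continuous_deriv_cutoff : Continuous (deriv cutoff) :=
  contDiff_cutoff.continuous_deriv le_rfl

lemma cutoff_of_le {ρ : ℝ} (h : ρ ≤ 1) : cutoff ρ = 0 :=
  Real.smoothTransition.zero_of_nonpos (by linarith)

lemma cutoff_of_ge {ρ : ℝ} (h : 2 ≤ ρ) : cutoff ρ = 1 :=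
  Real.smoothTransition.one_of_one_le (by linarith)

lemma abs_cutoff_le (ρ : ℝ) : |cutoff ρ| ≤ 1 := by
  rw [cutoff, abs_of_nonneg (Real.smoothTransition.nonneg _)]
  exact Real.smoothTransition.le_one _

lemma deriv_cutoff_of_ge : ∀ ρ ≥ (2 : ℝ), deriv cutoff ρ = 0 := by
  intro ρ hρ
  have h := deriv_eq_zero_of_ge (φ := fun ρ => cutoff ρ - 1) (contDiff_cutoff.sub contDiff_const)
    (R := 2) (fun ρ hρ => by rw [cutoff_of_ge hρ, sub_self]) ρ hρ
  rwa [deriv_sub_const] at h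

lemma integral_deriv_cutoff : ∫ z : Plane, 2 * deriv cutoff (‖z‖ ^ 2) = 2 * Real.pi := by
  have h := integral_fun_norm_addHaar (volume : Measure Plane)
    fun y : ℝ => 2 * deriv cutoff (y ^ 2)
  rw [h]
  have hfr : Module.finrank ℝ Plane = 2 := by simp
  have hvol : (volume : Measure Plane).real (Metric.ball 0 1) = Real.pi := by
    rw [measureReal_def, EuclideanSpace.volume_ball_fin_two]
    simp [Real.pi_pos.le]
  have hint : ∫ y in Ioi (0 : ℝ), y ^ (2 - 1) • (2 * deriv cutoff (y ^ 2)) = 1 := by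
    have hd : ∀ y : ℝ, HasDerivAt (fun y : ℝ => cutoff (y ^ 2))
        (y ^ (2 - 1) • (2 * deriv cutoff (y ^ 2))) y := fun y => by
      have := (cutoff_hasDerivAt (y ^ 2)).comp y (hasDerivAt_pow 2 y)
      refine this.congr_deriv ?_
      simp only [smul_eq_mul]
      push_cast
      ring
    have hev : ∀ y : ℝ, 2 ≤ y → cutoff (y ^ 2) = 1 := fun y hy => cutoff_of_ge (by nlinarith)
    have hi : IntegrableOn (fun y : ℝ => y ^ (2 - 1) • (2 * deriv cutoff (y ^ 2))) (Ioi 0) := by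
      have hc : Continuous fun y : ℝ => y ^ (2 - 1) • (2 * deriv cutoff (y ^ 2)) := by
        have := continuous_deriv_cutoff
        fun_prop
      refine (hc.integrable_of_hasCompactSupport (HasCompactSupport.intro
        (isCompact_Icc (a := -2) (b := 2)) fun y hy => ?_)).integrableOn
      have h4 : 2 ≤ y ^ 2 := by
        by_contra hlt
        exact hy ⟨by nlinarith, by nlinarith⟩
      rw [deriv_cutoff_of_ge _ h4]
      simp
    have := integral_Ioi_of_hasDerivAt_of_tendsto' (fun y _ => hd y) hi
      (tendsto_const_nhds.congr' (by
        filter_upwards [eventually_ge_atTop 2] with y hy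
        exact (hev y hy).symm))
    rw [this, cutoff_of_le (by norm_num), sub_zero]
  rw [hfr, hvol, hint]
  simp

section

variable {Ω : Set Plane} {n : Plane → Plane} (hΩ : IsLyapunovDomain Ω n)
include hΩ

omit hΩ in
lemma ae_arcLength_ne (x : Plane) : ∀ᵐ y ∂(arcLength Ω), y ≠ x := by
  have := Measure.nullSingletonClass_hausdorff Plane (d := 1) one_pos
  exact ae_restrict_of_ae (Measure.ae_ne _ x)

/-- Gauss' formula with a radial weight `g (r²)`. The weight is cut off near `x`; as the cut-off
shrinks, its derivative concentrates at `x` and yields the term at `x`. -/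
theorem integral_weight_angleKernel (x : Plane) {g : ℝ → ℝ} (hg : ContDiff ℝ 1 g) {R : ℝ}
    (hR : ∀ ρ ≥ R, g ρ = 0) :
    ∫ y, g (‖y - x‖ ^ 2) * angleKernel n x y ∂(arcLength Ω) =
      (∫ y in Ω, 2 * deriv g (‖y - x‖ ^ 2)) + 2 * Real.pi * domainIndicator Ω x * g 0 := by
  have hg' : Continuous (deriv g) := hg.continuous_deriv le_rfl
  have hrc : Continuous fun y : Plane => ‖y - x‖ ^ 2 := by fun_prop
  have hχc : ∀ ε : ℝ, Continuous fun y : Plane => cutoff (‖y - x‖ ^ 2 / ε ^ 2) := fun ε =>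
    contDiff_cutoff.continuous.comp (hrc.div_const _)
  have hχ'c : ∀ ε : ℝ, Continuous fun y : Plane => deriv cutoff (‖y - x‖ ^ 2 / ε ^ 2) := fun ε =>
    continuous_deriv_cutoff.comp (hrc.div_const _)
  obtain ⟨M, hM⟩ : ∃ M, ∀ ρ, 0 ≤ ρ → |g ρ| ≤ M := by
    obtain ⟨M, hM⟩ := (isCompact_Icc (a := 0) (b := R)).exists_bound_of_continuousOn
      hg.continuous.continuousOn
    refine ⟨max M 0, fun ρ hρ => ?_⟩
    rcases le_total ρ R with h | h
    · exact (hM ρ ⟨hρ, h⟩).trans (le_max_left _ _)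
    · rw [hR ρ h, abs_zero]; exact le_max_right _ _
  have hκ := integrable_angleKernel hΩ x
  -- away from `x` the cut-off is eventually `1`
  have hχ1 : ∀ y : Plane, y ≠ x → ∀ᶠ ε : ℝ in 𝓝[>] 0, cutoff (‖y - x‖ ^ 2 / ε ^ 2) = 1 := by
    intro y hy
    have hpos : 0 < ‖y - x‖ := norm_pos_iff.2 (sub_ne_zero.2 hy)
    have h1 : ∀ᶠ ε : ℝ in 𝓝[>] 0, 2 * ε ^ 2 < ‖y - x‖ ^ 2 := by
      have : Continuous fun ε : ℝ => 2 * ε ^ 2 := by fun_prop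
      exact ((this.tendsto 0).mono_left nhdsWithin_le_nhds).eventually_lt_const
        (by rw [zero_pow two_ne_zero, mul_zero]; positivity)
    filter_upwards [h1, self_mem_nhdsWithin] with ε h2 h3
    have h3' : (0 : ℝ) < ε := h3
    apply cutoff_of_ge
    rw [le_div_iff₀ (by positivity)]
    exact h2.le
  have hL : Tendsto (fun ε : ℝ => ∫ y, (g (‖y - x‖ ^ 2) * cutoff (‖y - x‖ ^ 2 / ε ^ 2)) *
      angleKernel n x y ∂(arcLength Ω)) (𝓝[>] 0)
      (𝓝 (∫ y, g (‖y - x‖ ^ 2) * angleKernel n x y ∂(arcLength Ω))) := by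
    refine tendsto_integral_filter_of_dominated_convergence (fun y => M * |angleKernel n x y|)
      (Eventually.of_forall fun ε => ?_) (Eventually.of_forall fun ε => ?_)
      (hκ.abs.const_mul M) ?_
    · exact ((hg.continuous.comp hrc).mul (hχc ε)).aestronglyMeasurable.mul hκ.1
    · refine Eventually.of_forall fun y => ?_
      rw [Real.norm_eq_abs, abs_mul, abs_mul]
      gcongr
      have h1 := hM (‖y - x‖ ^ 2) (sq_nonneg _)
      have h2 := abs_cutoff_le (‖y - x‖ ^ 2 / ε ^ 2)
      nlinarith [abs_nonneg (g (‖y - x‖ ^ 2))]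
    · filter_upwards [ae_arcLength_ne x] with y hy
      refine tendsto_const_nhds.congr' ?_
      filter_upwards [hχ1 y hy] with ε hε
      rw [hε, mul_one]
  have hi1 : Integrable fun y : Plane => 2 * deriv g (‖y - x‖ ^ 2) :=
    (integrable_radial x hg' (deriv_eq_zero_of_ge hg hR)).const_mul 2
  have hR1 : Tendsto (fun ε : ℝ => ∫ y in Ω, 2 * deriv g (‖y - x‖ ^ 2) *
      cutoff (‖y - x‖ ^ 2 / ε ^ 2)) (𝓝[>] 0) (𝓝 (∫ y in Ω, 2 * deriv g (‖y - x‖ ^ 2))) := by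
    refine tendsto_integral_filter_of_dominated_convergence
      (fun y => |2 * deriv g (‖y - x‖ ^ 2)|)
      (Eventually.of_forall fun ε => ?_) (Eventually.of_forall fun ε => ?_)
      hi1.abs.integrableOn ?_
    · exact (((hg'.comp hrc).const_mul 2).mul (hχc ε)).aestronglyMeasurable
    · refine Eventually.of_forall fun y => ?_
      rw [Real.norm_eq_abs, abs_mul]
      have h2 := abs_cutoff_le (‖y - x‖ ^ 2 / ε ^ 2)
      nlinarith [abs_nonneg (2 * deriv g (‖y - x‖ ^ 2))]
    · filter_upwards [ae_restrict_of_ae (Measure.ae_ne volume x)] with y hy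
      refine tendsto_const_nhds.congr' ?_
      filter_upwards [hχ1 y hy] with ε hε
      rw [hε, mul_one]
  obtain ⟨θ, hθ, hθi⟩ := exists_blowup hΩ x
  have hi2 : Integrable fun z : Plane => 2 * deriv cutoff (‖z‖ ^ 2) := by
    have := (integrable_radial 0 continuous_deriv_cutoff deriv_cutoff_of_ge).const_mul 2
    simpa using this
  -- the contribution of the derivative of the cut-off, in the variable `z = (y - x) / ε`
  have hscale : ∀ ε : ℝ, 0 < ε → ∫ y in Ω, 2 * (g (‖y - x‖ ^ 2) *
      (deriv cutoff (‖y - x‖ ^ 2 / ε ^ 2) / ε ^ 2)) =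
      ∫ z : Plane, Ω.indicator (fun _ => (1 : ℝ)) (x + ε • z) *
        (g (ε ^ 2 * ‖z‖ ^ 2) * (2 * deriv cutoff (‖z‖ ^ 2))) := by
    intro ε hε
    set F : Plane → ℝ := Ω.indicator fun y => 2 * (g (‖y - x‖ ^ 2) *
      (deriv cutoff (‖y - x‖ ^ 2 / ε ^ 2) / ε ^ 2)) with hF
    have h1 := Measure.integral_comp_smul (volume : Measure Plane) (fun y => F (x + y)) ε
    rw [integral_add_left_eq_self F x, hF, integral_indicator hΩ.isOpen.measurableSet, ← hF] at h1
    have hfr : Module.finrank ℝ Plane = 2 := by simp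
    rw [hfr, abs_of_pos (by positivity), smul_eq_mul, eq_inv_mul_iff_mul_eq₀ (by positivity)] at h1
    rw [← h1, ← integral_const_mul]
    congr 1
    funext z
    have h2 : ‖x + ε • z - x‖ ^ 2 = ε ^ 2 * ‖z‖ ^ 2 := by
      rw [add_sub_cancel_left, norm_smul, mul_pow, Real.norm_eq_abs, sq_abs]
    by_cases hz : x + ε • z ∈ Ω
    · rw [hF, indicator_of_mem hz, indicator_of_mem hz, h2,
        mul_div_cancel_left₀ _ (by positivity : ε ^ 2 ≠ 0)]
      field_simp
    · rw [hF, indicator_of_notMem hz, indicator_of_notMem hz]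
      ring
  have hR2 : Tendsto (fun ε : ℝ => ∫ y in Ω, 2 * (g (‖y - x‖ ^ 2) *
      (deriv cutoff (‖y - x‖ ^ 2 / ε ^ 2) / ε ^ 2))) (𝓝[>] 0)
      (𝓝 (2 * Real.pi * domainIndicator Ω x * g 0)) := by
    have hval : 2 * Real.pi * domainIndicator Ω x * g 0 =
        ∫ z : Plane, θ z * (g 0 * (2 * deriv cutoff (‖z‖ ^ 2))) := by
      rw [hθi (fun y => g 0 * (2 * deriv cutoff (y ^ 2))) (hi2.const_mul _), integral_const_mul,
        integral_deriv_cutoff]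
      ring
    rw [hval]
    have ht : Tendsto (fun ε : ℝ => ∫ z : Plane, Ω.indicator (fun _ => (1 : ℝ)) (x + ε • z) *
        (g (ε ^ 2 * ‖z‖ ^ 2) * (2 * deriv cutoff (‖z‖ ^ 2)))) (𝓝[>] 0)
        (𝓝 (∫ z : Plane, θ z * (g 0 * (2 * deriv cutoff (‖z‖ ^ 2))))) := by
      refine tendsto_integral_filter_of_dominated_convergence
        (fun z => M * |2 * deriv cutoff (‖z‖ ^ 2)|)
        (Eventually.of_forall fun ε => ?_) (Eventually.of_forall fun ε => ?_)
        (hi2.abs.const_mul M) ?_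
      · have h1 : Measurable fun z : Plane => Ω.indicator (fun _ => (1 : ℝ)) (x + ε • z) :=
          (measurable_const.indicator hΩ.isOpen.measurableSet).comp
            (by fun_prop : Continuous fun z : Plane => x + ε • z).measurable
        have h2 : Continuous fun z : Plane =>
            g (ε ^ 2 * ‖z‖ ^ 2) * (2 * deriv cutoff (‖z‖ ^ 2)) :=
          (hg.continuous.comp (by fun_prop)).mul
            ((continuous_deriv_cutoff.comp (by fun_prop)).const_mul 2)
        exact (h1.mul h2.measurable).aestronglyMeasurable
      · refine Eventually.of_forall fun z => ?_
        rw [norm_mul, norm_mul]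
        have h1 : ‖Ω.indicator (fun _ => (1 : ℝ)) (x + ε • z)‖ ≤ 1 := by
          by_cases hz : x + ε • z ∈ Ω <;> simp [hz]
        have h2 : ‖g (ε ^ 2 * ‖z‖ ^ 2)‖ ≤ M := hM _ (by positivity)
        calc _ ≤ 1 * (M * ‖2 * deriv cutoff (‖z‖ ^ 2)‖) := by gcongr
          _ = _ := by rw [one_mul, Real.norm_eq_abs]
      · filter_upwards [hθ] with z hz
        refine hz.mul (Tendsto.mul_const _ ?_)
        have hc : Continuous fun ε : ℝ => g (ε ^ 2 * ‖z‖ ^ 2) :=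
          hg.continuous.comp (by fun_prop)
        simpa using (hc.tendsto 0).mono_left (nhdsWithin_le_nhds (s := Ioi 0))
    refine ht.congr' ?_
    filter_upwards [self_mem_nhdsWithin] with ε hε
    exact (hscale ε hε).symm
  refine tendsto_nhds_unique hL ((hR1.add hR2).congr' ?_)
  filter_upwards [self_mem_nhdsWithin] with ε hε
  have hε' : (0 : ℝ) < ε := hε
  have hGd : ContDiff ℝ 1 fun ρ : ℝ => g ρ * cutoff (ρ / ε ^ 2) :=
    hg.mul (contDiff_cutoff.comp (contDiff_id.div_const _))
  have h := integral_weight_angleKernel_of_zero hΩ x hGd (a := ε ^ 2) (R := R) (by positivity)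
    (fun ρ hρ => by
      rw [cutoff_of_le ((div_le_one (by positivity)).2 hρ), mul_zero])
    (fun ρ hρ => by rw [hR ρ hρ, zero_mul])
  have hder : ∀ ρ : ℝ, deriv (fun ρ : ℝ => g ρ * cutoff (ρ / ε ^ 2)) ρ =
      deriv g ρ * cutoff (ρ / ε ^ 2) + g ρ * (deriv cutoff (ρ / ε ^ 2) / ε ^ 2) := fun ρ => by
    have h1 := (hg.differentiable one_ne_zero ρ).hasDerivAt
    have h2 := (cutoff_hasDerivAt (ρ / ε ^ 2)).comp ρ ((hasDerivAt_id ρ).div_const (ε ^ 2))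
    have h3 := h1.mul h2
    have h4 : HasDerivAt (fun ρ : ℝ => g ρ * cutoff (ρ / ε ^ 2)) _ ρ := h3
    rw [h4.deriv]
    simp only [Function.comp_apply, id]
    ring
  simp_rw [hder] at h
  rw [h, ← integral_add]
  · congr 1
    funext y
    ring
  · have hc : Continuous fun ρ : ℝ => 2 * deriv g ρ * cutoff (ρ / ε ^ 2) :=
      (hg'.const_mul 2).mul (contDiff_cutoff.continuous.comp (by fun_prop))
    exact (integrable_radial x hc (R := R) fun ρ hρ => by
      rw [deriv_eq_zero_of_ge hg hR ρ hρ]; ring).integrableOn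
  · have hc : Continuous fun ρ : ℝ => 2 * (g ρ * (deriv cutoff (ρ / ε ^ 2) / ε ^ 2)) :=
      (hg.continuous.mul ((continuous_deriv_cutoff.comp (by fun_prop)).div_const _)).const_mul 2
    exact (integrable_radial x hc (R := R) fun ρ hρ => by rw [hR ρ hρ]; ring).integrableOn

end

/-! ### The area integral as a boundary integral -/

lemma hasDerivAt_sqrt_sub_sq {τ r : ℝ} (hτ : r < τ) (hr : 0 ≤ r) :
    HasDerivAt (fun σ => √(σ ^ 2 - r ^ 2)) (τ / √(τ ^ 2 - r ^ 2)) τ := by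
  have hpos : 0 < τ ^ 2 - r ^ 2 := by nlinarith
  have := ((hasDerivAt_pow 2 τ).sub_const (r ^ 2)).sqrt hpos.ne'
  refine this.congr_deriv ?_
  have := Real.sqrt_pos.2 hpos
  push_cast
  field_simp

lemma hasDerivAt_neg_sqrt_sub_sq {τ r : ℝ} (hτ : r < τ) (hr : 0 ≤ r) :
    HasDerivAt (fun ρ => -√(τ ^ 2 - ρ ^ 2)) (r / √(τ ^ 2 - r ^ 2)) r := by
  have hpos : 0 < τ ^ 2 - r ^ 2 := by nlinarith
  have := (((hasDerivAt_pow 2 r).const_sub (τ ^ 2)).sqrt hpos.ne').neg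
  refine this.congr_deriv ?_
  have := Real.sqrt_pos.2 hpos
  push_cast
  field_simp

lemma sqrt_sub_sq_of_le {τ r : ℝ} (hτ : 0 ≤ τ) (h : τ ≤ r) : √(τ ^ 2 - r ^ 2) = 0 :=
  Real.sqrt_eq_zero_of_nonpos (by nlinarith)

/-- The convergence of the area integral over the whole disc. Outside the disc the integrand is `0`,
by the conventions on square roots and division. -/
lemma integrable_inv_sqrt (x : Plane) {τ : ℝ} (hτ : 0 < τ) :
    Integrable fun y : Plane => 1 / √(τ ^ 2 - ‖y - x‖ ^ 2) := by
  have h : Integrable fun y : Plane => 1 / √(τ ^ 2 - ‖y‖ ^ 2) := by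
    have := integrable_fun_norm_addHaar (volume : Measure Plane)
      (f := fun r : ℝ => 1 / √(τ ^ 2 - r ^ 2))
    rw [this]
    have hfr : Module.finrank ℝ Plane = 2 := by simp
    rw [hfr, ← Ioc_union_Ioi_eq_Ioi hτ.le]
    refine IntegrableOn.union ?_ ?_
    · have h1 := intervalIntegral.integrableOn_deriv_of_nonneg (a := 0) (b := τ)
        (g := fun ρ => -√(τ ^ 2 - ρ ^ 2)) (g' := fun r => r / √(τ ^ 2 - r ^ 2))
        (by fun_prop) (fun r hr => hasDerivAt_neg_sqrt_sub_sq hr.2 hr.1.le)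
        (fun r hr => div_nonneg hr.1.le (Real.sqrt_nonneg _))
      refine h1.congr_fun (fun r _ => ?_) measurableSet_Ioc
      simp [div_eq_mul_inv]
    · refine integrableOn_zero.congr_fun (fun r hr => ?_) measurableSet_Ioi
      simp only [sqrt_sub_sq_of_le hτ.le (le_of_lt hr), div_zero, smul_zero]
  exact h.comp_sub_right x

/-- A continuous approximation from below, as `δ → 0+`, of the derivative `1 / (2 √u)` of the square
root. -/
def sqrtDerivApprox (δ u : ℝ) : ℝ := √u / (2 * (|u| + δ))

/-- The primitive of `sqrtDerivApprox`, a `C¹` approximation of the square root. -/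
def sqrtApprox (δ u : ℝ) : ℝ := ∫ v in (0 : ℝ)..u, sqrtDerivApprox δ v

lemma continuous_sqrtDerivApprox {δ : ℝ} (hδ : 0 < δ) : Continuous (sqrtDerivApprox δ) := by
  unfold sqrtDerivApprox
  exact Real.continuous_sqrt.div (by fun_prop) fun u => by positivity

lemma sqrtDerivApprox_nonneg {δ : ℝ} (hδ : 0 < δ) (u : ℝ) : 0 ≤ sqrtDerivApprox δ u := by
  unfold sqrtDerivApprox; positivity

lemma sqrtDerivApprox_le {δ : ℝ} (hδ : 0 < δ) (u : ℝ) : sqrtDerivApprox δ u ≤ 1 / (2 * √u) := by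
  unfold sqrtDerivApprox
  rcases le_or_gt u 0 with h | h
  · simp [Real.sqrt_eq_zero_of_nonpos h]
  · have h1 := Real.sqrt_pos.2 h
    rw [div_le_div_iff₀ (by positivity) (by positivity), abs_of_pos h]
    have := Real.mul_self_sqrt h.le
    nlinarith

lemma tendsto_sqrtDerivApprox (u : ℝ) :
    Tendsto (fun δ => sqrtDerivApprox δ u) (𝓝[>] 0) (𝓝 (1 / (2 * √u))) := by
  rcases le_or_gt u 0 with h | h
  · have : ∀ δ, sqrtDerivApprox δ u = 1 / (2 * √u) := fun δ => by
      simp [sqrtDerivApprox, Real.sqrt_eq_zero_of_nonpos h]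
    simp_rw [this]
    exact tendsto_const_nhds
  · have h1 := Real.sqrt_pos.2 h
    have hc : ContinuousAt (fun δ => sqrtDerivApprox δ u) 0 := by
      unfold sqrtDerivApprox
      refine continuousAt_const.div (by fun_prop) ?_
      rw [add_zero, abs_of_pos h]; positivity
    have h2 : sqrtDerivApprox 0 u = 1 / (2 * √u) := by
      rw [sqrtDerivApprox, add_zero, abs_of_pos h]
      have := Real.mul_self_sqrt h.le
      field_simp
      nlinarith
    rw [← h2]
    exact hc.tendsto.mono_left nhdsWithin_le_nhds

lemma sqrtApprox_hasDerivAt {δ : ℝ} (hδ : 0 < δ) (u : ℝ) :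
    HasDerivAt (sqrtApprox δ) (sqrtDerivApprox δ u) u :=
  intervalIntegral.integral_hasDerivAt_right
    ((continuous_sqrtDerivApprox hδ).intervalIntegrable _ _)
    ((continuous_sqrtDerivApprox hδ).stronglyMeasurableAtFilter _ _)
    (continuous_sqrtDerivApprox hδ).continuousAt

lemma sqrtApprox_of_nonpos (δ : ℝ) {u : ℝ} (hu : u ≤ 0) : sqrtApprox δ u = 0 := by
  rw [sqrtApprox, intervalIntegral.integral_symm, intervalIntegral.integral_of_le hu,
    setIntegral_eq_zero_of_forall_eq_zero, neg_zero]
  intro v hv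
  rw [sqrtDerivApprox, Real.sqrt_eq_zero_of_nonpos hv.2, zero_div]

lemma intervalIntegrable_inv_sqrt {u : ℝ} (hu : 0 ≤ u) :
    IntervalIntegrable (fun v => 1 / (2 * √v)) volume 0 u := by
  rw [intervalIntegrable_iff, uIoc_of_le hu]
  exact intervalIntegral.integrableOn_deriv_of_nonneg (g := Real.sqrt)
    Real.continuous_sqrt.continuousOn (fun v hv => Real.hasDerivAt_sqrt hv.1.ne')
    (fun v _ => by positivity)

lemma integral_inv_sqrt {u : ℝ} (hu : 0 ≤ u) : ∫ v in (0 : ℝ)..u, 1 / (2 * √v) = √u := by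
  rw [intervalIntegral.integral_eq_sub_of_hasDerivAt_of_le hu Real.continuous_sqrt.continuousOn
    (fun v hv => Real.hasDerivAt_sqrt hv.1.ne') (intervalIntegrable_inv_sqrt hu), Real.sqrt_zero,
    sub_zero]

lemma sqrtApprox_mem {δ : ℝ} (hδ : 0 < δ) (u : ℝ) : sqrtApprox δ u ∈ Icc 0 (√u) := by
  rcases le_or_gt u 0 with h | h
  · rw [sqrtApprox_of_nonpos δ h]
    exact ⟨le_rfl, Real.sqrt_nonneg _⟩
  · refine ⟨intervalIntegral.integral_nonneg h.le fun v _ => sqrtDerivApprox_nonneg hδ v, ?_⟩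
    rw [← integral_inv_sqrt h.le]
    exact intervalIntegral.integral_mono_on h.le
      ((continuous_sqrtDerivApprox hδ).intervalIntegrable _ _) (intervalIntegrable_inv_sqrt h.le)
      fun v _ => sqrtDerivApprox_le hδ v

lemma tendsto_sqrtApprox (u : ℝ) : Tendsto (fun δ => sqrtApprox δ u) (𝓝[>] 0) (𝓝 (√u)) := by
  rcases le_or_gt u 0 with h | h
  · simp_rw [sqrtApprox_of_nonpos _ h, Real.sqrt_eq_zero_of_nonpos h]
    exact tendsto_const_nhds
  · rw [← integral_inv_sqrt h.le]
    refine intervalIntegral.tendsto_integral_filter_of_dominated_convergence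
      (fun v => 1 / (2 * √v)) ?_ ?_ (intervalIntegrable_inv_sqrt h.le) ?_
    · filter_upwards [self_mem_nhdsWithin] with δ hδ
      exact (continuous_sqrtDerivApprox hδ).aestronglyMeasurable
    · filter_upwards [self_mem_nhdsWithin] with δ hδ
      refine Eventually.of_forall fun v _ => ?_
      rw [Real.norm_of_nonneg (sqrtDerivApprox_nonneg hδ v)]
      exact sqrtDerivApprox_le hδ v
    · exact Eventually.of_forall fun v _ => tendsto_sqrtDerivApprox v

lemma contDiff_sqrtApprox {δ : ℝ} (hδ : 0 < δ) : ContDiff ℝ 1 (sqrtApprox δ) := by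
  have hd : deriv (sqrtApprox δ) = sqrtDerivApprox δ :=
    funext fun u => (sqrtApprox_hasDerivAt hδ u).deriv
  rw [contDiff_one_iff_deriv, hd]
  exact ⟨fun u => (sqrtApprox_hasDerivAt hδ u).differentiableAt, continuous_sqrtDerivApprox hδ⟩

/-- `(1 - (r/τ)²)^(-1/2)` for `0 ≤ r < τ`, in the form that vanishes for `0 ≤ τ ≤ r`. -/
def frontKernel (τ r : ℝ) : ℝ := τ / √(τ ^ 2 - r ^ 2)

lemma frontKernel_eq {τ : ℝ} (hτ : 0 < τ) (r : ℝ) :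
    1 / √(1 - (r / τ) ^ 2) = frontKernel τ r := by
  have h : 1 - (r / τ) ^ 2 = (τ ^ 2 - r ^ 2) / τ ^ 2 := by field_simp
  rw [frontKernel, h, Real.sqrt_div' _ (sq_nonneg τ), Real.sqrt_sq hτ.le, one_div_div]

lemma frontKernel_nonneg {τ : ℝ} (hτ : 0 ≤ τ) (r : ℝ) : 0 ≤ frontKernel τ r :=
  div_nonneg hτ (Real.sqrt_nonneg _)

lemma frontKernel_of_le {τ r : ℝ} (hτ : 0 ≤ τ) (h : τ ≤ r) : frontKernel τ r = 0 := by
  rw [frontKernel, sqrt_sub_sq_of_le hτ h, div_zero]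

lemma measurable_frontKernel : Measurable fun z : ℝ × ℝ => frontKernel z.1 z.2 := by
  unfold frontKernel; fun_prop

lemma intervalIntegrable_frontKernel {r T : ℝ} (hr : 0 ≤ r) (hT : 0 ≤ T) :
    IntervalIntegrable (fun σ => frontKernel σ r) volume 0 T ∧
      ∫ σ in (0 : ℝ)..T, frontKernel σ r = √(T ^ 2 - r ^ 2) := by
  have h0 : ∀ a, 0 ≤ a → a ≤ r → EqOn (fun σ => frontKernel σ r) (fun _ => 0) (uIcc 0 a) := by
    intro a ha har σ hσ
    rw [uIcc_of_le ha] at hσ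
    exact frontKernel_of_le hσ.1 (hσ.2.trans har)
  have h0i : ∀ a, 0 ≤ a → a ≤ r → IntervalIntegrable (fun σ => frontKernel σ r) volume 0 a :=
    fun a ha har => (intervalIntegrable_const (c := (0 : ℝ))).congr
      fun σ hσ => (h0 a ha har (uIoc_subset_uIcc hσ)).symm
  rcases le_or_gt T r with h | h
  · refine ⟨h0i T hT h, ?_⟩
    rw [intervalIntegral.integral_congr (h0 T hT h), sqrt_sub_sq_of_le hT h]
    simp
  · have hcont : ContinuousOn (fun σ => √(σ ^ 2 - r ^ 2)) (Icc r T) := by fun_prop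
    have h1 : IntervalIntegrable (fun σ => frontKernel σ r) volume r T := by
      rw [intervalIntegrable_iff, uIoc_of_le h.le]
      exact intervalIntegral.integrableOn_deriv_of_nonneg hcont
        (fun σ hσ => hasDerivAt_sqrt_sub_sq hσ.1 hr)
        (fun σ hσ => frontKernel_nonneg (hr.trans hσ.1.le) r)
    refine ⟨(h0i r hr le_rfl).trans h1, ?_⟩
    rw [← intervalIntegral.integral_add_adjacent_intervals (h0i r hr le_rfl) h1,
      intervalIntegral.integral_congr (h0 r hr le_rfl)]
    have h2 : ∫ σ in r..T, frontKernel σ r = √(T ^ 2 - r ^ 2) - √(r ^ 2 - r ^ 2) :=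
      intervalIntegral.integral_eq_sub_of_hasDerivAt_of_le h.le hcont
        (fun σ hσ => hasDerivAt_sqrt_sub_sq hσ.1 hr) h1
    rw [h2]
    simp

section

variable {Ω : Set Plane} {n : Plane → Plane} (hΩ : IsLyapunovDomain Ω n)
include hΩ

/-- Gauss' formula with the weight `√(τ² - r²)`. -/
lemma integral_area_eq (x : Plane) {τ : ℝ} (hτ : 0 < τ) :
    ∫ y in Ω, 1 / √(τ ^ 2 - ‖y - x‖ ^ 2) = 2 * Real.pi * domainIndicator Ω x * τ -
      ∫ y, √(τ ^ 2 - ‖y - x‖ ^ 2) * angleKernel n x y ∂(arcLength Ω) := by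
  have hκ := integrable_angleKernel hΩ x
  have hI := integrable_inv_sqrt x hτ
  have hrc : Continuous fun y : Plane => τ ^ 2 - ‖y - x‖ ^ 2 := by fun_prop
  have hg : ∀ δ : ℝ, 0 < δ → ∫ y, sqrtApprox δ (τ ^ 2 - ‖y - x‖ ^ 2) *
      angleKernel n x y ∂(arcLength Ω) =
      -(∫ y in Ω, 2 * sqrtDerivApprox δ (τ ^ 2 - ‖y - x‖ ^ 2)) +
        2 * Real.pi * domainIndicator Ω x * sqrtApprox δ (τ ^ 2) := by
    intro δ hδ
    have h := integral_weight_angleKernel hΩ x (g := fun ρ => sqrtApprox δ (τ ^ 2 - ρ))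
      ((contDiff_sqrtApprox hδ).comp (contDiff_const.sub contDiff_id)) (R := τ ^ 2)
      (fun ρ hρ => sqrtApprox_of_nonpos δ (by linarith))
    have hd : ∀ ρ, deriv (fun ρ => sqrtApprox δ (τ ^ 2 - ρ)) ρ = -sqrtDerivApprox δ (τ ^ 2 - ρ) :=
      fun ρ => by
        have := (sqrtApprox_hasDerivAt hδ (τ ^ 2 - ρ)).comp ρ
          ((hasDerivAt_id ρ).const_sub (τ ^ 2))
        rw [mul_neg_one] at this
        exact this.deriv
    simp_rw [hd, sub_zero, mul_neg, integral_neg] at h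
    exact h
  have h1 : Tendsto (fun δ => ∫ y, sqrtApprox δ (τ ^ 2 - ‖y - x‖ ^ 2) *
      angleKernel n x y ∂(arcLength Ω)) (𝓝[>] 0)
      (𝓝 (∫ y, √(τ ^ 2 - ‖y - x‖ ^ 2) * angleKernel n x y ∂(arcLength Ω))) := by
    refine tendsto_integral_filter_of_dominated_convergence (fun y => τ * |angleKernel n x y|)
      ?_ ?_ (hκ.abs.const_mul τ) ?_
    · filter_upwards [self_mem_nhdsWithin] with δ hδ
      exact ((contDiff_sqrtApprox hδ).continuous.comp hrc).aestronglyMeasurable.mul hκ.1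
    · filter_upwards [self_mem_nhdsWithin] with δ hδ
      refine Eventually.of_forall fun y => ?_
      have := sqrtApprox_mem hδ (τ ^ 2 - ‖y - x‖ ^ 2)
      rw [norm_mul, Real.norm_of_nonneg this.1, Real.norm_eq_abs]
      gcongr
      refine this.2.trans (Real.sqrt_le_iff.2 ⟨hτ.le, ?_⟩)
      nlinarith [sq_nonneg ‖y - x‖]
    · exact Eventually.of_forall fun y => (tendsto_sqrtApprox _).mul_const _
  have h2 : Tendsto (fun δ => ∫ y in Ω, 2 * sqrtDerivApprox δ (τ ^ 2 - ‖y - x‖ ^ 2)) (𝓝[>] 0)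
      (𝓝 (∫ y in Ω, 1 / √(τ ^ 2 - ‖y - x‖ ^ 2))) := by
    have hhalf : ∀ u : ℝ, 2 * (1 / (2 * √u)) = 1 / √u := fun u => by
      rw [one_div, mul_inv, ← mul_assoc]; norm_num
    refine tendsto_integral_filter_of_dominated_convergence
      (fun y => 1 / √(τ ^ 2 - ‖y - x‖ ^ 2)) ?_ ?_ hI.integrableOn ?_
    · filter_upwards [self_mem_nhdsWithin] with δ hδ
      exact (((continuous_sqrtDerivApprox hδ).comp hrc).const_mul 2).aestronglyMeasurable
    · filter_upwards [self_mem_nhdsWithin] with δ hδ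
      refine Eventually.of_forall fun y => ?_
      rw [Real.norm_of_nonneg (mul_nonneg zero_le_two (sqrtDerivApprox_nonneg hδ _)), ← hhalf]
      exact mul_le_mul_of_nonneg_left (sqrtDerivApprox_le hδ _) zero_le_two
    · refine Eventually.of_forall fun y => ?_
      rw [← hhalf]
      exact (tendsto_sqrtDerivApprox _).const_mul 2
  have h3 := (h2.neg).add ((tendsto_sqrtApprox (τ ^ 2)).const_mul
    (2 * Real.pi * domainIndicator Ω x))
  have h4 := tendsto_nhds_unique h1 (h3.congr' (by
    filter_upwards [self_mem_nhdsWithin] with δ hδ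
    exact (hg δ hδ).symm))
  rw [h4, Real.sqrt_sq hτ.le]
  ring

/-- The boundary integral, up to sign, at the wave front radius `τ`. -/
def frontIntegral (Ω : Set Plane) (n : Plane → Plane) (x : Plane) (τ : ℝ) : ℝ :=
  ∫ y, frontKernel τ ‖y - x‖ * angleKernel n x y ∂(arcLength Ω)

/-- Although the boundary integral may diverge at some `τ`, it converges absolutely together with an
integration in `τ`. -/
lemma integrable_frontKernel_prod (x : Plane) {T : ℝ} (hT : 0 ≤ T) :
    Integrable (fun z : ℝ × Plane => frontKernel z.1 ‖z.2 - x‖ * angleKernel n x z.2)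
      ((volume.restrict (Ioc 0 T)).prod (arcLength Ω)) := by
  have := isFiniteMeasure_arcLength hΩ
  have hκ := integrable_angleKernel hΩ x
  have hm : AEStronglyMeasurable (fun z : ℝ × Plane =>
      frontKernel z.1 ‖z.2 - x‖ * angleKernel n x z.2)
      ((volume.restrict (Ioc 0 T)).prod (arcLength Ω)) := by
    refine AEStronglyMeasurable.mul ?_ hκ.1.comp_snd
    exact (measurable_frontKernel.comp
      (measurable_fst.prodMk (by fun_prop))).aestronglyMeasurable
  rw [integrable_prod_iff' hm]
  have hK := fun y : Plane => intervalIntegrable_frontKernel (norm_nonneg (y - x)) hT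
  have hKi : ∀ y : Plane, IntegrableOn (fun σ => frontKernel σ ‖y - x‖) (Ioc 0 T) := fun y => by
    have := (hK y).1
    rwa [intervalIntegrable_iff, uIoc_of_le hT] at this
  refine ⟨Eventually.of_forall fun y => (hKi y).mul_const (angleKernel n x y), ?_⟩
  have heq : ∀ y, ∫ σ in Ioc 0 T, ‖frontKernel σ ‖y - x‖ * angleKernel n x y‖ =
      √(T ^ 2 - ‖y - x‖ ^ 2) * |angleKernel n x y| := by
    intro y
    rw [← (hK y).2, intervalIntegral.integral_of_le hT, ← integral_mul_const]
    refine setIntegral_congr_fun measurableSet_Ioc fun σ hσ => ?_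
    simp only [norm_mul, Real.norm_of_nonneg (frontKernel_nonneg hσ.1.le _), Real.norm_eq_abs]
  simp only [heq]
  refine (hκ.abs.const_mul T).mono' ?_ (Eventually.of_forall fun y => ?_)
  · exact (by fun_prop : Continuous fun y : Plane =>
      √(T ^ 2 - ‖y - x‖ ^ 2)).aestronglyMeasurable.mul hκ.abs.1
  · rw [norm_mul, Real.norm_of_nonneg (Real.sqrt_nonneg _), Real.norm_eq_abs, abs_abs]
    gcongr
    exact Real.sqrt_le_iff.2 ⟨hT, by nlinarith [sq_nonneg ‖y - x‖]⟩

lemma integrableOn_frontIntegral (x : Plane) {T : ℝ} (hT : 0 ≤ T) :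
    IntegrableOn (frontIntegral Ω n x) (Ioc 0 T) := by
  have := isFiniteMeasure_arcLength hΩ
  exact (integrable_frontKernel_prod hΩ x hT).integral_prod_left

lemma integral_frontIntegral (x : Plane) {T : ℝ} (hT : 0 ≤ T) :
    ∫ σ in (0 : ℝ)..T, frontIntegral Ω n x σ =
      ∫ y, √(T ^ 2 - ‖y - x‖ ^ 2) * angleKernel n x y ∂(arcLength Ω) := by
  have := isFiniteMeasure_arcLength hΩ
  rw [intervalIntegral.integral_of_le hT]
  unfold frontIntegral
  rw [integral_integral_swap (integrable_frontKernel_prod hΩ x hT)]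
  congr 1
  funext y
  rw [integral_mul_const, ← (intervalIntegrable_frontKernel (norm_nonneg (y - x)) hT).2,
    intervalIntegral.integral_of_le hT]

end

/-! ### Continuity of the boundary integral at transversal times -/

lemma tendsto_frontKernel {τ₀ ρ : ℝ} (hτ₀ : 0 < τ₀) (hρ : 0 ≤ ρ) (hne : ρ ≠ τ₀) :
    Tendsto (fun τ => frontKernel τ ρ) (𝓝 τ₀) (𝓝 (frontKernel τ₀ ρ)) := by
  rcases lt_or_gt_of_ne hne with h | h
  · have hpos : 0 < τ₀ ^ 2 - ρ ^ 2 := by nlinarith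
    have : ContinuousAt (fun τ => frontKernel τ ρ) τ₀ := by
      unfold frontKernel
      exact continuousAt_id.div (by fun_prop) (Real.sqrt_pos.2 hpos).ne'
    exact this.tendsto
  · rw [frontKernel_of_le hτ₀.le h.le]
    refine tendsto_const_nhds.congr' ?_
    filter_upwards [lt_mem_nhds hτ₀, gt_mem_nhds h] with τ h1 h2
    rw [frontKernel_of_le h1.le h2.le]

lemma integrableOn_frontKernel_radius {τ : ℝ} (hτ : 0 < τ) :
    IntegrableOn (frontKernel τ) (Ioi 0) ∧
      ∫ ρ in Ioi (0 : ℝ), frontKernel τ ρ = Real.pi / 2 * τ := by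
  have hd : ∀ ρ ∈ Ioo 0 τ, HasDerivAt (fun ρ => τ * Real.arcsin (ρ / τ)) (frontKernel τ ρ) ρ := by
    intro ρ hρ
    have h1 : ρ / τ < 1 := (div_lt_one hτ).2 hρ.2
    have h2 : 0 < ρ / τ := div_pos hρ.1 hτ
    have h3 := ((Real.hasDerivAt_arcsin (by linarith : ρ / τ ≠ -1) h1.ne).comp ρ
      ((hasDerivAt_id ρ).div_const τ)).const_mul τ
    refine h3.congr_deriv ?_
    rw [← frontKernel_eq hτ]
    field_simp
  have hcont : ContinuousOn (fun ρ => τ * Real.arcsin (ρ / τ)) (Icc 0 τ) :=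
    (continuous_const.mul (Real.continuous_arcsin.comp (by fun_prop))).continuousOn
  have hi : IntegrableOn (frontKernel τ) (Ioc 0 τ) :=
    intervalIntegral.integrableOn_deriv_of_nonneg hcont hd
      (fun ρ _ => frontKernel_nonneg hτ.le ρ)
  have h0 : ∀ ρ ∈ Ioi τ, frontKernel τ ρ = 0 := fun ρ hρ =>
    frontKernel_of_le hτ.le (le_of_lt hρ)
  have hi0 : IntegrableOn (frontKernel τ) (Ioi τ) :=
    integrableOn_zero.congr_fun (fun ρ hρ => (h0 ρ hρ).symm) measurableSet_Ioi
  have hunion := Ioc_union_Ioi_eq_Ioi hτ.le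
  refine ⟨hunion ▸ hi.union hi0, ?_⟩
  rw [← hunion, setIntegral_union (Ioc_disjoint_Ioi le_rfl) measurableSet_Ioi hi hi0,
    setIntegral_eq_zero_of_forall_eq_zero h0, add_zero, ← intervalIntegral.integral_of_le hτ.le]
  have h1 := intervalIntegral.integral_eq_sub_of_hasDerivAt_of_le hτ.le hcont hd
    ((intervalIntegrable_iff.2 (by rwa [uIoc_of_le hτ.le])))
  rw [h1, div_self hτ.ne']
  simp
  ring

/-- Continuity of the kernel in `L¹`: the kernels are nonnegative, converge almost everywhere and
their integrals converge, so the integrals of the minima do as well. -/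
lemma tendsto_integral_abs_frontKernel_sub {τ₀ : ℝ} (hτ₀ : 0 < τ₀) :
    Tendsto (fun τ => ∫ ρ in Ioi (0 : ℝ), |frontKernel τ ρ - frontKernel τ₀ ρ|) (𝓝 τ₀) (𝓝 0) := by
  obtain ⟨hi0, hv0⟩ := integrableOn_frontKernel_radius hτ₀
  have hmeas : ∀ τ, Measurable (frontKernel τ) := fun τ => by unfold frontKernel; fun_prop
  have hmin : Tendsto (fun τ => ∫ ρ in Ioi (0 : ℝ), min (frontKernel τ ρ) (frontKernel τ₀ ρ)) (𝓝 τ₀)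
      (𝓝 (∫ ρ in Ioi (0 : ℝ), min (frontKernel τ₀ ρ) (frontKernel τ₀ ρ))) := by
    refine tendsto_integral_filter_of_dominated_convergence (frontKernel τ₀)
      (Eventually.of_forall fun τ => ((hmeas τ).min (hmeas τ₀)).aestronglyMeasurable) ?_ hi0 ?_
    · filter_upwards [lt_mem_nhds hτ₀] with τ hτ
      refine Eventually.of_forall fun ρ => ?_
      rw [Real.norm_of_nonneg (le_min (frontKernel_nonneg hτ.le ρ) (frontKernel_nonneg hτ₀.le ρ))]
      exact min_le_right _ _
    · filter_upwards [ae_restrict_mem measurableSet_Ioi, ae_restrict_of_ae (Measure.ae_ne volume τ₀)]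
        with ρ h1 h2
      exact (tendsto_frontKernel hτ₀ (le_of_lt h1) h2).min tendsto_const_nhds
  simp only [min_self, hv0] at hmin
  have hlim : Tendsto (fun τ => Real.pi / 2 * τ + Real.pi / 2 * τ₀ -
      2 * ∫ ρ in Ioi (0 : ℝ), min (frontKernel τ ρ) (frontKernel τ₀ ρ)) (𝓝 τ₀)
      (𝓝 (Real.pi / 2 * τ₀ + Real.pi / 2 * τ₀ - 2 * (Real.pi / 2 * τ₀))) :=
    ((tendsto_id.const_mul _).add tendsto_const_nhds).sub (hmin.const_mul 2)
  rw [show Real.pi / 2 * τ₀ + Real.pi / 2 * τ₀ - 2 * (Real.pi / 2 * τ₀) = 0 by ring] at hlim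
  refine hlim.congr' ?_
  filter_upwards [lt_mem_nhds hτ₀] with τ hτ
  obtain ⟨hi, hv⟩ := integrableOn_frontKernel_radius hτ
  have habs : ∀ a b : ℝ, |a - b| = a + b - 2 * min a b := fun a b => by
    rcases le_total a b with h | h
    · rw [min_eq_left h, abs_of_nonpos (by linarith)]; ring
    · rw [min_eq_right h, abs_of_nonneg (by linarith)]; ring
  have himin : IntegrableOn (fun ρ => min (frontKernel τ ρ) (frontKernel τ₀ ρ)) (Ioi 0) :=
    hi.inf hi0
  have hadd : IntegrableOn (fun ρ => frontKernel τ ρ + frontKernel τ₀ ρ) (Ioi 0) := hi.add hi0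
  simp only [habs]
  rw [integral_sub hadd (himin.const_mul 2), integral_add hi hi0, integral_const_mul, hv,
    hv0]

section

variable {Ω : Set Plane} {n : Plane → Plane} (hΩ : IsLyapunovDomain Ω n)
include hΩ

/-- Near a point at which the boundary crosses the circle of radius `τ₀ > 0` about `x` without being
tangent to it, the distance from `x` is a bi-Lipschitz parameter of the boundary. -/
lemma exists_nhds_dist_le (x : Plane) {y₀ : Plane} (hy₀ : y₀ ∈ frontier Ω)
    (htr : inner ℝ (y₀ - x) (perp (n y₀)) ≠ 0) :
    ∃ N, IsOpen N ∧ y₀ ∈ N ∧ ∃ K : NNReal, ∀ y ∈ frontier Ω ∩ N, ∀ z ∈ frontier Ω ∩ N,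
      dist y z ≤ K * dist ‖y - x‖ ‖z - x‖ := by
  obtain ⟨δ, η, f, hG⟩ := exists_isGraphBox hΩ hy₀
  have hν := hG.norm_normal
  set ν := n y₀
  let γ := graphCurve y₀ ν f
  let q : ℝ → ℝ := fun s => ‖γ s - x‖ ^ 2
  set q' : ℝ := 2 * inner ℝ (y₀ - x) (perp ν) with hq'
  have hq'0 : q' ≠ 0 := mul_ne_zero two_ne_zero htr
  have hγ0 : γ 0 = y₀ := hG.curve_zero
  have hγs : HasStrictDerivAt γ (perp ν) 0 := by
    have := hasStrictDerivAt_of_hasDerivAt_of_continuousAt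
      (Eventually.of_forall hG.curve_hasDerivAt) (hG.continuous_speed.continuousAt (x := 0))
    simpa [hG.deriv_zero, frameVec] using this
  have hqs : HasStrictDerivAt q q' 0 := by
    have h1 := (hasStrictFDerivAt_norm_sq (γ 0 - x)).comp_hasStrictDerivAt 0 (hγs.sub_const x)
    refine h1.congr_deriv ?_
    rw [hγ0, hq']
    simp [inner_sub_left]
  have hc : 0 < |q'| / 2 := by positivity
  obtain ⟨V, hV, hVs⟩ := hqs.hasStrictFDerivAt.approximates_deriv_on_nhds
    (c := (|q'| / 2).toNNReal) (Or.inr (by simpa using hq'0))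
  obtain ⟨a, ha, haV⟩ := Metric.mem_nhds_iff.1 hV
  have hlow : ∀ s t : ℝ, |s| < a → |t| < a → |q'| / 2 * |s - t| ≤ |q s - q t| := by
    intro s t hs ht
    have h1 := hVs s (haV (by simpa using hs)) t (haV (by simpa using ht))
    simp only [ContinuousLinearMap.toSpanSingleton_apply, smul_eq_mul, Real.norm_eq_abs] at h1
    rw [Real.coe_toNNReal _ hc.le] at h1
    have h2 := abs_sub_abs_le_abs_sub ((s - t) * q') (q s - q t)
    rw [abs_sub_comm ((s - t) * q'), abs_mul (s - t) q'] at h2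
    linarith
  set R := ‖y₀ - x‖ + 1
  have hR : 0 < R := by positivity
  refine ⟨frameBox y₀ ν δ η ∩ {y | |inner ℝ (y - y₀) (perp ν)| < a} ∩ {y | ‖y - x‖ < R},
    ((isOpen_frameBox _ _ _ _).inter (isOpen_lt (by fun_prop) continuous_const)).inter
      (isOpen_lt (by fun_prop) continuous_const),
    ⟨⟨self_mem_frameBox _ _ hG.pos_left hG.pos_right, by simpa using ha⟩,
      by simp [R]⟩, (2 * (2 / |q'|) * (2 * R)).toNNReal, ?_⟩
  have hpar : ∀ y ∈ frontier Ω ∩ (frameBox y₀ ν δ η ∩ {y | |inner ℝ (y - y₀) (perp ν)| < a} ∩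
      {y | ‖y - x‖ < R}), ∃ s, |s| < a ∧ γ s = y ∧ ‖y - x‖ < R := by
    rintro y ⟨hy, ⟨hyb, hya⟩, hyR⟩
    have : y ∈ graphCurve y₀ ν f '' Ioo (-δ) δ := hG.frontier_inter_box ▸ ⟨hy, hyb⟩
    obtain ⟨s, -, rfl⟩ := this
    refine ⟨s, ?_, rfl, hyR⟩
    have h1 : inner ℝ (graphCurve y₀ ν f s - y₀) (perp ν) = s := inner_frame_sub_perp hν _ _
    rw [mem_ofPred_eq, h1] at hya
    exact hya
  intro y hy z hz
  obtain ⟨s, hs, rfl, hyR⟩ := hpar y hy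
  obtain ⟨t, ht, rfl, hzR⟩ := hpar z hz
  rw [Real.coe_toNNReal _ (by positivity), dist_eq_norm, Real.dist_eq]
  have h1 : ‖γ s - γ t‖ ≤ 2 * |s - t| := hG.dist_le s t
  have h2 := hlow s t hs ht
  have h3 : |q s - q t| ≤ 2 * R * |‖γ s - x‖ - ‖γ t - x‖| := by
    have : q s - q t = (‖γ s - x‖ + ‖γ t - x‖) * (‖γ s - x‖ - ‖γ t - x‖) := by
      simp only [q]; ring
    rw [this, abs_mul, abs_of_nonneg (by positivity)]
    gcongr
    linarith
  have h4 : |s - t| ≤ 2 / |q'| * (2 * R * |‖γ s - x‖ - ‖γ t - x‖|) := by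
    rw [div_mul_eq_mul_div, le_div_iff₀ (by positivity)]
    linarith
  calc ‖γ s - γ t‖ ≤ 2 * |s - t| := h1
    _ ≤ 2 * (2 / |q'| * (2 * R * |‖γ s - x‖ - ‖γ t - x‖|)) := by gcongr
    _ = _ := by ring

/-- At a transversal radius the distribution of arc length by distance from `x` is, near that radius,
bounded by a multiple of Lebesgue measure. -/
lemma exists_arcLength_shell_le (x : Plane) {τ₀ : ℝ}
    (htr : ∀ y ∈ frontier Ω, ‖y - x‖ = τ₀ → inner ℝ (y - x) (perp (n y)) ≠ 0) :
    ∃ δ : ℝ, 0 < δ ∧ ∃ M : NNReal, ∀ E : Set ℝ,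
      arcLength Ω ({y | |‖y - x‖ - τ₀| < δ} ∩ (fun y => ‖y - x‖) ⁻¹' E) ≤ M * volume E := by
  have hcl := hΩ.isCompact_frontier.isClosed
  let Z : Set Plane := frontier Ω ∩ {y | ‖y - x‖ = τ₀}
  have hZ : IsCompact Z :=
    hΩ.isCompact_frontier.inter_right (isClosed_eq (by fun_prop) continuous_const)
  have hcov : ∃ U, IsOpen U ∧ Z ⊆ U ∧ ∃ M : NNReal, ∀ E : Set ℝ,
      arcLength Ω (U ∩ (fun y => ‖y - x‖) ⁻¹' E) ≤ M * volume E := by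
    refine hZ.induction_on (p := fun s => ∃ U, IsOpen U ∧ s ⊆ U ∧ ∃ M : NNReal, ∀ E : Set ℝ,
      arcLength Ω (U ∩ (fun y => ‖y - x‖) ⁻¹' E) ≤ M * volume E) ?_ ?_ ?_ ?_
    · exact ⟨∅, isOpen_empty, Subset.rfl, 0, fun E => by simp⟩
    · rintro s t hst ⟨U, hU, htU, M⟩
      exact ⟨U, hU, hst.trans htU, M⟩
    · rintro s t ⟨U, hU, hsU, M, hM⟩ ⟨V, hV, htV, M', hM'⟩
      refine ⟨U ∪ V, hU.union hV, union_subset_union hsU htV, M + M', fun E => ?_⟩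
      rw [union_inter_distrib_right, ENNReal.coe_add, add_mul]
      exact (measure_union_le _ _).trans (add_le_add (hM E) (hM' E))
    · rintro y₀ ⟨hy₀, hyτ⟩
      obtain ⟨N, hN, hyN, K, hK⟩ := exists_nhds_dist_le hΩ x hy₀ (htr y₀ hy₀ hyτ)
      refine ⟨N, mem_nhdsWithin_of_mem_nhds (hN.mem_nhds hyN), N, hN, Subset.rfl, K, fun E => ?_⟩
      have h1 := hausdorffMeasure_le_of_antilipschitzOn (f := fun y : Plane => ‖y - x‖)
        (s := frontier Ω ∩ N ∩ (fun y => ‖y - x‖) ⁻¹' E) (K := K)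
        (fun y hy z hz => hK y hy.1 z hz.1) zero_le_one
      rw [ENNReal.rpow_one, hausdorffMeasure_real] at h1
      rw [arcLength, Measure.restrict_apply' hcl.measurableSet]
      calc _ = Measure.hausdorffMeasure 1 (frontier Ω ∩ N ∩ (fun y => ‖y - x‖) ⁻¹' E) := by
            congr 1; ext y; simp only [mem_inter_iff]; tauto
        _ ≤ _ := h1
        _ ≤ K * volume E := by
            gcongr
            rintro _ ⟨y, hy, rfl⟩
            exact hy.2
  obtain ⟨U, hU, hZU, M, hM⟩ := hcov
  have hδ : ∃ δ > 0, ∀ y ∈ frontier Ω, |‖y - x‖ - τ₀| < δ → y ∈ U := by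
    have hC : IsCompact (frontier Ω \ U) := hΩ.isCompact_frontier.diff hU
    rcases (frontier Ω \ U).eq_empty_or_nonempty with he | hne
    · exact ⟨1, one_pos, fun y hy _ => by
        by_contra h
        exact (he ▸ (⟨hy, h⟩ : y ∈ frontier Ω \ U) : y ∈ (∅ : Set Plane))⟩
    · obtain ⟨y₁, hy₁, hmin⟩ := hC.exists_isMinOn hne
        (f := fun y => |‖y - x‖ - τ₀|) (by fun_prop)
      refine ⟨|‖y₁ - x‖ - τ₀|, abs_pos.2 fun h => hy₁.2 (hZU ⟨hy₁.1, sub_eq_zero.1 h⟩),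
        fun y hy hlt => ?_⟩
      by_contra h
      exact hlt.not_ge (hmin ⟨hy, h⟩)
  obtain ⟨δ, hδ, hδU⟩ := hδ
  refine ⟨δ, hδ, M, fun E => le_trans ?_ (hM E)⟩
  refine measure_mono_ae ?_
  filter_upwards [ae_mem_frontier hΩ] with y hy
  rintro ⟨h1, h2⟩
  exact ⟨hδU y hy h1, h2⟩

/-- At a transversal radius the boundary integral converges absolutely and is continuous in the
radius: away from the circle the kernel is bounded, and near it `‖y - x‖` can be used as a parameter,
in which the kernel is continuous in `L¹`. -/
theorem integrable_and_continuousAt_frontIntegral (x : Plane) {τ₀ : ℝ} (hτ₀ : 0 < τ₀)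
    (htr : ∀ y ∈ frontier Ω, ‖y - x‖ = τ₀ → inner ℝ (y - x) (perp (n y)) ≠ 0) :
    Integrable (fun y => frontKernel τ₀ ‖y - x‖ * angleKernel n x y) (arcLength Ω) ∧
      ContinuousAt (frontIntegral Ω n x) τ₀ := by
  obtain ⟨δ', hδ', M, hM'⟩ := exists_arcLength_shell_le hΩ x htr
  obtain ⟨δ, hδ, hδle, hδτ⟩ : ∃ δ : ℝ, 0 < δ ∧ δ ≤ δ' ∧ δ ≤ τ₀ / 2 :=
    ⟨min δ' (τ₀ / 2), by positivity, min_le_left _ _, min_le_right _ _⟩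
  have hfin := isFiniteMeasure_arcLength hΩ
  have hκ := integrable_angleKernel hΩ x
  let r : Plane → ℝ := fun y => ‖y - x‖
  have hr : Continuous r := by fun_prop
  set A : Set Plane := {y | |‖y - x‖ - τ₀| < δ} with hA
  have hAm : MeasurableSet A := (isOpen_lt (by fun_prop) continuous_const).measurableSet
  have hAr : ∀ y ∈ A, τ₀ / 2 < ‖y - x‖ := fun y hy => by
    have h : |‖y - x‖ - τ₀| < δ := hy
    linarith [(abs_lt.1 h).1]
  have hM : ∀ E, arcLength Ω (A ∩ r ⁻¹' E) ≤ M * volume E := fun E =>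
    (measure_mono (inter_subset_inter_left _ fun y (hy : |‖y - x‖ - τ₀| < δ) =>
      lt_of_lt_of_le hy hδle)).trans (hM' E)
  have hmap : ((arcLength Ω).restrict A).map r ≤ (M : ENNReal) • volume.restrict (Ioi 0) := by
    rw [Measure.le_iff]
    intro E hE
    rw [Measure.map_apply hr.measurable hE, Measure.restrict_apply (hr.measurable hE),
      Measure.smul_apply, Measure.restrict_apply hE, smul_eq_mul]
    refine le_trans (measure_mono ?_) (hM (E ∩ Ioi 0))
    rintro y ⟨h1, h2⟩
    exact ⟨h2, h1, lt_trans (by positivity) (hAr y h2)⟩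
  have hmeas : ∀ τ, Measurable (frontKernel τ) := fun τ => by unfold frontKernel; fun_prop
  have hmeasr : ∀ τ, Measurable fun y : Plane => frontKernel τ ‖y - x‖ := fun τ =>
    (hmeas τ).comp hr.measurable
  -- transfer of integrals over the shell `A` to the radius
  have htrans : ∀ φ : ℝ → ℝ, Measurable φ → (∀ ρ, 0 ≤ φ ρ) → IntegrableOn φ (Ioi 0) →
      IntegrableOn (fun y => φ (r y)) A (arcLength Ω) ∧
        ∫ y in A, φ (r y) ∂(arcLength Ω) ≤ M * ∫ ρ in Ioi (0 : ℝ), φ ρ := by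
    intro φ hφm hφ0 hφi
    have h1 : Integrable φ ((M : ENNReal) • volume.restrict (Ioi 0)) :=
      hφi.smul_measure (by simp)
    have h2 := h1.mono_measure hmap
    refine ⟨h2.comp_measurable hr.measurable, ?_⟩
    have h3 : ∫ y in A, φ (r y) ∂(arcLength Ω) = ∫ ρ, φ ρ ∂(((arcLength Ω).restrict A).map r) :=
      (integral_map hr.measurable.aemeasurable hφm.aestronglyMeasurable).symm
    rw [h3]
    refine (integral_mono_measure hmap (Eventually.of_forall hφ0) h1).trans_eq ?_
    rw [integral_smul_measure]
    simp
  have hκA : ∀ᵐ y ∂((arcLength Ω).restrict A), |angleKernel n x y| ≤ 2 / τ₀ := by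
    filter_upwards [ae_restrict_mem hAm, ae_restrict_of_ae (ae_mem_frontier hΩ)] with y h1 h2
    refine (abs_angleKernel_le hΩ x h2).trans ?_
    rw [← inv_div]
    exact inv_anti₀ (by positivity) (hAr y h1).le
  have hiA : ∀ τ, 0 < τ → IntegrableOn (fun y => frontKernel τ ‖y - x‖ * angleKernel n x y) A
      (arcLength Ω) := fun τ hτ => by
    have h1 := (htrans (frontKernel τ) (hmeas τ) (frontKernel_nonneg hτ.le)
      (integrableOn_frontKernel_radius hτ).1).1
    exact h1.mul_bdd (c := 2 / τ₀) hκ.1.restrict hκA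
  -- off the shell the kernel is bounded
  set C : ℝ := √(4 * τ₀ / δ)
  have hbound : ∀ τ, |τ - τ₀| < δ / 2 → ∀ y ∈ Aᶜ, |frontKernel τ ‖y - x‖| ≤ C := by
    intro τ hτ y hy
    have hτ1 := (abs_lt.1 hτ).1
    have hτ2 := (abs_lt.1 hτ).2
    have hτ0 : 0 < τ := by linarith
    have hy' : δ ≤ |‖y - x‖ - τ₀| := not_lt.1 hy
    rcases le_abs.1 hy' with h | h
    · rw [frontKernel_of_le hτ0.le (by linarith), abs_zero]
      exact Real.sqrt_nonneg _
    · rw [abs_of_nonneg (frontKernel_nonneg hτ0.le _), ← frontKernel_eq hτ0, one_div, ← Real.sqrt_inv]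
      refine Real.sqrt_le_sqrt ?_
      have h1 : ‖y - x‖ / τ ≤ 1 - δ / (4 * τ₀) := by
        rw [div_le_iff₀ hτ0, sub_mul, one_mul, div_mul_eq_mul_div, le_sub_iff_add_le,
          ← le_sub_iff_add_le', div_le_iff₀ (by positivity)]
        nlinarith
      have h0 : 0 ≤ ‖y - x‖ / τ := by positivity
      have h2 : 0 < δ / (4 * τ₀) := by positivity
      have h3 : δ / (4 * τ₀) ≤ 1 - (‖y - x‖ / τ) ^ 2 := by nlinarith
      rw [← inv_div δ]
      exact inv_anti₀ h2 h3
  have hiAc : ∀ τ, |τ - τ₀| < δ / 2 → IntegrableOn (fun y => frontKernel τ ‖y - x‖ *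
      angleKernel n x y) Aᶜ (arcLength Ω) := fun τ hτ => by
    refine (hκ.integrableOn (s := Aᶜ)).bdd_mul (c := C)
      (hmeasr τ).aestronglyMeasurable ?_
    filter_upwards [ae_restrict_mem hAm.compl] with y hy using hbound τ hτ y hy
  have hnear : ∀ᶠ τ in 𝓝 τ₀, |τ - τ₀| < δ / 2 := by
    have := Metric.ball_mem_nhds τ₀ (by positivity : 0 < δ / 2)
    filter_upwards [this] with τ hτ
    simpa [Real.dist_eq] using hτ
  have hi : ∀ τ, 0 < τ → |τ - τ₀| < δ / 2 → Integrable (fun y => frontKernel τ ‖y - x‖ *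
      angleKernel n x y) (arcLength Ω) := fun τ h0 h1 => by
    rw [← integrableOn_univ, ← union_compl_self A]
    exact (hiA τ h0).union (hiAc τ h1)
  have hself : |τ₀ - τ₀| < δ / 2 := by rw [sub_self, abs_zero]; positivity
  refine ⟨hi τ₀ hτ₀ hself, ?_⟩
  have hcA : Tendsto (fun τ => ∫ y in A, frontKernel τ ‖y - x‖ * angleKernel n x y ∂(arcLength Ω))
      (𝓝 τ₀) (𝓝 (∫ y in A, frontKernel τ₀ ‖y - x‖ * angleKernel n x y ∂(arcLength Ω))) := by
    rw [tendsto_iff_norm_sub_tendsto_zero]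
    have h0 := (tendsto_integral_abs_frontKernel_sub hτ₀).const_mul (2 / τ₀ * M)
    rw [mul_zero] at h0
    refine squeeze_zero' (Eventually.of_forall fun _ => norm_nonneg _) ?_ h0
    filter_upwards [lt_mem_nhds hτ₀] with τ hτ
    have hd : IntegrableOn (fun ρ => |frontKernel τ ρ - frontKernel τ₀ ρ|) (Ioi 0) :=
      ((integrableOn_frontKernel_radius hτ).1.sub (integrableOn_frontKernel_radius hτ₀).1).abs
    obtain ⟨h1, h2⟩ := htrans (fun ρ => |frontKernel τ ρ - frontKernel τ₀ ρ|)
      ((hmeas τ).sub (hmeas τ₀)).abs (fun _ => abs_nonneg _) hd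
    rw [← integral_sub (hiA τ hτ) (hiA τ₀ hτ₀)]
    calc _ ≤ ∫ y in A, 2 / τ₀ * |frontKernel τ ‖y - x‖ - frontKernel τ₀ ‖y - x‖|
          ∂(arcLength Ω) := by
          refine norm_integral_le_of_norm_le (h1.const_mul _) ?_
          filter_upwards [hκA] with y hy
          rw [← sub_mul, norm_mul, mul_comm, Real.norm_eq_abs, Real.norm_eq_abs]
          gcongr
      _ = 2 / τ₀ * ∫ y in A, |frontKernel τ ‖y - x‖ - frontKernel τ₀ ‖y - x‖|
          ∂(arcLength Ω) := integral_const_mul _ _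
      _ ≤ 2 / τ₀ * (M * ∫ ρ in Ioi (0 : ℝ), |frontKernel τ ρ - frontKernel τ₀ ρ|) := by
          gcongr
      _ = _ := by ring
  have hcAc : Tendsto (fun τ => ∫ y in Aᶜ, frontKernel τ ‖y - x‖ * angleKernel n x y
      ∂(arcLength Ω)) (𝓝 τ₀)
      (𝓝 (∫ y in Aᶜ, frontKernel τ₀ ‖y - x‖ * angleKernel n x y ∂(arcLength Ω))) := by
    refine tendsto_integral_filter_of_dominated_convergence (fun y => C * |angleKernel n x y|)
      (Eventually.of_forall fun τ => (hmeasr τ).aestronglyMeasurable.mul hκ.1.restrict) ?_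
      (hκ.abs.const_mul C).integrableOn ?_
    · filter_upwards [hnear] with τ hτ
      filter_upwards [ae_restrict_mem hAm.compl] with y hy
      rw [norm_mul, Real.norm_eq_abs, Real.norm_eq_abs]
      gcongr
      exact hbound τ hτ y hy
    · filter_upwards [ae_restrict_mem hAm.compl] with y hy
      refine (tendsto_frontKernel hτ₀ (norm_nonneg _) fun h => hy ?_).mul_const _
      rw [hA, mem_ofPred_eq, h, sub_self, abs_zero]
      exact hδ
  have hsplit : ∀ τ, 0 < τ → |τ - τ₀| < δ / 2 →
      (∫ y in A, frontKernel τ ‖y - x‖ * angleKernel n x y ∂(arcLength Ω)) +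
      (∫ y in Aᶜ, frontKernel τ ‖y - x‖ * angleKernel n x y ∂(arcLength Ω)) =
      frontIntegral Ω n x τ := fun τ h0 h1 => integral_add_compl hAm (hi τ h0 h1)
  have := hcA.add hcAc
  rw [hsplit τ₀ hτ₀ hself] at this
  refine this.congr' ?_
  filter_upwards [lt_mem_nhds hτ₀, hnear] with τ h0 h1 using hsplit τ h0 h1

end

/-! ### Almost every front is transversal -/

lemma perp_smul (a : ℝ) (v : Plane) : perp (a • v) = a • perp v := by
  ext i; fin_cases i <;> simp [perp]

lemma perp_frameVec (ν : Plane) (z : ℝ × ℝ) : perp (frameVec ν z) = frameVec ν (z.2, -z.1) := by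
  ext i
  fin_cases i
  · simp [perp, frameVec]
  · simp [perp, frameVec]; ring

section

variable {Ω : Set Plane} {n : Plane → Plane} (hΩ : IsLyapunovDomain Ω n)
include hΩ

/-- The times of tangency are critical values of the distance from `x` along the boundary (or `0`),
so they form a null set by Sard's lemma. -/
lemma ae_frontTransversal {c : ℝ} (hc : 0 < c) (x : Plane) :
    ∀ᵐ t : ℝ, FrontTransversal Ω n c x t := by
  have key : volume {t : ℝ | ∃ y ∈ frontier Ω, y ∈ frontier Ω ∧ ‖x - y‖ = c * t ∧
      inner ℝ (x - y) (perp (n y)) = 0} = 0 := by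
    refine hΩ.isCompact_frontier.induction_on (p := fun s => volume {t : ℝ | ∃ y ∈ s,
      y ∈ frontier Ω ∧ ‖x - y‖ = c * t ∧ inner ℝ (x - y) (perp (n y)) = 0} = 0) ?_ ?_ ?_ ?_
    · simp
    · intro s s' hs h
      refine measure_mono_null ?_ h
      rintro t ⟨y, hy, h⟩
      exact ⟨y, hs hy, h⟩
    · intro s s' h h'
      refine measure_mono_null ?_ (measure_union_null h h')
      rintro t ⟨y, hy | hy, h⟩
      · exact Or.inl ⟨y, hy, h⟩
      · exact Or.inr ⟨y, hy, h⟩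
    · intro p hp
      obtain ⟨δ, η, f, hG⟩ := exists_isGraphBox hΩ hp
      have hν := hG.norm_normal
      refine ⟨frameBox p (n p) δ η, mem_nhdsWithin_of_mem_nhds
        ((isOpen_frameBox _ _ _ _).mem_nhds (self_mem_frameBox _ _ hG.pos_left hG.pos_right)), ?_⟩
      set γ := graphCurve p (n p) f
      let φ : ℝ → ℝ := fun s => √(‖γ s - x‖ ^ 2) / c
      let D : Set ℝ := {s | |s| < δ ∧ γ s ≠ x ∧ inner ℝ (γ s - x) (perp (n (γ s))) = 0}
      have hφ : ∀ s ∈ D, HasDerivAt φ 0 s := by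
        rintro s ⟨hs, hne, hin⟩
        have h1 := hG.normal_curve hΩ hs
        have h2 : frameVec (n p) (1, deriv f s) = √(1 + deriv f s ^ 2) • perp (n (γ s)) := by
          rw [← perp_smul, h1, perp_frameVec]
          simp
        have h3 := (hasFDerivAt_norm_sub_sq x (γ s)).comp_hasDerivAt s (hG.curve_hasDerivAt s)
        have h4 : (2 • innerSL ℝ (γ s - x)) (frameVec (n p) (1, deriv f s)) = (0 : ℝ) := by
          rw [h2]
          simp only [smul_apply, innerSL_apply_apply, real_inner_smul_right, hin, mul_zero,
            smul_zero]
        rw [h4] at h3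
        have hpos : ‖γ s - x‖ ^ 2 ≠ 0 := pow_ne_zero 2 (norm_ne_zero_iff.2 (sub_ne_zero.2 hne))
        exact ((h3.sqrt hpos).div_const c).congr_deriv (by simp)
      have hnull : volume (φ '' D) = 0 :=
        addHaar_image_eq_zero_of_det_fderivWithin_eq_zero volume (f' := fun _ => 0)
          (fun s hs => by
            have := (hφ s hs).hasFDerivAt.hasFDerivWithinAt (s := D)
            simpa using this)
          (fun s _ => by simp [ContinuousLinearMap.det])
      refine measure_mono_null ?_ (measure_union_null (measure_singleton (μ := volume) (0 : ℝ)) hnull)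
      rintro t ⟨y, hyb, hyf, hyt, hyin⟩
      by_cases hyx : y = x
      · left
        rw [hyx, sub_self, norm_zero] at hyt
        exact (mul_eq_zero.1 hyt.symm).resolve_left hc.ne'
      · right
        have : y ∈ γ '' Ioo (-δ) δ := hG.frontier_inter_box ▸ ⟨hyf, hyb⟩
        obtain ⟨s, hs, rfl⟩ := this
        refine ⟨s, ⟨abs_lt.2 hs, hyx, ?_⟩, ?_⟩
        · rw [← neg_sub, inner_neg_left, hyin, neg_zero]
        · simp only [φ]
          rw [Real.sqrt_sq (norm_nonneg _), norm_sub_rev, hyt, mul_div_cancel_left₀ _ hc.ne']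
  have h2 : ∀ᵐ t : ℝ, t ∉ {t : ℝ | ∃ y ∈ frontier Ω, y ∈ frontier Ω ∧ ‖x - y‖ = c * t ∧
      inner ℝ (x - y) (perp (n y)) = 0} := measure_eq_zero_iff_ae_notMem.1 key
  filter_upwards [h2] with t ht y hy hyt hin
  exact ht ⟨y, hy, hy, hyt, hin⟩

end

/-! ### The formula as a function of time -/

lemma boundaryKernel_eq (n : Plane → Plane) {c t : ℝ} (ht : 0 < c * t) {x y : Plane} (hy : y ≠ x) :
    boundaryKernel n c x t y = -(frontKernel (c * t) ‖y - x‖ * angleKernel n x y) := by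
  have hpos : ‖y - x‖ ≠ 0 := norm_ne_zero_iff.2 (sub_ne_zero.2 hy)
  have h1 := ((hasFDerivAt_norm_sub_sq x y).log (pow_ne_zero 2 hpos)).const_mul (-(1 / 2))
  have h2 : (fun z : Plane => Real.log (1 / ‖x - z‖)) =
      fun z => -(1 / 2) * Real.log (‖z - x‖ ^ 2) := by
    funext z
    rw [one_div, Real.log_inv, Real.log_pow, norm_sub_rev]
    push_cast
    ring
  have h3 : lineDeriv ℝ (fun z : Plane => Real.log (1 / ‖x - z‖)) y (n y) = -angleKernel n x y := by
    rw [h2, (h1.hasLineDerivAt (n y)).lineDeriv, angleKernel]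
    simp only [smul_apply, innerSL_apply_apply, smul_eq_mul, nsmul_eq_mul]
    push_cast
    field_simp
  rw [boundaryKernel, h3, norm_sub_rev, frontKernel_eq ht]
  ring

/-- Integration by parts against a primitive of a locally integrable function. -/
lemma integral_primitive_mul_deriv {b : ℝ → ℝ} (hb : LocallyIntegrable b) {φ : ℝ → ℝ}
    (hφ : ContDiff ℝ 1 φ) (hc : HasCompactSupport φ) :
    ∫ t, (∫ s in (0 : ℝ)..t, b s) * deriv φ t = -∫ t, b t * φ t := by
  obtain ⟨R, hR⟩ := hc.isBounded.subset_closedBall (0 : ℝ)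
  set T := |R| + 1
  have hT : 0 < T := by positivity
  have hsupp : ∀ t, T ≤ |t| → t ∉ tsupport φ := fun t ht h => by
    have := hR h
    rw [mem_closedBall_zero_iff, Real.norm_eq_abs] at this
    linarith [le_abs_self R]
  have hφ0 : ∀ t, T ≤ |t| → φ t = 0 := fun t ht => image_eq_zero_of_notMem_tsupport (hsupp t ht)
  have hφ'0 : ∀ t, T ≤ |t| → deriv φ t = 0 := fun t ht =>
    image_eq_zero_of_notMem_tsupport fun h => hsupp t ht (tsupport_deriv_subset h)
  have hI : ∀ g : ℝ → ℝ, (∀ t, T ≤ |t| → g t = 0) → ∫ t, g t = ∫ t in (-T)..T, g t := by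
    intro g hg
    refine (intervalIntegral.integral_eq_integral_of_support_subset fun t ht => ?_).symm
    have : |t| < T := not_le.1 fun h => ht (hg t h)
    exact ⟨(abs_lt.1 this).1, (abs_lt.1 this).2.le⟩
  have hbi : IntervalIntegrable b volume (-T) T :=
    (hb.integrableOn_isCompact isCompact_uIcc).intervalIntegrable
  have h0 : (0 : ℝ) ∈ uIcc (-T) T := by
    rw [uIcc_of_le (by linarith)]; exact ⟨by linarith, hT.le⟩
  have hA := hbi.absolutelyContinuousOnInterval_intervalIntegral h0
  have hP := hA.integral_mul_deriv_eq_deriv_mul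
    (hφ.contDiffOn (s := uIcc (-T) T)).absolutelyContinuousOnInterval
  rw [hI _ fun t ht => by rw [hφ'0 t ht, mul_zero], hP, hφ0 T (le_abs_self T),
    hφ0 (-T) (by rw [abs_neg]; exact le_abs_self T), hI _ fun t ht => by rw [hφ0 t ht, mul_zero],
    mul_zero, mul_zero, sub_zero, zero_sub]
  congr 1
  refine intervalIntegral.integral_congr_ae ?_
  filter_upwards [hbi.ae_hasDerivAt_integral] with t ht hmem
  rw [(ht (uIoc_subset_uIcc hmem) 0 h0).deriv]

section

variable {Ω : Set Plane} {n : Plane → Plane} {c : ℝ}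

lemma domainPart_eq_empty (hc : 0 < c) (x : Plane) {t : ℝ} (ht : t ≤ 0) :
    domainPart Ω c x t = ∅ := by
  refine eq_empty_of_forall_notMem fun y hy => ?_
  have := hy.2
  nlinarith [norm_nonneg (x - y)]

lemma boundaryPart_eq_empty (hc : 0 < c) (x : Plane) {t : ℝ} (ht : t ≤ 0) :
    boundaryPart Ω c x t = ∅ := by
  refine eq_empty_of_forall_notMem fun y hy => ?_
  have := hy.2
  nlinarith [norm_nonneg (x - y)]

lemma areaKernel_eq (x : Plane) (t : ℝ) (y : Plane) :
    areaKernel c x t y = 1 / √((c * t) ^ 2 - ‖y - x‖ ^ 2) := by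
  rw [areaKernel, mul_pow, norm_sub_rev]

lemma areaIntegral_of_nonpos (hc : 0 < c) (x : Plane) {t : ℝ} (ht : t ≤ 0) :
    areaIntegral Ω c x t = 0 := by
  rw [areaIntegral, domainPart_eq_empty hc x ht, setIntegral_empty]

lemma integrableOn_areaKernel (hc : 0 < c) (x : Plane) (t : ℝ) :
    IntegrableOn (areaKernel c x t) (domainPart Ω c x t) := by
  rcases le_or_gt t 0 with ht | ht
  · rw [domainPart_eq_empty hc x ht]
    exact integrableOn_empty
  · have h := integrable_inv_sqrt x (mul_pos hc ht)
    rw [show areaKernel c x t = _ from funext (areaKernel_eq x t)]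
    exact h.integrableOn

/-- The boundary integral as a function of time. It is the Bochner integral, hence `0` at those
exceptional times at which the integral diverges. -/
def boundaryIntegral (Ω : Set Plane) (n : Plane → Plane) (c : ℝ) (x : Plane) : ℝ → ℝ :=
  (Ioi 0).indicator fun t => -frontIntegral Ω n x (c * t)

/-- The time derivative of the area integral, divided by `c`, as a locally integrable function. -/
def areaRate (Ω : Set Plane) (n : Plane → Plane) (c : ℝ) (x : Plane) : ℝ → ℝ :=
  (Ioi 0).indicator fun t => 2 * Real.pi * domainIndicator Ω x - frontIntegral Ω n x (c * t)

lemma locallyIntegrable_indicator_Ioi {g : ℝ → ℝ}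
    (hg : ∀ T, 0 ≤ T → IntegrableOn g (Ioc 0 T)) : LocallyIntegrable ((Ioi 0).indicator g) := by
  rw [locallyIntegrable_iff]
  intro K hK
  obtain ⟨R, hR⟩ := hK.isBounded.subset_closedBall (0 : ℝ)
  rw [IntegrableOn, integrable_indicator_iff measurableSet_Ioi, IntegrableOn,
    Measure.restrict_restrict measurableSet_Ioi]
  refine (hg |R| (abs_nonneg R)).mono_set ?_
  rintro t ⟨h0, hK⟩
  have := hR hK
  rw [mem_closedBall_zero_iff, Real.norm_eq_abs] at this
  exact ⟨h0, (le_abs_self t).trans (this.trans (le_abs_self R))⟩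

variable (hΩ : IsLyapunovDomain Ω n)
include hΩ

lemma integrableOn_frontIntegral_mul (hc : 0 < c) (x : Plane) {T : ℝ} (hT : 0 ≤ T) :
    IntegrableOn (fun t => frontIntegral Ω n x (c * t)) (Ioc 0 T) := by
  have h1 : IntervalIntegrable (frontIntegral Ω n x) volume 0 (c * T) := by
    rw [intervalIntegrable_iff, uIoc_of_le (by positivity)]
    exact integrableOn_frontIntegral hΩ x (by positivity)
  have h2 := h1.comp_mul_left (c := c)
  rw [zero_div, mul_div_cancel_left₀ _ hc.ne', intervalIntegrable_iff, uIoc_of_le hT] at h2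
  exact h2

lemma locallyIntegrable_boundaryIntegral (hc : 0 < c) (x : Plane) :
    LocallyIntegrable (boundaryIntegral Ω n c x) :=
  locallyIntegrable_indicator_Ioi fun _ hT => (integrableOn_frontIntegral_mul hΩ hc x hT).neg

lemma locallyIntegrable_areaRate (hc : 0 < c) (x : Plane) :
    LocallyIntegrable (areaRate Ω n c x) :=
  locallyIntegrable_indicator_Ioi fun _ hT =>
    (integrableOn_const (by simp)).sub (integrableOn_frontIntegral_mul hΩ hc x hT)

/-- The area integral is the primitive of `c` times `areaRate`. -/
lemma areaIntegral_eq (hc : 0 < c) (x : Plane) (t : ℝ) :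
    areaIntegral Ω c x t = c * ∫ s in (0 : ℝ)..t, areaRate Ω n c x s := by
  rcases le_or_gt t 0 with ht | ht
  · rw [areaIntegral_of_nonpos hc x ht, intervalIntegral.integral_symm,
      intervalIntegral.integral_of_le ht, setIntegral_eq_zero_of_forall_eq_zero, neg_zero, mul_zero]
    intro s hs
    exact indicator_of_notMem (not_lt.2 hs.2) _
  · have hτ : 0 < c * t := mul_pos hc ht
    have h1 : areaIntegral Ω c x t = ∫ y in Ω, 1 / √((c * t) ^ 2 - ‖y - x‖ ^ 2) := by
      rw [areaIntegral]
      simp_rw [areaKernel_eq]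
      refine (setIntegral_eq_of_subset_of_forall_sdiff_eq_zero hΩ.isOpen.measurableSet
        (fun y hy => hy.1) fun y hy => ?_).symm
      have : c * t ≤ ‖y - x‖ := by
        rw [norm_sub_rev]
        exact not_lt.1 fun h => hy.2 ⟨hy.1, h⟩
      rw [sqrt_sub_sq_of_le hτ.le this, div_zero]
    have h2 : ∫ s in (0 : ℝ)..t, areaRate Ω n c x s =
        ∫ s in (0 : ℝ)..t, (2 * Real.pi * domainIndicator Ω x - frontIntegral Ω n x (c * s)) := by
      refine intervalIntegral.integral_congr_ae (Eventually.of_forall fun s hs => ?_)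
      rw [uIoc_of_le ht.le] at hs
      exact indicator_of_mem (show s ∈ Ioi 0 from hs.1) _
    have h3 : IntervalIntegrable (fun s => frontIntegral Ω n x (c * s)) volume 0 t := by
      rw [intervalIntegrable_iff, uIoc_of_le ht.le]
      exact integrableOn_frontIntegral_mul hΩ hc x ht.le
    rw [h1, integral_area_eq hΩ x hτ, h2, intervalIntegral.integral_sub (by simp) h3, mul_sub,
      intervalIntegral.mul_integral_comp_mul_left, mul_zero, integral_frontIntegral hΩ x hτ.le]
    simp
    ring

lemma hasPrincipalValue_boundaryIntegral (x : Plane) {t : ℝ} (hc : 0 < c) (ht : 0 < t)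
    (hi : Integrable (fun y => frontKernel (c * t) ‖y - x‖ * angleKernel n x y) (arcLength Ω)) :
    HasPrincipalValue (boundaryKernel n c x t) (boundaryPart Ω c x t) x
      (boundaryIntegral Ω n c x t) := by
  have hτ : 0 < c * t := mul_pos hc ht
  have hTm : MeasurableSet (boundaryPart Ω c x t) :=
    hΩ.isCompact_frontier.isClosed.measurableSet.inter
      (isOpen_lt (by fun_prop) continuous_const : IsOpen {y : Plane | ‖x - y‖ < c * t}).measurableSet
  have hTS : boundaryPart Ω c x t ⊆ frontier Ω := fun y hy => hy.1
  have hk : boundaryKernel n c x t =ᵐ[arcLength Ω]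
      fun y => -(frontKernel (c * t) ‖y - x‖ * angleKernel n x y) := by
    filter_upwards [ae_arcLength_ne x] with y hy using boundaryKernel_eq n hτ hy
  have hki : Integrable (boundaryKernel n c x t) (arcLength Ω) := hi.neg.congr hk.symm
  refine ⟨fun ε _ => IntegrableOn.mono_set hki (sdiff_subset.trans hTS), ?_⟩
  have hset : ∀ ε : ℝ, ∫ y in boundaryPart Ω c x t \ Metric.ball x ε, boundaryKernel n c x t y
      ∂(Measure.hausdorffMeasure 1) =
      ∫ y, (boundaryPart Ω c x t \ Metric.ball x ε).indicator (boundaryKernel n c x t) y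
        ∂(arcLength Ω) := fun ε => by
    rw [integral_indicator (hTm.diff measurableSet_ball), arcLength,
      Measure.restrict_restrict (hTm.diff measurableSet_ball),
      inter_eq_left.2 (sdiff_subset.trans hTS)]
  simp_rw [hset]
  have hB : boundaryIntegral Ω n c x t =
      ∫ y, (boundaryPart Ω c x t).indicator (boundaryKernel n c x t) y ∂(arcLength Ω) := by
    rw [boundaryIntegral, indicator_of_mem (show t ∈ Ioi 0 from ht), frontIntegral, ← integral_neg]
    refine integral_congr_ae ?_
    filter_upwards [hk, ae_mem_frontier hΩ] with y hy hyS
    by_cases hyT : y ∈ boundaryPart Ω c x t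
    · rw [indicator_of_mem hyT, hy]
    · have : c * t ≤ ‖y - x‖ := by
        rw [norm_sub_rev]
        exact not_lt.1 fun h => hyT ⟨hyS, h⟩
      rw [indicator_of_notMem hyT, frontKernel_of_le hτ.le this, zero_mul, neg_zero]
  rw [hB]
  refine tendsto_integral_filter_of_dominated_convergence (fun y => |boundaryKernel n c x t y|)
    (Eventually.of_forall fun ε => hki.1.indicator (hTm.diff measurableSet_ball))
    (Eventually.of_forall fun ε => Eventually.of_forall fun y => norm_indicator_le_norm_self _ _)
    hki.abs ?_
  filter_upwards [ae_arcLength_ne x] with y hy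
  refine tendsto_const_nhds.congr' ?_
  have hpos : 0 < dist y x := dist_pos.2 hy
  filter_upwards [mem_nhdsWithin_of_mem_nhds (gt_mem_nhds hpos)] with ε hε
  have hyε : y ∉ Metric.ball x ε := fun h => (lt_irrefl _ ((Metric.mem_ball.1 h).trans hε))
  by_cases hyT : y ∈ boundaryPart Ω c x t
  · rw [indicator_of_mem hyT, indicator_of_mem
      (show y ∈ boundaryPart Ω c x t \ Metric.ball x ε from ⟨hyT, hyε⟩)]
  · rw [indicator_of_notMem hyT, indicator_of_notMem fun h => hyT h.1]

lemma gaussFormulaAt_of_transversal (hc : 0 < c) (x : Plane) {t : ℝ} (ht : t ≠ 0)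
    (htr : FrontTransversal Ω n c x t) :
    GaussFormulaAt Ω n c x t (boundaryIntegral Ω n c x t) := by
  rcases lt_or_gt_of_ne ht with h | h
  · have hB : boundaryIntegral Ω n c x t = 0 :=
      indicator_of_notMem (show t ∉ Ioi (0 : ℝ) from not_lt.2 h.le) _
    rw [hB]
    refine ⟨?_, 0, ?_, ?_⟩
    · rw [boundaryPart_eq_empty hc x h.le]
      simp only [HasPrincipalValue, empty_sdiff, setIntegral_empty]
      exact ⟨fun ε _ => integrableOn_empty, tendsto_const_nhds⟩
    · refine (hasDerivAt_const t (0 : ℝ)).congr_of_eventuallyEq ?_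
      filter_upwards [gt_mem_nhds h] with s hs
      exact areaIntegral_of_nonpos hc x hs.le
    · simp [heavisideHalf, h.not_gt, h.ne]
  · have hτ : 0 < c * t := mul_pos hc h
    obtain ⟨hi, hcont⟩ := integrable_and_continuousAt_frontIntegral hΩ x hτ fun y hy hyt => by
      rw [← neg_sub, inner_neg_left, neg_ne_zero]
      exact htr y hy (by rwa [norm_sub_rev])
    refine ⟨hasPrincipalValue_boundaryIntegral hΩ x hc h hi, c * areaRate Ω n c x t, ?_, ?_⟩
    · have hca : ContinuousAt (areaRate Ω n c x) t := by
        have h1 : ContinuousAt (fun s => 2 * Real.pi * domainIndicator Ω x -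
            frontIntegral Ω n x (c * s)) t :=
          continuousAt_const.sub (ContinuousAt.comp (f := fun s => c * s) hcont (by fun_prop))
        refine h1.congr ?_
        filter_upwards [lt_mem_nhds h] with s hs
        rw [areaRate, indicator_of_mem (show s ∈ Ioi (0 : ℝ) from hs)]
      have hloc := locallyIntegrable_areaRate hΩ hc x
      have h2 : HasDerivAt (fun s => ∫ u in (0 : ℝ)..s, areaRate Ω n c x u)
          (areaRate Ω n c x t) t :=
        intervalIntegral.integral_hasDerivAt_right
          (hloc.integrableOn_isCompact isCompact_uIcc).intervalIntegrable
          (hloc.aestronglyMeasurable.stronglyMeasurableAtFilter) hca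
      exact (h2.const_mul c).congr_of_eventuallyEq
        (Eventually.of_forall fun s => areaIntegral_eq hΩ hc x s)
    · have hmem : t ∈ Ioi (0 : ℝ) := h
      rw [boundaryIntegral, areaRate, indicator_of_mem hmem, indicator_of_mem hmem, heavisideHalf,
        if_pos h]
      field_simp
      ring

end

theorem lemma5p1 (c : ℝ) (hc : 0 < c) (Ω : Set Plane) (n : Plane → Plane)
    (hΩ : IsLyapunovDomain Ω n) (x : Plane) :
    -- the area integral converges absolutely
    (∀ t : ℝ, IntegrableOn (areaKernel c x t) (domainPart Ω c x t)) ∧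
    -- `B t` is the principal value integral over `S_t(x)`
    ∃ B : ℝ → ℝ,
      -- the formula at every `t ≠ 0` at which the front is nowhere tangent to the boundary
      (∀ t : ℝ, t ≠ 0 → FrontTransversal Ω n c x t → GaussFormulaAt Ω n c x t (B t)) ∧
      -- such `t` are almost all `t`, so the formula holds for almost every `t`
      (∀ᵐ t : ℝ, FrontTransversal Ω n c x t ∧ GaussFormulaAt Ω n c x t (B t)) ∧
      -- the formula in the sense of generalized functions of `t`
      LocallyIntegrable B ∧
      LocallyIntegrable (areaIntegral Ω c x) ∧
      (∀ φ : ℝ → ℝ, ContDiff ℝ ∞ φ → HasCompactSupport φ →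
        -(∫ t, B t * φ t) - 1 / c * (∫ t, areaIntegral Ω c x t * deriv φ t) =
          2 * Real.pi * domainIndicator Ω x * ∫ t, heavisideHalf t * φ t) := by
  have hlocB := locallyIntegrable_boundaryIntegral hΩ hc x
  have hlocR := locallyIntegrable_areaRate hΩ hc x
  refine ⟨integrableOn_areaKernel hc x, boundaryIntegral Ω n c x,
    fun t ht htr => gaussFormulaAt_of_transversal hΩ hc x ht htr, ?_, hlocB, ?_, ?_⟩
  · filter_upwards [ae_frontTransversal hΩ hc x, Measure.ae_ne volume (0 : ℝ)] with t htr ht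
    exact ⟨htr, gaussFormulaAt_of_transversal hΩ hc x ht htr⟩
  · have hcont : Continuous (areaIntegral Ω c x) := by
      rw [show areaIntegral Ω c x = _ from funext (areaIntegral_eq hΩ hc x)]
      exact continuous_const.mul (intervalIntegral.continuous_primitive
        (fun a b => (hlocR.integrableOn_isCompact isCompact_uIcc).intervalIntegrable) 0)
    exact hcont.locallyIntegrable
  · intro φ hφ hφc
    have hφ1 : ContDiff ℝ 1 φ := hφ.of_le (by exact_mod_cast le_top)
    have h1 : ∫ t, areaIntegral Ω c x t * deriv φ t = -(c * ∫ t, areaRate Ω n c x t * φ t) := by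
      simp_rw [areaIntegral_eq hΩ hc x, mul_assoc]
      rw [integral_const_mul, integral_primitive_mul_deriv hlocR hφ1 hφc, mul_neg]
    have hiB : Integrable fun t => boundaryIntegral Ω n c x t * φ t :=
      hlocB.integrable_smul_right_of_hasCompactSupport hφ.continuous hφc
    have hiR : Integrable fun t => areaRate Ω n c x t * φ t :=
      hlocR.integrable_smul_right_of_hasCompactSupport hφ.continuous hφc
    have h2 : 2 * Real.pi * domainIndicator Ω x * ∫ t, heavisideHalf t * φ t =
        ∫ t, (areaRate Ω n c x t * φ t - boundaryIntegral Ω n c x t * φ t) := by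
      rw [← integral_const_mul]
      refine integral_congr_ae ?_
      filter_upwards [Measure.ae_ne volume (0 : ℝ)] with t ht
      rcases lt_or_gt_of_ne ht with h | h
      · have hmem : t ∉ Ioi (0 : ℝ) := not_lt.2 h.le
        rw [boundaryIntegral, areaRate, indicator_of_notMem hmem, indicator_of_notMem hmem,
          heavisideHalf, if_neg h.not_gt, if_neg h.ne]
        ring
      · have hmem : t ∈ Ioi (0 : ℝ) := h
        rw [boundaryIntegral, areaRate, indicator_of_mem hmem, indicator_of_mem hmem, heavisideHalf,
          if_pos h]
        ring
    rw [h1, h2, integral_sub hiR hiB]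
    field_simp
    ring

end
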